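/- Let $d\ge 2$, $l>0$, $a>0$, and let $\Omega=\mathbb{R}^{d-1}\times\,]0,l[\,$, with points $(x,y)$. Let $H_a=-\Delta$ on $L^2(\Omega)$ with domain $\{u\in H^2(\Omega): \partial_\nu u=iau \text{ on }\partial\Omega\}$ ($\partial_\nu$ is the outward normal derivative, in the sense of traces), let $T_a=-\frac{d^2}{dy^2}$ on $L^2(0,l)$ with domain $\{v\in H^2(0,l): v'(0)=-iav(0),\ v'(l)=iav(l)\}$, and let $-\Delta_x$ be the Laplacian on $L^2(\mathbb{R}^{d-1})$ with domain $H^2(\mathbb{R}^{d-1})$. For every $n\in\mathbb{N}$ there is exactly one $\lambda_n(a)\in\mathbb{C}$ with $\frac{n\pi}{l}<\operatorname{Re}\lambda_n(a)<\frac{(n+1)\pi}{l}$ such that $\lambda_n(a)^2$ is an eigenvalue of $T_a$; the set of eigenvalues of $T_a$ is $\{\lambda_n(a)^2: n\in\mathbb{N}\}$; and the functions $$\varphi_n(y)=A_n\Big(e^{i\lambda_n(a)y}+\frac{\lambda_n(a)+a}{\lambda_n(a)-a}\,e^{-i\lambda_n(a)y}\Big),\qquad A_n>0,\quad \|\varphi_n\|_{L^2(0,l)}=1,$$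 form a Riesz basis of $L^2(0,l)$ (the image of an orthonormal basis under a bounded operator with bounded inverse). Let $(\varphi_n^*)$ be its dual basis, so that $\langle\varphi_j,\varphi_k^*\rangle=\delta_{jk}$. For $u\in L^2(\Omega)$ let $u_n\in L^2(\mathbb{R}^{d-1})$ be $u_n(x)=\int_0^l u(x,y)\overline{\varphi_n^*(y)}\,dy$, and let $\mathfrak{S}_a=\{\lambda_n(a)^2+r: n\in\mathbb{N},\ r\ge 0\}$. Then the following hold. (i) If $u\in\mathrm{Dom}(H_a)$, then $u_n\in H^2(\mathbb{R}^{d-1})$ for all $n$, and in $L^2(\Omega)$ $$H_au=\sum_{n\in\mathbb{N}}\big(-\Delta_x+\lambda_n(a)^2\big)u_n\otimes\varphi_n .$$ (ii) Every $z\in\mathbb{C}\setminus\mathfrak{S}_a$ is in the resolvent set of $H_a$; for each $n$ the operator $-\Delta_x+\lambda_n(a)^2-z$ has a bounded inverse on $L^2(\mathbb{R}^{d-1})$; and for all $u\in L^2(\Omega)$, in $L^2(\Omega)$, $$(H_a-z)^{-1}u=\sum_{n\in\mathbb{N}}\big(-\Delta_x+\lambda_n(a)^2-z\big)^{-1}u_n\otimes\varphi_n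 .$$ Moreover there is $C\ge 0$ such that for all $z\in\mathbb{C}\setminus\mathfrak{S}_a$ and $u\in L^2(\Omega)$ $$\|(H_a-z)^{-1}u\|_{L^2(\Omega)}\le\frac{C}{\operatorname{dist}(z,\mathfrak{S}_a)}\,\|u\|_{L^2(\Omega)} .$$ (iii) There are $\tilde\gamma>0$ and $C\ge 0$ such that every $z\in\mathbb{C}$ with $\operatorname{Im}z\ge-\tilde\gamma$ is in the resolvent set of $H_a$ and $\|(H_a-z)^{-1}\|_{\mathcal{L}(L^2(\Omega))}\le C$. All series converge unconditionally. -/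

import Mathlib

open MeasureTheory Set Filter Topology
open scoped ENNReal ContDiff InnerProductSpace

noncomputable section

namespace Waveguide

/-! ## Unbounded operators on a Hilbert space: eigenvalues, resolvent set, resolvent -/

section Operators

variable {H : Type*} [NormedAddCommGroup H] [InnerProductSpace ℂ H]

/-- `μ` is an eigenvalue of the (partially defined) operator `T`. -/
def IsEigenvalue (T : H →ₗ.[ℂ] H) (μ : ℂ) : Prop :=
  ∃ u : T.domain, u ≠ 0 ∧ T u = μ • (u : H)

/-- The bounded operator `R` is the inverse of `T - z : Dom(T) → H`. -/
def IsResolventAt (T : H →ₗ.[ℂ] H) (z : ℂ) (R : H →L[ℂ] H) : Prop :=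
  (∀ f : H, ∃ h : R f ∈ T.domain, T ⟨R f, h⟩ - z • R f = f) ∧
    ∀ u : T.domain, R (T u - z • (u : H)) = u

/-- The resolvent set: those `z` for which `T - z` has a bounded, everywhere defined inverse. -/
def opResolventSet (T : H →ₗ.[ℂ] H) : Set ℂ := {z | ∃ R : H →L[ℂ] H, IsResolventAt T z R}

open Classical in
/-- The resolvent `(T - z)⁻¹` for `z` in the resolvent set (and `0` otherwise). -/
def opResolvent (T : H →ₗ.[ℂ] H) (z : ℂ) : H →L[ℂ] H :=
  if h : ∃ R : H →L[ℂ] H, IsResolventAt T z R then h.choose else 0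

/-- `(T - z)⁻¹` is the only operator inverting `T - z`. -/
theorem IsResolventAt.opResolvent_eq {T : H →ₗ.[ℂ] H} {z : ℂ} {R : H →L[ℂ] H}
    (hR : IsResolventAt T z R) : opResolvent T z = R := by
  have h : ∃ R : H →L[ℂ] H, IsResolventAt T z R := ⟨R, hR⟩
  have hres : opResolvent T z = h.choose := dif_pos h
  rw [hres]
  ext f
  obtain ⟨hf, hf'⟩ := hR.1 f
  have h2 := h.choose_spec.2 ⟨R f, hf⟩
  rw [hf'] at h2
  exact h2

end Operators

/-! ## Riesz bases -/

section Riesz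

variable {H : Type*} [NormedAddCommGroup H] [InnerProductSpace ℂ H] [CompleteSpace H]

/-- `φ = Θ e` for an orthonormal basis `e` and a bounded operator `Θ` with bounded inverse. -/
def IsRieszBasis (φ : ℕ → H) : Prop :=
  ∃ p : (H ≃L[ℂ] H) × HilbertBasis ℕ ℂ H, ∀ n, φ n = p.1 (p.2 n)

open Classical in
/-- The dual basis `φ*_n = (Θ⁻¹)* e_n` of the Riesz basis `φ = Θ e` (it does not depend on the
choice of `Θ` and `e`); `0` if `φ` is not a Riesz basis. -/
def dualBasis (φ : ℕ → H) : ℕ → H :=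
  if h : IsRieszBasis φ then
    fun n => ContinuousLinearMap.adjoint (h.choose.1.symm : H →L[ℂ] H) (h.choose.2 n)
  else 0

/-- The dual basis is biorthogonal to the Riesz basis. -/
theorem inner_dualBasis {φ : ℕ → H} (h : IsRieszBasis φ) (j k : ℕ) :
    ⟪dualBasis φ k, φ j⟫_ℂ = if k = j then 1 else 0 := by
  have hd : dualBasis φ = fun n =>
      ContinuousLinearMap.adjoint (h.choose.1.symm : H →L[ℂ] H) (h.choose.2 n) := dif_pos h
  rw [hd, h.choose_spec j]
  simp only [ContinuousLinearMap.adjoint_inner_left, ContinuousLinearEquiv.coe_coe,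
    ContinuousLinearEquiv.symm_apply_apply]
  exact orthonormal_iff_ite.mp h.choose.2.orthonormal k j

end Riesz

/-! ## `L²`, weak derivatives and Sobolev spaces on a subset of a Euclidean space -/

section Sobolev

variable {E : Type*} [NormedAddCommGroup E] [NormedSpace ℝ E] [MeasureSpace E]

/-- The Hilbert space `L²(Ω)` of complex valued functions, for the Lebesgue measure. -/
abbrev L2 (Ω : Set E) : Type _ := Lp ℂ 2 (volume.restrict Ω)

/-- `w` is the weak derivative of `u` on `Ω` in the direction `v`. -/
def HasWeakDeriv (Ω : Set E) (v : E) (u w : L2 Ω) : Prop :=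
  ∀ φ : E → ℝ, ContDiff ℝ ∞ φ → HasCompactSupport φ → tsupport φ ⊆ Ω →
    ∫ x in Ω, (fderiv ℝ φ x v) • u x = -∫ x in Ω, φ x • w x

open Classical in
/-- The weak derivative in the direction `v`, when it exists in `L²(Ω)` (and `0` otherwise). -/
def weakDeriv (Ω : Set E) (v : E) (u : L2 Ω) : L2 Ω :=
  if h : ∃ w, HasWeakDeriv Ω v u w then h.choose else 0

theorem HasWeakDeriv.smul {Ω : Set E} {v : E} {u w : L2 Ω} (c : ℂ) (h : HasWeakDeriv Ω v u w) :
    HasWeakDeriv Ω v (c • u) (c • w) := by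
  intro φ h1 h2 h3
  have e1 : ∫ x in Ω, (fderiv ℝ φ x v) • (c • u) x
      = c • ∫ x in Ω, (fderiv ℝ φ x v) • u x := by
    rw [← integral_smul]
    refine integral_congr_ae ?_
    filter_upwards [Lp.coeFn_smul c u] with x hx
    rw [hx, Pi.smul_apply, smul_comm]
  have e2 : ∫ x in Ω, φ x • (c • w) x = c • ∫ x in Ω, φ x • w x := by
    rw [← integral_smul]
    refine integral_congr_ae ?_
    filter_upwards [Lp.coeFn_smul c w] with x hx
    rw [hx, Pi.smul_apply, smul_comm]
  rw [e1, e2, h φ h1 h2 h3, smul_neg]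

theorem hasWeakDeriv_zero (Ω : Set E) (v : E) : HasWeakDeriv Ω v 0 0 := by
  intro φ _ _ _
  have h0 : ∀ᵐ x ∂(volume.restrict Ω), (0 : L2 Ω) x = 0 := Lp.coeFn_zero ..
  have e1 : ∫ x in Ω, (fderiv ℝ φ x v) • (0 : L2 Ω) x = 0 :=
    integral_eq_zero_of_ae (h0.mono fun x hx => by
      change _ • (0 : L2 Ω) x = 0
      rw [hx, smul_zero])
  have e2 : ∫ x in Ω, φ x • (0 : L2 Ω) x = 0 :=
    integral_eq_zero_of_ae (h0.mono fun x hx => by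
      change _ • (0 : L2 Ω) x = 0
      rw [hx, smul_zero])
  rw [e1, e2, neg_zero]

variable [BorelSpace E] [FiniteDimensional ℝ E] [IsLocallyFiniteMeasure (volume : Measure E)]

theorem integrable_smul_L2 {Ω : Set E} {g : E → ℝ} (hg : Continuous g) (hc : HasCompactSupport g)
    (u : L2 Ω) : Integrable (fun x => g x • u x) (volume.restrict Ω) := by
  have h1 : MemLp g 2 (volume.restrict Ω) :=
    (hg.memLp_of_hasCompactSupport hc).restrict Ω
  have h2 : MemLp (fun x => g x • u x) 1 (volume.restrict Ω) := (Lp.memLp u).smul h1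
  exact memLp_one_iff_integrable.mp h2

theorem integrable_fderiv_smul_L2 {Ω : Set E} {g : E → ℝ} (hg : ContDiff ℝ ∞ g)
    (hc : HasCompactSupport g) (v : E) (u : L2 Ω) :
    Integrable (fun x => (fderiv ℝ g x v) • u x) (volume.restrict Ω) :=
  integrable_smul_L2 ((hg.continuous_fderiv (by simp)).clm_apply continuous_const)
    (hc.fderiv_apply (𝕜 := ℝ) v) u

theorem HasWeakDeriv.add {Ω : Set E} {v : E} {u u' w w' : L2 Ω} (h : HasWeakDeriv Ω v u w)
    (h' : HasWeakDeriv Ω v u' w') : HasWeakDeriv Ω v (u + u') (w + w') := by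
  intro φ h1 h2 h3
  have e1 : ∫ x in Ω, (fderiv ℝ φ x v) • (u + u') x
      = (∫ x in Ω, (fderiv ℝ φ x v) • u x) + ∫ x in Ω, (fderiv ℝ φ x v) • u' x := by
    rw [← integral_add (integrable_fderiv_smul_L2 h1 h2 v u)
      (integrable_fderiv_smul_L2 h1 h2 v u')]
    refine integral_congr_ae ?_
    filter_upwards [Lp.coeFn_add u u'] with x hx
    rw [hx, Pi.add_apply, smul_add]
  have e2 : ∫ x in Ω, φ x • (w + w') x
      = (∫ x in Ω, φ x • w x) + ∫ x in Ω, φ x • w' x := by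
    rw [← integral_add (integrable_smul_L2 h1.continuous h2 w)
      (integrable_smul_L2 h1.continuous h2 w')]
    refine integral_congr_ae ?_
    filter_upwards [Lp.coeFn_add w w'] with x hx
    rw [hx, Pi.add_apply, smul_add]
  rw [e1, e2, h φ h1 h2 h3, h' φ h1 h2 h3]
  ring

theorem HasWeakDeriv.unique {Ω : Set E} (hΩ : IsOpen Ω) {v : E} {u w w' : L2 Ω}
    (h : HasWeakDeriv Ω v u w) (h' : HasWeakDeriv Ω v u w') : w = w' := by
  have key : ∀ᵐ x ∂(volume : Measure E), x ∈ Ω → (w x - w' x) = 0 := by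
    refine hΩ.ae_eq_zero_of_integral_contDiff_smul_eq_zero ?_ ?_
    · refine locallyIntegrableOn_of_locallyIntegrable_restrict ?_
      exact ((Lp.memLp w).locallyIntegrable (by norm_num)).sub
        ((Lp.memLp w').locallyIntegrable (by norm_num))
    · intro g h1 h2 h3
      have e : ∫ x in Ω, g x • (w x - w' x) = 0 := by
        simp only [smul_sub]
        rw [integral_sub (integrable_smul_L2 h1.continuous h2 w)
          (integrable_smul_L2 h1.continuous h2 w')]
        have a1 := h g h1 h2 h3
        have a2 := h' g h1 h2 h3
        rw [a1] at a2
        rw [neg_injective a2, sub_self]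
      rw [← e, setIntegral_eq_integral_of_forall_compl_eq_zero]
      intro x hx
      rw [image_eq_zero_of_notMem_tsupport (fun hx' => hx (h3 hx')), zero_smul]
  refine Lp.ext ?_
  rw [Filter.EventuallyEq, ae_restrict_iff' hΩ.measurableSet]
  filter_upwards [key] with x hx hxΩ
  exact sub_eq_zero.mp (hx hxΩ)

theorem HasWeakDeriv.weakDeriv_eq {Ω : Set E} (hΩ : IsOpen Ω) {v : E} {u w : L2 Ω}
    (h : HasWeakDeriv Ω v u w) : weakDeriv Ω v u = w := by
  have hex : ∃ w, HasWeakDeriv Ω v u w := ⟨w, h⟩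
  have he : weakDeriv Ω v u = hex.choose := dif_pos hex
  rw [he]
  exact hex.choose_spec.unique hΩ h

/-- The Sobolev space `H¹(Ω)`: all first order weak derivatives belong to `L²(Ω)`. -/
def H1 (Ω : Set E) : Submodule ℂ (L2 Ω) where
  carrier := {u | ∀ v, ∃ w, HasWeakDeriv Ω v u w}
  add_mem' := fun hu hu' v => by
    obtain ⟨w, hw⟩ := hu v
    obtain ⟨w', hw'⟩ := hu' v
    exact ⟨w + w', hw.add hw'⟩
  zero_mem' := fun v => ⟨0, hasWeakDeriv_zero Ω v⟩
  smul_mem' := fun c _ hu v => by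
    obtain ⟨w, hw⟩ := hu v
    exact ⟨c • w, hw.smul c⟩

/-- The Sobolev space `H²(Ω)`: all weak derivatives of order at most two belong to `L²(Ω)`. -/
def H2 (Ω : Set E) : Submodule ℂ (L2 Ω) where
  carrier := {u | ∀ v, ∃ w ∈ H1 Ω, HasWeakDeriv Ω v u w}
  add_mem' := fun hu hu' v => by
    obtain ⟨w, hm, hw⟩ := hu v
    obtain ⟨w', hm', hw'⟩ := hu' v
    exact ⟨w + w', (H1 Ω).add_mem hm hm', hw.add hw'⟩
  zero_mem' := fun v => ⟨0, (H1 Ω).zero_mem, hasWeakDeriv_zero Ω v⟩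
  smul_mem' := fun c _ hu v => by
    obtain ⟨w, hm, hw⟩ := hu v
    exact ⟨c • w, (H1 Ω).smul_mem c hm, hw.smul c⟩

theorem H2_le_H1 (Ω : Set E) : H2 Ω ≤ H1 Ω := fun _ hu v => by
  obtain ⟨w, _, hw⟩ := hu v
  exact ⟨w, hw⟩

theorem hasWeakDeriv_weakDeriv {Ω : Set E} {u : L2 Ω} (hu : u ∈ H1 Ω) (v : E) :
    HasWeakDeriv Ω v u (weakDeriv Ω v u) := by
  have he : weakDeriv Ω v u = (hu v).choose := dif_pos (hu v)
  rw [he]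
  exact (hu v).choose_spec

theorem weakDeriv_mem_H1 {Ω : Set E} (hΩ : IsOpen Ω) {u : L2 Ω} (hu : u ∈ H2 Ω) (v : E) :
    weakDeriv Ω v u ∈ H1 Ω := by
  obtain ⟨w, hm, hw⟩ := hu v
  rw [hw.weakDeriv_eq hΩ]
  exact hm

theorem weakDeriv_add {Ω : Set E} (hΩ : IsOpen Ω) {u u' : L2 Ω} (hu : u ∈ H1 Ω) (hu' : u' ∈ H1 Ω)
    (v : E) : weakDeriv Ω v (u + u') = weakDeriv Ω v u + weakDeriv Ω v u' :=
  ((hasWeakDeriv_weakDeriv hu v).add (hasWeakDeriv_weakDeriv hu' v)).weakDeriv_eq hΩ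

theorem weakDeriv_smul {Ω : Set E} (hΩ : IsOpen Ω) {u : L2 Ω} (hu : u ∈ H1 Ω) (c : ℂ)
    (v : E) : weakDeriv Ω v (c • u) = c • weakDeriv Ω v u :=
  ((hasWeakDeriv_weakDeriv hu v).smul c).weakDeriv_eq hΩ

theorem weakDeriv_weakDeriv_add {Ω : Set E} (hΩ : IsOpen Ω) {u u' : L2 Ω} (hu : u ∈ H2 Ω)
    (hu' : u' ∈ H2 Ω) (v : E) : weakDeriv Ω v (weakDeriv Ω v (u + u'))
      = weakDeriv Ω v (weakDeriv Ω v u) + weakDeriv Ω v (weakDeriv Ω v u') := by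
  rw [weakDeriv_add hΩ (H2_le_H1 Ω hu) (H2_le_H1 Ω hu'),
    weakDeriv_add hΩ (weakDeriv_mem_H1 hΩ hu v) (weakDeriv_mem_H1 hΩ hu' v)]

theorem weakDeriv_weakDeriv_smul {Ω : Set E} (hΩ : IsOpen Ω) {u : L2 Ω} (hu : u ∈ H2 Ω)
    (c : ℂ) (v : E) : weakDeriv Ω v (weakDeriv Ω v (c • u))
      = c • weakDeriv Ω v (weakDeriv Ω v u) := by
  rw [weakDeriv_smul hΩ (H2_le_H1 Ω hu), weakDeriv_smul hΩ (weakDeriv_mem_H1 hΩ hu v)]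

end Sobolev

/-! ## The Laplacian on `ℝᵐ` -/

section FreeLaplacian

open scoped Laplacian

/-- `ℝᵐ` with its Euclidean structure. -/
abbrev Euc (m : ℕ) : Type := EuclideanSpace ℝ (Fin m)

/-- The Hilbert space `L²(ℝᵐ)`. -/
abbrev L2Euc (m : ℕ) : Type := Lp ℂ 2 (volume : Measure (Euc m))

theorem exists_laplacian {m : ℕ} {u : L2Euc m}
    (hu : TemperedDistribution.MemSobolev 2 2 (u : TemperedDistribution (Euc m) ℂ)) :
    ∃ f : L2Euc m, Δ (u : TemperedDistribution (Euc m) ℂ) = f := by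
  have h := hu.laplacian
  rw [sub_self] at h
  exact TemperedDistribution.memSobolev_zero_iff.mp h

theorem toTemperedDistribution_injective (m : ℕ) :
    Function.Injective (Lp.toTemperedDistributionCLM ℂ (volume : Measure (Euc m)) 2) :=
  LinearMap.ker_eq_bot.mp Lp.ker_toTemperedDistributionCLM_eq_bot

theorem coe_add_L2Euc {m : ℕ} (u v : L2Euc m) :
    ((u + v : L2Euc m) : TemperedDistribution (Euc m) ℂ)
      = (u : TemperedDistribution (Euc m) ℂ) + (v : TemperedDistribution (Euc m) ℂ) :=
  map_add (Lp.toTemperedDistributionCLM ℂ (volume : Measure (Euc m)) 2) u v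

theorem coe_smul_L2Euc {m : ℕ} (c : ℂ) (u : L2Euc m) :
    ((c • u : L2Euc m) : TemperedDistribution (Euc m) ℂ)
      = c • (u : TemperedDistribution (Euc m) ℂ) :=
  map_smul (Lp.toTemperedDistributionCLM ℂ (volume : Measure (Euc m)) 2) c u

theorem coe_zero_L2Euc (m : ℕ) : ((0 : L2Euc m) : TemperedDistribution (Euc m) ℂ) = 0 :=
  map_zero (Lp.toTemperedDistributionCLM ℂ (volume : Measure (Euc m)) 2)

/-- The Sobolev space `H²(ℝᵐ)`. -/
def H2Euc (m : ℕ) : Submodule ℂ (L2Euc m) where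
  carrier := {u | TemperedDistribution.MemSobolev 2 2 (u : TemperedDistribution (Euc m) ℂ)}
  add_mem' := fun {u u'} hu hu' => by
    have h := TemperedDistribution.MemSobolev.add hu hu'
    rw [← coe_add_L2Euc] at h
    exact h
  zero_mem' := by
    have h := TemperedDistribution.memSobolev_fun_zero (Euc m) ℂ 2 2
    rw [← coe_zero_L2Euc] at h
    exact h
  smul_mem' := fun c u hu => by
    have h := TemperedDistribution.MemSobolev.smul c hu
    rw [← coe_smul_L2Euc] at h
    exact h

/-- The Laplacian `Δ u ∈ L²(ℝᵐ)`, in the sense of distributions, of `u ∈ H²(ℝᵐ)`. -/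
def laplacianEuc {m : ℕ} (u : H2Euc m) : L2Euc m := (exists_laplacian u.2).choose

theorem coe_laplacianEuc {m : ℕ} (u : H2Euc m) :
    (laplacianEuc u : TemperedDistribution (Euc m) ℂ)
      = Δ ((u : L2Euc m) : TemperedDistribution (Euc m) ℂ) :=
  (exists_laplacian u.2).choose_spec.symm

theorem laplacianEuc_add {m : ℕ} (u v : H2Euc m) :
    laplacianEuc (u + v) = laplacianEuc u + laplacianEuc v := by
  apply toTemperedDistribution_injective m
  change (laplacianEuc (u + v) : TemperedDistribution (Euc m) ℂ)
    = ((laplacianEuc u + laplacianEuc v : L2Euc m) : TemperedDistribution (Euc m) ℂ)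
  rw [coe_add_L2Euc, coe_laplacianEuc, coe_laplacianEuc, coe_laplacianEuc, Submodule.coe_add,
    coe_add_L2Euc]
  rw [← TemperedDistribution.laplacianCLM_apply, ← TemperedDistribution.laplacianCLM_apply,
    ← TemperedDistribution.laplacianCLM_apply, map_add]

theorem laplacianEuc_smul {m : ℕ} (c : ℂ) (u : H2Euc m) :
    laplacianEuc (c • u) = c • laplacianEuc u := by
  apply toTemperedDistribution_injective m
  change (laplacianEuc (c • u) : TemperedDistribution (Euc m) ℂ)
    = ((c • laplacianEuc u : L2Euc m) : TemperedDistribution (Euc m) ℂ)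
  rw [coe_smul_L2Euc, coe_laplacianEuc, coe_laplacianEuc, Submodule.coe_smul, coe_smul_L2Euc]
  rw [← TemperedDistribution.laplacianCLM_apply, ← TemperedDistribution.laplacianCLM_apply,
    map_smul]

/-- The operator `-Δ` on `L²(ℝᵐ)`, with domain `H²(ℝᵐ)`. -/
def negLaplacian (m : ℕ) : L2Euc m →ₗ.[ℂ] L2Euc m where
  domain := H2Euc m
  toFun :=
    { toFun := fun u => -laplacianEuc u
      map_add' := fun u u' => by rw [laplacianEuc_add, neg_add]
      map_smul' := fun c u => by rw [laplacianEuc_smul, smul_neg, RingHom.id_apply] }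

end FreeLaplacian

/-! ## The transverse operator on `]0, l[` -/

section Transverse

/-- The function `u` on `]0, l[` has a continuous representative on `[0, l]`, with value `u₀` at `0`
and `u₁` at `l`. -/
def HasEndValues (l : ℝ) (u : L2 (Ioo 0 l)) (u₀ u₁ : ℂ) : Prop :=
  ∃ f : ℝ → ℂ, Continuous f ∧ u =ᵐ[volume.restrict (Ioo 0 l)] f ∧ f 0 = u₀ ∧ f l = u₁

theorem HasEndValues.add {l : ℝ} {u u' : L2 (Ioo 0 l)} {a b a' b' : ℂ}
    (h : HasEndValues l u a b) (h' : HasEndValues l u' a' b') :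
    HasEndValues l (u + u') (a + a') (b + b') := by
  obtain ⟨f, hf, hu, h0, h1⟩ := h
  obtain ⟨f', hf', hu', h0', h1'⟩ := h'
  refine ⟨f + f', hf.add hf', ?_, by simp [h0, h0'], by simp [h1, h1']⟩
  filter_upwards [hu, hu', Lp.coeFn_add u u'] with x h1 h2 h3
  rw [h3, Pi.add_apply, Pi.add_apply, h1, h2]

theorem HasEndValues.smul {l : ℝ} {u : L2 (Ioo 0 l)} {a b : ℂ} (c : ℂ)
    (h : HasEndValues l u a b) : HasEndValues l (c • u) (c * a) (c * b) := by
  obtain ⟨f, hf, hu, h0, h1⟩ := h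
  refine ⟨c • f, hf.const_smul c, ?_, by simp [h0], by simp [h1]⟩
  filter_upwards [hu, Lp.coeFn_smul c u] with x h1 h2
  rw [h2, Pi.smul_apply, Pi.smul_apply, h1]

theorem hasEndValues_zero (l : ℝ) : HasEndValues l 0 0 0 :=
  ⟨0, continuous_const, Lp.coeFn_zero .., rfl, rfl⟩

/-- The transverse operator `T_a = -d²/dy²` on `L²(0, l)`, with domain
`{u ∈ H²(0, l) | u'(0) = - i a u(0), u'(l) = i a u(l)}`. -/
def transverseOp (l a : ℝ) : L2 (Ioo 0 l) →ₗ.[ℂ] L2 (Ioo 0 l) where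
  domain :=
    { carrier := {u | u ∈ H2 (Ioo 0 l) ∧ ∃ u₀ u₁ : ℂ, HasEndValues l u u₀ u₁ ∧
        HasEndValues l (weakDeriv (Ioo 0 l) 1 u) (-(Complex.I * a * u₀)) (Complex.I * a * u₁)}
      add_mem' := by
        rintro u u' ⟨hu, u₀, u₁, h1, h2⟩ ⟨hu', u₀', u₁', h1', h2'⟩
        refine ⟨(H2 _).add_mem hu hu', u₀ + u₀', u₁ + u₁', h1.add h1', ?_⟩
        rw [weakDeriv_add isOpen_Ioo (H2_le_H1 _ hu) (H2_le_H1 _ hu')]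
        convert h2.add h2' using 1 <;> ring
      zero_mem' := by
        refine ⟨(H2 _).zero_mem, 0, 0, hasEndValues_zero l, ?_⟩
        rw [(hasWeakDeriv_zero _ _).weakDeriv_eq isOpen_Ioo]
        simpa using hasEndValues_zero l
      smul_mem' := by
        rintro c u ⟨hu, u₀, u₁, h1, h2⟩
        refine ⟨(H2 _).smul_mem c hu, c * u₀, c * u₁, h1.smul c, ?_⟩
        rw [weakDeriv_smul isOpen_Ioo (H2_le_H1 _ hu)]
        convert h2.smul c using 1 <;> ring }
  toFun :=
    { toFun := fun u => -weakDeriv (Ioo 0 l) 1 (weakDeriv (Ioo 0 l) 1 (u : L2 (Ioo 0 l)))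
      map_add' := fun u u' => by
        rw [Submodule.coe_add, weakDeriv_weakDeriv_add isOpen_Ioo u.2.1 u'.2.1, neg_add]
      map_smul' := fun c u => by
        rw [Submodule.coe_smul, weakDeriv_weakDeriv_smul isOpen_Ioo u.2.1, smul_neg,
          RingHom.id_apply] }

/-- `lam` is a square root of an eigenvalue of `T_a` with real part in `]nπ/l, (n+1)π/l[`. -/
def IsTransverseRoot (l a : ℝ) (n : ℕ) (lam : ℂ) : Prop :=
  n * (Real.pi / l) < lam.re ∧ lam.re < (n + 1) * (Real.pi / l) ∧
    IsEigenvalue (transverseOp l a) (lam ^ 2)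

/-- For `a > 0`, the number `λ_n(a)`: the square root of an eigenvalue of `T_a` with real part in
`]nπ/l, (n+1)π/l[`. -/
def transverseRoot (l a : ℝ) (n : ℕ) : ℂ := Classical.epsilon (IsTransverseRoot l a n)

/-- The function `e^{i λ y} + (λ + a) / (λ - a) e^{-i λ y}`. -/
def modeFun (a : ℝ) (lam : ℂ) (y : ℝ) : ℂ :=
  Complex.exp (Complex.I * lam * y) + (lam + a) / (lam - a) * Complex.exp (-(Complex.I * lam * y))

theorem memLp_modeFun (l a : ℝ) (lam : ℂ) :
    MemLp (modeFun a lam) 2 (volume.restrict (Ioo 0 l)) := by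
  have hc : Continuous (modeFun a lam) := by unfold modeFun; fun_prop
  obtain ⟨C, hC⟩ := isCompact_Icc.exists_bound_of_continuousOn (s := Icc 0 l) hc.continuousOn
  refine MemLp.of_bound hc.aestronglyMeasurable C ?_
  filter_upwards [ae_restrict_mem measurableSet_Ioo] with y hy
  exact hC y (Ioo_subset_Icc_self hy)

/-- The eigenfunction `φ_n(a) = A_n(a) (e^{i λ_n y} + (λ_n + a) / (λ_n - a) e^{-i λ_n y})`,
normalized in `L²(0, l)` with `A_n(a) > 0`. -/
def transverseMode (l a : ℝ) (n : ℕ) : L2 (Ioo 0 l) :=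
  ((‖(memLp_modeFun l a (transverseRoot l a n)).toLp‖⁻¹ : ℝ) : ℂ) •
    (memLp_modeFun l a (transverseRoot l a n)).toLp

end Transverse

/-! ## The waveguide -/

section Guide

/-- The straight waveguide `ℝᵐ × ]0, l[`. -/
def guide (m : ℕ) (l : ℝ) : Set (Euc m × ℝ) := univ ×ˢ Ioo 0 l

theorem isOpen_guide (m : ℕ) (l : ℝ) : IsOpen (guide m l) := isOpen_univ.prod isOpen_Ioo

theorem restrict_guide (m : ℕ) (l : ℝ) : (volume : Measure (Euc m × ℝ)).restrict (guide m l)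
    = (volume : Measure (Euc m)).prod (volume.restrict (Ioo 0 l)) := by
  rw [guide, Measure.volume_eq_prod, ← Measure.prod_restrict, Measure.restrict_univ]

/-- The `j`-th unit vector of the unbounded directions. -/
def dirX (m : ℕ) (j : Fin m) : Euc m × ℝ := (EuclideanSpace.single j 1, 0)

/-- The unit vector of the bounded direction. -/
def dirY (m : ℕ) : Euc m × ℝ := (0, 1)

/-- For `u ∈ H¹(Ω)`: the traces of `u` on the two sides `ℝᵐ × {0}` and `ℝᵐ × {l}` of `∂Ω` are `g₀`
and `g₁`. The traces are characterized by Green's formula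
`∫_Ω (∂_y φ) u + ∫_Ω φ ∂_y u = ∫ φ(x, l) g₁(x) dx - ∫ φ(x, 0) g₀(x) dx`
for all smooth compactly supported functions `φ` on the whole space. -/
def HasTraces (m : ℕ) (l : ℝ) (u : L2 (guide m l)) (g₀ g₁ : L2Euc m) : Prop :=
  ∀ φ : Euc m × ℝ → ℝ, ContDiff ℝ ∞ φ → HasCompactSupport φ →
    (∫ p in guide m l, (fderiv ℝ φ p (dirY m)) • u p)
        + ∫ p in guide m l, φ p • weakDeriv (guide m l) (dirY m) u p
      = (∫ x, φ (x, l) • g₁ x) - ∫ x, φ (x, 0) • g₀ x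

theorem integral_smul_Lp_add {α : Type*} [MeasurableSpace α] {μ : Measure α} {g : α → ℝ}
    {u v : Lp ℂ 2 μ} (hu : Integrable (fun x => g x • u x) μ)
    (hv : Integrable (fun x => g x • v x) μ) :
    ∫ x, g x • (u + v) x ∂μ = (∫ x, g x • u x ∂μ) + ∫ x, g x • v x ∂μ := by
  rw [← integral_add hu hv]
  refine integral_congr_ae ?_
  filter_upwards [Lp.coeFn_add u v] with x hx
  rw [hx, Pi.add_apply, smul_add]

theorem integral_smul_Lp_smul {α : Type*} [MeasurableSpace α] {μ : Measure α} (g : α → ℝ)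
    (c : ℂ) (u : Lp ℂ 2 μ) :
    ∫ x, g x • (c • u) x ∂μ = c • ∫ x, g x • u x ∂μ := by
  rw [← integral_smul]
  refine integral_congr_ae ?_
  filter_upwards [Lp.coeFn_smul c u] with x hx
  rw [hx, Pi.smul_apply, smul_comm]

theorem integrable_slice_smul {m : ℕ} {φ : Euc m × ℝ → ℝ} (hφ : Continuous φ)
    (hc : HasCompactSupport φ) (y : ℝ) (g : L2Euc m) :
    Integrable (fun x => φ (x, y) • g x) (volume : Measure (Euc m)) := by
  have h1 : Continuous fun x : Euc m => φ (x, y) := hφ.comp (by fun_prop)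
  have h2 : HasCompactSupport fun x : Euc m => φ (x, y) := by
    refine HasCompactSupport.intro (hc.isCompact.image continuous_fst) fun x hx => ?_
    by_contra h
    exact hx ⟨(x, y), subset_tsupport _ h, rfl⟩
  exact memLp_one_iff_integrable.mp
    ((Lp.memLp g).smul (h1.memLp_of_hasCompactSupport (p := 2) h2))

theorem HasTraces.add {m : ℕ} {l : ℝ} {u u' : L2 (guide m l)} {g₀ g₁ g₀' g₁' : L2Euc m}
    (hu : u ∈ H1 (guide m l)) (hu' : u' ∈ H1 (guide m l))
    (h : HasTraces m l u g₀ g₁) (h' : HasTraces m l u' g₀' g₁') :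
    HasTraces m l (u + u') (g₀ + g₀') (g₁ + g₁') := by
  intro φ h1 h2
  rw [weakDeriv_add (isOpen_guide m l) hu hu',
    integral_smul_Lp_add (integrable_fderiv_smul_L2 h1 h2 _ u)
      (integrable_fderiv_smul_L2 h1 h2 _ u'),
    integral_smul_Lp_add (integrable_smul_L2 h1.continuous h2 _)
      (integrable_smul_L2 h1.continuous h2 _),
    integral_smul_Lp_add (integrable_slice_smul h1.continuous h2 _ _)
      (integrable_slice_smul h1.continuous h2 _ _),
    integral_smul_Lp_add (integrable_slice_smul h1.continuous h2 _ _)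
      (integrable_slice_smul h1.continuous h2 _ _)]
  linear_combination h φ h1 h2 + h' φ h1 h2

theorem HasTraces.smul {m : ℕ} {l : ℝ} {u : L2 (guide m l)} {g₀ g₁ : L2Euc m}
    (hu : u ∈ H1 (guide m l)) (c : ℂ) (h : HasTraces m l u g₀ g₁) :
    HasTraces m l (c • u) (c • g₀) (c • g₁) := by
  intro φ h1 h2
  rw [weakDeriv_smul (isOpen_guide m l) hu, integral_smul_Lp_smul, integral_smul_Lp_smul,
    integral_smul_Lp_smul, integral_smul_Lp_smul]
  simp only [smul_eq_mul]
  linear_combination c * h φ h1 h2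

/-- The operator `H_a = -Δ` on `L²(Ω)`, for a constant `a`, with domain
`{u ∈ H²(Ω) | ∂_ν u = i a u on ∂Ω}`, in the sense of traces; here `ν` is the outward normal, so that
`∂_ν u = - ∂_y u` on `ℝᵐ × {0}` and `∂_ν u = ∂_y u` on `ℝᵐ × {l}`. -/
def guideOp (m : ℕ) (l a : ℝ) : L2 (guide m l) →ₗ.[ℂ] L2 (guide m l) where
  domain :=
    { carrier := {u | u ∈ H2 (guide m l) ∧ ∃ g₀ g₁ : L2Euc m, HasTraces m l u g₀ g₁ ∧
        HasTraces m l (weakDeriv (guide m l) (dirY m) u)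
          (-((Complex.I * a) • g₀)) ((Complex.I * a) • g₁)}
      add_mem' := by
        rintro u u' ⟨hu, g₀, g₁, h1, h2⟩ ⟨hu', g₀', g₁', h1', h2'⟩
        refine ⟨(H2 _).add_mem hu hu', g₀ + g₀', g₁ + g₁',
          h1.add (H2_le_H1 _ hu) (H2_le_H1 _ hu') h1', ?_⟩
        rw [weakDeriv_add (isOpen_guide m l) (H2_le_H1 _ hu) (H2_le_H1 _ hu'), smul_add, smul_add,
          neg_add]
        exact h2.add (weakDeriv_mem_H1 (isOpen_guide m l) hu _)
          (weakDeriv_mem_H1 (isOpen_guide m l) hu' _) h2'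
      zero_mem' := by
        have h0 : HasTraces m l 0 0 0 := by
          intro φ _ _
          have e := integral_smul_Lp_smul (μ := volume.restrict (guide m l))
          have e' := integral_smul_Lp_smul (μ := (volume : Measure (Euc m)))
          rw [(hasWeakDeriv_zero _ _).weakDeriv_eq (isOpen_guide m l),
            ← zero_smul ℂ (0 : L2 (guide m l)), ← zero_smul ℂ (0 : L2Euc m), e, e, e', e']
          simp only [zero_smul, add_zero, sub_zero]
        refine ⟨(H2 _).zero_mem, 0, 0, h0, ?_⟩
        rw [(hasWeakDeriv_zero _ _).weakDeriv_eq (isOpen_guide m l), smul_zero, neg_zero]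
        exact h0
      smul_mem' := by
        rintro c u ⟨hu, g₀, g₁, h1, h2⟩
        refine ⟨(H2 _).smul_mem c hu, c • g₀, c • g₁, h1.smul (H2_le_H1 _ hu) c, ?_⟩
        rw [weakDeriv_smul (isOpen_guide m l) (H2_le_H1 _ hu), smul_comm _ c, smul_comm _ c,
          ← smul_neg]
        exact h2.smul (weakDeriv_mem_H1 (isOpen_guide m l) hu _) c }
  toFun :=
    { toFun := fun u =>
        -((∑ j : Fin m, weakDeriv (guide m l) (dirX m j)
            (weakDeriv (guide m l) (dirX m j) (u : L2 (guide m l))))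
          + weakDeriv (guide m l) (dirY m) (weakDeriv (guide m l) (dirY m) (u : L2 (guide m l))))
      map_add' := fun u u' => by
        simp only [Submodule.coe_add, weakDeriv_weakDeriv_add (isOpen_guide m l) u.2.1 u'.2.1,
          Finset.sum_add_distrib]
        abel
      map_smul' := fun c u => by
        simp only [Submodule.coe_smul, weakDeriv_weakDeriv_smul (isOpen_guide m l) u.2.1,
          ← Finset.smul_sum, ← smul_add, smul_neg, RingHom.id_apply] }

/-! ### Tensor products and components -/

theorem memLp_tensor {m : ℕ} {l : ℝ} (f : L2Euc m) (g : L2 (Ioo 0 l)) :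
    MemLp (fun p : Euc m × ℝ => f p.1 * g p.2) 2 (volume.restrict (guide m l)) := by
  rw [restrict_guide]
  have hf := Lp.memLp f
  have hg := Lp.memLp g
  have hm : AEStronglyMeasurable (fun p : Euc m × ℝ => f p.1 * g p.2)
      ((volume : Measure (Euc m)).prod (volume.restrict (Ioo 0 l))) :=
    hf.1.comp_fst.mul hg.1.comp_snd
  rw [memLp_two_iff_integrable_sq_norm hm]
  have hf2 := (memLp_two_iff_integrable_sq_norm hf.1).mp hf
  have hg2 := (memLp_two_iff_integrable_sq_norm hg.1).mp hg
  refine (hf2.mul_prod hg2).congr (Eventually.of_forall fun p => ?_)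
  simp only [norm_mul, mul_pow]

/-- The function `f ⊗ g : (x, y) ↦ f(x) g(y)` of `L²(Ω)`. -/
def tensor {m : ℕ} {l : ℝ} (f : L2Euc m) (g : L2 (Ioo 0 l)) : L2 (guide m l) :=
  (memLp_tensor f g).toLp

/-- The function `x ↦ ⟨u(x, ·), ψ⟩ = ∫₀ˡ u(x, y) conj(ψ(y)) dy`. -/
def componentFun {m : ℕ} {l : ℝ} (u : L2 (guide m l)) (ψ : L2 (Ioo 0 l)) (x : Euc m) : ℂ :=
  ∫ y in Ioo 0 l, u (x, y) * (starRingEnd ℂ) (ψ y)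

theorem memLp_componentFun {m : ℕ} {l : ℝ} (u : L2 (guide m l)) (ψ : L2 (Ioo 0 l)) :
    MemLp (componentFun u ψ) 2 (volume : Measure (Euc m)) := by
  have hu : MemLp u 2 ((volume : Measure (Euc m)).prod (volume.restrict (Ioo 0 l))) := by
    rw [← restrict_guide]
    exact Lp.memLp u
  have hψ := Lp.memLp ψ
  have hm : AEStronglyMeasurable (componentFun u ψ) (volume : Measure (Euc m)) :=
    (hu.1.mul (Complex.continuous_conj.comp_aestronglyMeasurable hψ.1).comp_snd).integral_prod_right'
  rw [memLp_two_iff_integrable_sq_norm hm]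
  have hu2 := (memLp_two_iff_integrable_sq_norm hu.1).mp hu
  refine (hu2.integral_prod_left.const_mul (‖ψ‖ ^ 2)).mono' (hm.norm.pow 2) ?_
  filter_upwards [hu.1.prodMk_left, hu2.prod_right_ae] with x hx1 hx2
  have hx : MemLp (fun y => u (x, y)) 2 (volume.restrict (Ioo 0 l)) :=
    (memLp_two_iff_integrable_sq_norm hx1).mpr hx2
  have hc : componentFun u ψ x = ⟪ψ, hx.toLp⟫_ℂ := by
    rw [L2.inner_def]
    refine integral_congr_ae ?_
    filter_upwards [hx.coeFn_toLp] with y hy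
    rw [hy]
    rfl
  have hn : ‖hx.toLp‖ ^ 2 = ∫ y in Ioo 0 l, ‖u (x, y)‖ ^ 2 := by
    have h1 : ⟪hx.toLp, hx.toLp⟫_ℂ = ((∫ y in Ioo 0 l, ‖u (x, y)‖ ^ 2 : ℝ) : ℂ) := by
      rw [L2.inner_def, ← integral_complex_ofReal]
      refine integral_congr_ae ?_
      filter_upwards [hx.coeFn_toLp] with y hy
      rw [hy, inner_self_eq_norm_sq_to_K]
      norm_cast
    rw [inner_self_eq_norm_sq_to_K] at h1
    exact Complex.ofReal_injective (by simpa using h1)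
  rw [Real.norm_of_nonneg (by positivity), hc, ← hn, ← mul_pow]
  gcongr
  exact norm_inner_le_norm _ _

/-- The function `x ↦ ⟨u(x, ·), ψ⟩` as an element of `L²(ℝᵐ)`. -/
def component {m : ℕ} {l : ℝ} (u : L2 (guide m l)) (ψ : L2 (Ioo 0 l)) : L2Euc m :=
  (memLp_componentFun u ψ).toLp

/-- The component `u_n = ⟨u(x, ·), φ*_n(a)⟩ ∈ L²(ℝᵐ)` of `u ∈ L²(Ω)`. -/
def modeComponent (m : ℕ) (l a : ℝ) (u : L2 (guide m l)) (n : ℕ) : L2Euc m :=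
  component u (dualBasis (transverseMode l a) n)

/-- The set `𝔖_a = {λ_n(a)² + r | n ∈ ℕ, r ≥ 0}`. -/
def spectralSet (l a : ℝ) : Set ℂ :=
  {z | ∃ (n : ℕ) (r : ℝ), 0 ≤ r ∧ z = transverseRoot l a n ^ 2 + r}

end Guide

end Waveguide

end

open Waveguide

/-! The transverse problem is solved explicitly, and everything on the guide is then done
coefficient by coefficient along the transverse modes.

Eigenfunctions of T_a for λ² ≠ 0 are combinations of e^{iλy} and e^{-iλy}, and the two boundary
conditions leave the equation e^{2iλl}(λ - a)² = (λ + a)². Comparing moduli, a nonzero root with Re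
λ ≥ 0 lies in the open fourth quadrant. There (λ + a)/(λ - a) has positive imaginary part, so it has
a holomorphic logarithm and the equation becomes `phase l a λ` ∈ πℤ. The real part of the phase is l
Re λ - arg with arg in ]0, π[, which places the root with phase kπ in the k-th strip. The derivative
of the phase has positive real part on the convex quadrant, whence uniqueness (`injOn_phase`);
existence is the intermediate value theorem along the curve where the phase is real
(`exists_phase_eq`).

Since λ_n l = nπ + O(1/n), the modes are O(1/n)-close to 2 cos(nπy/l), and by Bari's theorem
(`isRieszBasis_of_close`) only ω-independence is missing. The operator T_a is not selfadjoint, but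
it is symmetric for the bilinear pairing ∫ f g. Hence distinct modes are orthogonal without
conjugation, while ∫ φ_n² is a nonzero multiple of the derivative of the phase. This gives
ω-independence and shows that the dual vectors are multiples of the conjugated modes
(`exists_dualBasis_eq`).

The Riesz inequalities pass to L²(Ω) slice by slice (`BesselBound.tensor`), so a function is the sum
of its components and is determined by them. For u in the domain of H_a, the x-derivatives act on
components as Fourier multipliers, and two integrations by parts in y against a conjugated mode
produce λ_n² with no boundary term (`modeComponent_guideOp`). The formula for H_a u is then the
expansion of H_a u itself.

The resolvent is built by applying the multiplier 1/(4π²|ξ|² + λ_n² - z) to the n-th component; it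
is bounded by the inverse distance to the spectral set. The delicate point is that the series lies
in the domain of H_a. Ellipticity, uniform in n (`exists_symbol_bound`), makes the series of all
derivatives of order at most two converge, and the series of traces as well
(`IsMultSeries.mem_domain`). Finally Im λ_n² ≤ -c < 0 uniformly in n (`exists_gap`), because Im λ_n
is no smaller in size than a constant over Re λ_n; this gives the uniform bound on a half-plane Im z
≥ -c/2. -/

noncomputable section

namespace Waveguide

/-! ### Bessel sequences and square-summable perturbations -/

section Bessel

variable {G H : Type*} [NormedAddCommGroup G] [NormedAddCommGroup H]

/-- The maps `A n` satisfy `‖∑ A n (c n)‖² ≤ C ∑ ‖c n‖²` for all finite sums. -/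
def BesselBound (C : ℝ) (A : ℕ → G → H) : Prop :=
  ∀ (s : Finset ℕ) (c : ℕ → G), ‖∑ i ∈ s, A i (c i)‖ ^ 2 ≤ C * ∑ i ∈ s, ‖c i‖ ^ 2

/-- The maps `c ↦ c • ψ n` attached to a sequence of vectors. -/
abbrev smulSeq [NormedSpace ℂ H] (ψ : ℕ → H) : ℕ → ℂ → H := fun n c => c • ψ n

theorem BesselBound.mono {C C' : ℝ} {A : ℕ → G → H} (h : BesselBound C A) (hC : C ≤ C') :
    BesselBound C' A := fun s c =>
  (h s c).trans (mul_le_mul_of_nonneg_right hC (Finset.sum_nonneg fun _ _ => by positivity))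

/-- The inequality on finite sets transfers the Cauchy criterion from the squared norms of the
coefficients to the vector-valued series. -/
theorem BesselBound.summable [CompleteSpace H] {C : ℝ} {A : ℕ → G → H} (h : BesselBound C A)
    {c : ℕ → G} (hc : Summable fun n => ‖c n‖ ^ 2) : Summable fun n => A n (c n) := by
  rw [summable_iff_vanishing_norm] at hc ⊢
  intro ε hε
  -- No sign is assumed on `C`; |C| + 1 is a positive upper bound for it.
  obtain ⟨s, hs⟩ := hc (ε ^ 2 / (|C| + 1)) (by positivity)
  refine ⟨s, fun t ht => ?_⟩
  have h1 := hs t ht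
  have h0 : 0 ≤ ∑ i ∈ t, ‖c i‖ ^ 2 := Finset.sum_nonneg fun _ _ => by positivity
  rw [Real.norm_of_nonneg h0, lt_div_iff₀ (by positivity)] at h1
  refine lt_of_pow_lt_pow_left₀ 2 hε.le ?_
  have := mul_le_mul_of_nonneg_right (le_abs_self C) h0
  nlinarith [h t c]

theorem BesselBound.norm_sq_le_of_hasSum {C : ℝ} (hC : 0 ≤ C) {A : ℕ → G → H}
    (h : BesselBound C A) {c : ℕ → G} {S : ℝ} (hS : ∀ s : Finset ℕ, ∑ i ∈ s, ‖c i‖ ^ 2 ≤ S)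
    {v : H} (hv : HasSum (fun n => A n (c n)) v) : ‖v‖ ^ 2 ≤ C * S := by
  refine le_of_tendsto ((hv.norm).pow 2) (Eventually.of_forall fun s => ?_)
  exact (h s c).trans (mul_le_mul_of_nonneg_left (hS s) hC)

theorem BesselBound.add {C C' : ℝ} {A A' : ℕ → G → H} (h : BesselBound C A)
    (h' : BesselBound C' A') : BesselBound (2 * C + 2 * C') (fun n c => A n c + A' n c) := by
  intro s c
  rw [Finset.sum_add_distrib]
  have h1 := norm_add_le (∑ i ∈ s, A i (c i)) (∑ i ∈ s, A' i (c i))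
  have h2 := h s c
  have h3 := h' s c
  have h4 : ‖∑ i ∈ s, A i (c i) + ∑ i ∈ s, A' i (c i)‖ ^ 2
      ≤ (‖∑ i ∈ s, A i (c i)‖ + ‖∑ i ∈ s, A' i (c i)‖) ^ 2 := by gcongr
  nlinarith [sq_nonneg (‖∑ i ∈ s, A i (c i)‖ - ‖∑ i ∈ s, A' i (c i)‖)]

/-- Cauchy-Schwarz on the finite sum; square-summable norms make any form of orthogonality
superfluous. -/
theorem besselBound_of_summable [NormedSpace ℂ H] {ψ : ℕ → H}
    (h : Summable fun n => ‖ψ n‖ ^ 2) : BesselBound (∑' n, ‖ψ n‖ ^ 2) (smulSeq ψ) := by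
  intro s c
  have h1 : ‖∑ i ∈ s, c i • ψ i‖ ≤ ∑ i ∈ s, ‖c i‖ * ‖ψ i‖ := by
    refine (norm_sum_le _ _).trans (Finset.sum_le_sum fun i _ => (norm_smul_le _ _))
  calc ‖∑ i ∈ s, c i • ψ i‖ ^ 2 ≤ (∑ i ∈ s, ‖c i‖ * ‖ψ i‖) ^ 2 := by gcongr
    _ ≤ (∑ i ∈ s, ‖c i‖ ^ 2) * ∑ i ∈ s, ‖ψ i‖ ^ 2 := Finset.sum_mul_sq_le_sq_mul_sq _ _ _
    _ ≤ (∑ i ∈ s, ‖c i‖ ^ 2) * ∑' n, ‖ψ n‖ ^ 2 := by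
        gcongr
        exact h.sum_le_tsum s fun _ _ => by positivity
    _ = _ := mul_comm _ _

/-- Split ψ n = e n + (ψ n - e n); the second sequence is Bessel by square summability. -/
theorem BesselBound.of_close [NormedSpace ℂ H] {C : ℝ} {ψ e : ℕ → H}
    (he : BesselBound C (smulSeq e)) (h : Summable fun n => ‖ψ n - e n‖ ^ 2) :
    ∃ C', BesselBound C' (smulSeq ψ) := by
  refine ⟨2 * C + 2 * ∑' n, ‖ψ n - e n‖ ^ 2, fun s c => ?_⟩
  have := (he.add (besselBound_of_summable h)) s c
  simpa [smulSeq, ← smul_add] using this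

end Bessel

/-! ### Riesz bases, dual bases and Bari's theorem -/

section RieszCriterion

variable {H : Type*} [NormedAddCommGroup H] [InnerProductSpace ℂ H]

theorem besselBound_of_orthonormal {e : ℕ → H} (he : Orthonormal ℂ e) :
    BesselBound 1 (smulSeq e) := by
  intro s c
  have h := he.inner_sum c c s
  rw [inner_self_eq_norm_sq_to_K] at h
  have h2 : ((‖∑ i ∈ s, c i • e i‖ ^ 2 : ℝ) : ℂ) = ((∑ i ∈ s, ‖c i‖ ^ 2 : ℝ) : ℂ) := by
    push_cast
    refine h.trans (Finset.sum_congr rfl fun i _ => ?_)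
    rw [Complex.conj_mul']
  rw [one_mul]
  exact (Complex.ofReal_injective h2).le

theorem BesselBound.map {C : ℝ} {ψ : ℕ → H} (h : BesselBound C (smulSeq ψ)) (T : H →L[ℂ] H) :
    BesselBound (‖T‖ ^ 2 * C) (smulSeq fun n => T (ψ n)) := by
  intro s c
  have h1 : ∑ i ∈ s, c i • T (ψ i) = T (∑ i ∈ s, c i • ψ i) := by simp
  simp only [smulSeq]
  rw [h1]
  calc ‖T (∑ i ∈ s, c i • ψ i)‖ ^ 2 ≤ (‖T‖ * ‖∑ i ∈ s, c i • ψ i‖) ^ 2 := by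
        gcongr
        exact T.le_opNorm _
    _ = ‖T‖ ^ 2 * ‖∑ i ∈ s, c i • ψ i‖ ^ 2 := mul_pow _ _ _
    _ ≤ ‖T‖ ^ 2 * (C * ∑ i ∈ s, ‖c i‖ ^ 2) := by gcongr; exact h s c
    _ = _ := by ring

variable [CompleteSpace H]

/-- The operator `v ↦ ∑ ⟪e n, v⟫ ψ n` for a Bessel sequence `ψ`. -/
theorem exists_synthesis (e : HilbertBasis ℕ ℂ H) {C : ℝ} (hC : 0 ≤ C) {ψ : ℕ → H}
    (h : BesselBound C (smulSeq ψ)) :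
    ∃ K : H →L[ℂ] H, (∀ v, HasSum (fun n => ⟪e n, v⟫_ℂ • ψ n) (K v)) ∧ ‖K‖ ≤ √C := by
  have hs : ∀ v, Summable fun n => ⟪e n, v⟫_ℂ • ψ n := fun v =>
    h.summable (c := fun n => ⟪e n, v⟫_ℂ) (e.orthonormal.inner_products_summable v)
  let K₀ : H →ₗ[ℂ] H :=
    { toFun := fun v => ∑' n, ⟪e n, v⟫_ℂ • ψ n
      map_add' := fun v w => by
        rw [← (hs v).tsum_add (hs w)]
        simp only [inner_add_right, add_smul]
      map_smul' := fun a v => by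
        rw [RingHom.id_apply, ← tsum_const_smul'' a]
        simp only [inner_smul_right, mul_smul] }
  have hb : ∀ v, ‖K₀ v‖ ≤ √C * ‖v‖ := fun v => by
    have h1 := h.norm_sq_le_of_hasSum hC (c := fun n => ⟪e n, v⟫_ℂ)
      (fun s => e.orthonormal.sum_inner_products_le v) (hs v).hasSum
    refine le_of_sq_le_sq ?_ (by positivity)
    rw [mul_pow, Real.sq_sqrt hC]
    exact h1
  refine ⟨K₀.mkContinuous _ hb, fun v => (hs v).hasSum,
    LinearMap.mkContinuous_norm_le _ (Real.sqrt_nonneg _) _⟩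

/-- `K` is of Hilbert-Schmidt type: its truncations have finite rank, and the remainder after N
terms has operator norm at most the square root of ∑_{n ≥ N} ‖ψ n‖², so it is a norm limit of
compact operators. -/
theorem isCompactOperator_of_summable (e : HilbertBasis ℕ ℂ H) {ψ : ℕ → H}
    (h : Summable fun n => ‖ψ n‖ ^ 2) (K : H →L[ℂ] H)
    (hK : ∀ v, HasSum (fun n => ⟪e n, v⟫_ℂ • ψ n) (K v)) : IsCompactOperator K := by
  let T : ℕ → H →L[ℂ] H := fun N =>
    ∑ n ∈ Finset.range N, (innerSL ℂ (e n)).smulRight (ψ n)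
  have hT : ∀ N, IsCompactOperator (T N) := by
    intro N
    refine Submodule.sum_mem (compactOperator (RingHom.id ℂ) H H) fun n _ => ?_
    change IsCompactOperator fun v => (innerSL ℂ (e n)) v • ψ n
    exact (isCompactOperator_of_locallyCompactSpace_rng
      (ContinuousLinearMap.toSpanSingleton ℂ (ψ n))).comp_clm (innerSL ℂ (e n))
  refine isCompactOperator_of_tendsto (F := T) (l := atTop) ?_ (Eventually.of_forall hT)
  rw [tendsto_iff_norm_sub_tendsto_zero]
  have htail : Tendsto (fun N => √(∑' n, ‖ψ (n + N)‖ ^ 2)) atTop (𝓝 0) := by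
    have := (tendsto_sum_nat_add fun n => ‖ψ n‖ ^ 2).sqrt
    simpa using this
  refine squeeze_zero (fun _ => norm_nonneg _) (fun N => ?_) htail
  refine ContinuousLinearMap.opNorm_le_bound _ (Real.sqrt_nonneg _) fun v => ?_
  have hN : Summable fun n => ‖ψ (n + N)‖ ^ 2 := (summable_nat_add_iff N).2 h
  have hs : HasSum (fun n => ⟪e (n + N), v⟫_ℂ • ψ (n + N)) (K v - T N v) := by
    have := (hasSum_nat_add_iff' N).2 (hK v)
    simpa [T] using this
  have h1 := (besselBound_of_summable hN).norm_sq_le_of_hasSum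
    (tsum_nonneg fun _ => by positivity) (c := fun n => ⟪e (n + N), v⟫_ℂ)
    (fun s => (e.orthonormal.comp _ (add_left_injective N)).sum_inner_products_le v) hs
  rw [sub_apply, norm_sub_rev]
  refine le_of_sq_le_sq ?_ (by positivity)
  rw [mul_pow, Real.sq_sqrt (tsum_nonneg fun _ => by positivity)]
  exact h1

/-- Bari's theorem: an `ω`-independent sequence which is quadratically close to an orthonormal
basis is a Riesz basis. -/
theorem isRieszBasis_of_close (e : HilbertBasis ℕ ℂ H) {φ : ℕ → H}
    (h : Summable fun n => ‖φ n - e n‖ ^ 2)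
    (hind : ∀ c : ℕ → ℂ, HasSum (fun n => c n • φ n) 0 → ∀ n, c n = 0) : IsRieszBasis φ := by
  obtain ⟨K, hK, -⟩ := exists_synthesis e (tsum_nonneg fun _ => by positivity)
    (besselBound_of_summable h)
  have hcomp := isCompactOperator_of_summable e h K hK
  -- The candidate for Θ is K + 1, which sends e n to φ n.
  have hφ : ∀ v, HasSum (fun n => ⟪e n, v⟫_ℂ • φ n) (K v + v) := fun v => by
    have h1 := (hK v).add (e.hasSum_repr v)
    simpa only [e.repr_apply_apply, smul_sub, sub_add_cancel] using h1
  -- If K v = -v, the series ∑ ⟪e n, v⟫ φ n has sum zero; ω-independence then kills all coefficients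
  -- of v.
  have hne : ¬ Module.End.HasEigenvalue (K : Module.End ℂ H) (-1) := by
    intro hev
    obtain ⟨v, hv⟩ := hev.exists_hasEigenvector
    have h1 : K v = -v := by simpa using hv.apply_eq_smul
    have h2 := hφ v
    rw [h1, neg_add_cancel] at h2
    refine hv.2 ?_
    have h3 := e.hasSum_repr v
    simp only [e.repr_apply_apply, hind _ h2, zero_smul] at h3
    exact h3.unique hasSum_zero
  have hres := (hcomp.hasEigenvalue_or_mem_resolventSet (μ := (-1 : ℂ)) (by simp)).resolve_left hne
  rw [spectrum.mem_resolventSet_iff] at hres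
  -- The Fredholm alternative makes -1 - K a unit; its opposite is K + 1.
  obtain ⟨u, hu⟩ := hres.neg
  let Θ := ContinuousLinearEquiv.ofUnit u
  have hΘ : ∀ v, Θ v = K v + v := fun v => by
    change (u : H →L[ℂ] H) v = _
    rw [hu]
    simp
  refine ⟨(Θ, e), fun n => ?_⟩
  change φ n = Θ (e n)
  rw [hΘ]
  refine HasSum.unique ?_ (hφ (e n))
  have : (fun k => ⟪e k, e n⟫_ℂ • φ k) = fun k => if k = n then φ k else 0 := by
    ext k
    rw [orthonormal_iff_ite.mp e.orthonormal k n]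
    split_ifs <;> simp
  rw [this]
  simpa using hasSum_single n (f := fun k => if k = n then φ k else 0) fun k hk => by simp [hk]

/-- A Riesz basis together with its dual basis. -/
theorem exists_rieszBasis_dualBasis {φ : ℕ → H} (h : IsRieszBasis φ) :
    ∃ (Θ : H ≃L[ℂ] H) (e : HilbertBasis ℕ ℂ H), (∀ n, φ n = Θ (e n)) ∧
      ∀ n, dualBasis φ n = ContinuousLinearMap.adjoint (Θ.symm : H →L[ℂ] H) (e n) :=
  ⟨h.choose.1, h.choose.2, h.choose_spec, fun n => by rw [dualBasis, dif_pos h]⟩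

theorem IsRieszBasis.exists_besselBound {φ : ℕ → H} (h : IsRieszBasis φ) :
    ∃ C, 0 ≤ C ∧ BesselBound C (smulSeq φ) ∧ BesselBound C (smulSeq (dualBasis φ)) := by
  obtain ⟨Θ, e, h1, h2⟩ := exists_rieszBasis_dualBasis h
  have hb := besselBound_of_orthonormal e.orthonormal
  refine ⟨max (‖(Θ : H →L[ℂ] H)‖ ^ 2 * 1)
    (‖ContinuousLinearMap.adjoint (Θ.symm : H →L[ℂ] H)‖ ^ 2 * 1), by positivity, ?_, ?_⟩
  · rw [funext h1]
    exact (hb.map (Θ : H →L[ℂ] H)).mono (le_max_left _ _)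
  · rw [funext h2]
    exact (hb.map _).mono (le_max_right _ _)

/-- The inner products with φ n are the coefficients of Θ* v in the orthonormal basis, so Θ* v = 0,
and ‖v‖² = ⟪v, Θ Θ⁻¹ v⟫ = 0. -/
theorem IsRieszBasis.eq_zero_of_inner_eq_zero {φ : ℕ → H} (h : IsRieszBasis φ) {v : H}
    (hv : ∀ n, ⟪φ n, v⟫_ℂ = 0) : v = 0 := by
  obtain ⟨⟨Θ, e⟩, h1⟩ := h
  have h2 : ContinuousLinearMap.adjoint (Θ : H →L[ℂ] H) v = 0 := by
    refine e.repr.map_eq_zero_iff.mp (lp.ext (funext fun n => ?_))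
    rw [e.repr_apply_apply, ContinuousLinearMap.adjoint_inner_right]
    have := hv n
    rw [h1] at this
    exact this
  have h3 : ⟪v, Θ (Θ.symm v)⟫_ℂ = 0 := by
    have := ContinuousLinearMap.adjoint_inner_left (Θ : H →L[ℂ] H) (Θ.symm v) v
    rw [h2, inner_zero_left] at this
    exact this.symm
  rwa [Θ.apply_symm_apply, inner_self_eq_zero] at h3

/-- The inner products with the dual vectors are the coefficients of Θ⁻¹ v in the orthonormal basis.
-/
theorem IsRieszBasis.eq_zero_of_inner_dualBasis_eq_zero {φ : ℕ → H} (h : IsRieszBasis φ) {v : H}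
    (hv : ∀ n, ⟪dualBasis φ n, v⟫_ℂ = 0) : v = 0 := by
  obtain ⟨Θ, e, -, h1⟩ := exists_rieszBasis_dualBasis h
  have h2 : Θ.symm v = 0 := by
    refine e.repr.map_eq_zero_iff.mp (lp.ext (funext fun n => ?_))
    rw [e.repr_apply_apply]
    have := hv n
    rw [h1, ContinuousLinearMap.adjoint_inner_left] at this
    exact this
  simpa using h2

/-- The dual basis is the only biorthogonal sequence. -/
theorem IsRieszBasis.dualBasis_eq {φ : ℕ → H} (h : IsRieszBasis φ) {n : ℕ} {w : H}
    (hw : ∀ k, ⟪φ k, w⟫_ℂ = if k = n then 1 else 0) : dualBasis φ n = w := by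
  refine sub_eq_zero.mp (h.eq_zero_of_inner_eq_zero fun k => ?_)
  rw [inner_sub_right, hw, ← inner_conj_symm, inner_dualBasis h]
  by_cases hk : k = n
  · simp [hk]
  · simp [hk, Ne.symm hk]

end RieszCriterion

/-! ### The characteristic equation: localization, uniqueness, existence and asymptotics of its
roots -/

section Roots

/-- The open fourth quadrant. -/
def quadrant : Set ℂ := {z | 0 < z.re ∧ z.im < 0}

/-- The reflection coefficient `(λ + a) / (λ - a)`. -/
def mob (a : ℝ) (lam : ℂ) : ℂ := (lam + a) / (lam - a)

/-- The characteristic equation of the transverse eigenvalue problem. -/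
def IsCharRoot (l a : ℝ) (lam : ℂ) : Prop :=
  lam ≠ 0 ∧ Complex.exp (Complex.I * lam * l) ^ 2 * (lam - a) ^ 2 = (lam + a) ^ 2

/-- The characteristic equation reads `phase l a λ ∈ π ℤ`. -/
def phase (l a : ℝ) (lam : ℂ) : ℂ := lam * l + Complex.I * Complex.log (mob a lam)

theorem convex_quadrant : Convex ℝ quadrant :=
  (convex_halfSpace_re_gt 0).inter (convex_halfSpace_im_lt 0)

theorem sub_ne_zero_of_mem_quadrant {lam : ℂ} (h : lam ∈ quadrant) (a : ℝ) : lam - a ≠ 0 := by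
  intro h0
  have := congrArg Complex.im h0
  simp at this
  exact h.2.ne this

theorem add_ne_zero_of_mem_quadrant {lam : ℂ} (h : lam ∈ quadrant) (a : ℝ) : lam + a ≠ 0 := by
  have := sub_ne_zero_of_mem_quadrant h (-a)
  rwa [Complex.ofReal_neg, sub_neg_eq_add] at this

/-- The imaginary part equals -2a Im λ / |λ - a|². It keeps `mob` away from the branch cut of the
logarithm, so that `phase` is holomorphic on the quadrant. -/
theorem mob_im_pos {a : ℝ} (ha : 0 < a) {lam : ℂ} (h : lam ∈ quadrant) : 0 < (mob a lam).im := by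
  have h0 := Complex.normSq_pos.mpr (sub_ne_zero_of_mem_quadrant h a)
  rw [mob, Complex.div_im, ← sub_div]
  apply div_pos _ h0
  simp
  nlinarith [h.1, h.2]

theorem mob_ne_zero {a : ℝ} (ha : 0 < a) {lam : ℂ} (h : lam ∈ quadrant) : mob a lam ≠ 0 := by
  intro h0
  have := mob_im_pos ha h
  rw [h0] at this
  simp at this

theorem arg_mob_mem {a : ℝ} (ha : 0 < a) {lam : ℂ} (h : lam ∈ quadrant) :
    0 < (mob a lam).arg ∧ (mob a lam).arg < Real.pi := by
  have h1 := mob_im_pos ha h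
  refine ⟨lt_of_le_of_ne (Complex.arg_nonneg_iff.2 h1.le) fun h0 => ?_,
    Complex.arg_lt_pi_iff.2 (Or.inr h1.ne')⟩
  have := (Complex.arg_eq_zero_iff.1 h0.symm).2
  exact h1.ne' this

/-- Take moduli in the characteristic equation. If Re λ > 0 then |λ + a| > |λ - a|, so e^{-2 l Im λ}
> 1. If Re λ = 0 the two moduli agree, hence Im λ = 0, and λ = 0 is excluded by definition. -/
theorem IsCharRoot.mem_quadrant {l a : ℝ} (hl : 0 < l) (ha : 0 < a) {lam : ℂ}
    (h : IsCharRoot l a lam) (hre : 0 ≤ lam.re) : lam ∈ quadrant := by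
  obtain ⟨h0, h1⟩ := h
  have h2 := congrArg norm h1
  simp only [norm_mul, norm_pow, ← Complex.normSq_eq_norm_sq, Complex.norm_exp] at h2
  simp [Complex.normSq_apply] at h2
  have hE : 0 < Real.exp (-(lam.im * l)) := Real.exp_pos _
  rcases hre.eq_or_lt with hs | hs
  · exfalso
    rw [← hs] at h2
    have hE1 : Real.exp (-(lam.im * l)) ^ 2 = 1 := by
      have h3 : 0 < a * a + lam.im * lam.im := by nlinarith [mul_self_nonneg lam.im]
      have h4 : (Real.exp (-(lam.im * l)) ^ 2 - 1) * (a * a + lam.im * lam.im) = 0 := by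
        linear_combination h2
      have := (mul_eq_zero.1 h4).resolve_right h3.ne'
      linarith
    have hE2 : Real.exp (-(lam.im * l)) = 1 := by nlinarith
    have h5 : lam.im = 0 := by
      have := Real.exp_eq_one_iff _ |>.1 hE2
      have := neg_eq_zero.1 this
      exact (mul_eq_zero.1 this).resolve_right hl.ne'
    exact h0 (Complex.ext hs.symm h5)
  · refine ⟨hs, ?_⟩
    by_contra ht
    push Not at ht
    have hE1 : Real.exp (-(lam.im * l)) ≤ 1 := Real.exp_le_one_iff.2 (by nlinarith)
    have hE2 : Real.exp (-(lam.im * l)) ^ 2 ≤ 1 := pow_le_one₀ hE.le hE1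
    have hN : 0 ≤ (lam.re - a) * (lam.re - a) + lam.im * lam.im := by
      nlinarith [mul_self_nonneg (lam.re - a), mul_self_nonneg lam.im]
    have := mul_le_mul_of_nonneg_right hE2 hN
    nlinarith [mul_pos hs ha]

/-- The equation says exp(2(iλl - log mob)) = 1, and iλl - log mob is i times the phase; the period
2πi becomes π after division by 2i. -/
theorem isCharRoot_iff_phase {l a : ℝ} (ha : 0 < a) {lam : ℂ} (h : lam ∈ quadrant) :
    IsCharRoot l a lam ↔ ∃ k : ℤ, phase l a lam = k * Real.pi := by
  have h1 := sub_ne_zero_of_mem_quadrant h a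
  have hm := mob_ne_zero ha h
  have h0 : lam ≠ 0 := by simpa using sub_ne_zero_of_mem_quadrant h 0
  have hexp : Complex.exp (2 * (Complex.I * lam * l - Complex.log (mob a lam)))
      = Complex.exp (Complex.I * lam * l) ^ 2 / mob a lam ^ 2 := by
    rw [two_mul, Complex.exp_add, ← sq, Complex.exp_sub, Complex.exp_log hm, div_pow]
  have e1 : IsCharRoot l a lam ↔
      Complex.exp (2 * (Complex.I * lam * l - Complex.log (mob a lam))) = 1 := by
    rw [hexp, div_eq_one_iff_eq (pow_ne_zero 2 hm), mob, div_pow, eq_div_iff (pow_ne_zero 2 h1)]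
    exact and_iff_right h0
  rw [e1, Complex.exp_eq_one_iff]
  refine exists_congr fun k => ?_
  rw [phase]
  constructor
  · intro h
    have hI := Complex.I_mul_I
    linear_combination (-Complex.I / 2) * h + (lam * l - k * Real.pi) * hI
  · intro h
    have hI := Complex.I_mul_I
    linear_combination (2 * Complex.I) * h - 2 * Complex.log (mob a lam) * hI

theorem phase_re (l a : ℝ) (lam : ℂ) : (phase l a lam).re = lam.re * l - (mob a lam).arg := by
  simp [phase, Complex.log_im, sub_eq_add_neg]

theorem phase_im (l a : ℝ) (lam : ℂ) :
    (phase l a lam).im = lam.im * l + Real.log ‖mob a lam‖ := by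
  simp [phase, Complex.log_re]

/-- Here l Re λ = kπ + arg(mob), and the argument lies strictly between 0 and π. -/
theorem re_bounds_of_phase {l a : ℝ} (hl : 0 < l) (ha : 0 < a) {lam : ℂ} (h : lam ∈ quadrant)
    {k : ℤ} (hk : phase l a lam = k * Real.pi) :
    k * (Real.pi / l) < lam.re ∧ lam.re < (k + 1) * (Real.pi / l) := by
  have h1 := congrArg Complex.re hk
  rw [phase_re] at h1
  have h2 := arg_mob_mem ha h
  have e : ((k : ℂ) * (Real.pi : ℂ)).re = k * Real.pi := by
    rw [← Complex.ofReal_intCast, ← Complex.ofReal_mul, Complex.ofReal_re]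
  rw [e] at h1
  rw [mul_div_assoc', mul_div_assoc', div_lt_iff₀ hl, lt_div_iff₀ hl]
  constructor <;> linarith

/-- The derivative of the phase. -/
def phaseDeriv (l a : ℝ) (lam : ℂ) : ℂ := l - 2 * a * Complex.I / (lam ^ 2 - a ^ 2)

/-- Im(λ² - a²) = 2 Re λ Im λ is negative on the quadrant, so the second term adds a positive
quantity to l. -/
theorem phaseDeriv_re_pos {l a : ℝ} (hl : 0 < l) (ha : 0 < a) {lam : ℂ} (h : lam ∈ quadrant) :
    0 < (phaseDeriv l a lam).re := by
  have hD : (lam ^ 2 - a ^ 2) ≠ 0 := by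
    rw [sq_sub_sq]
    exact mul_ne_zero (add_ne_zero_of_mem_quadrant h a) (sub_ne_zero_of_mem_quadrant h a)
  have hN := Complex.normSq_pos.mpr hD
  have him : (lam ^ 2 - (a : ℂ) ^ 2).im = 2 * lam.re * lam.im := by
    rw [Complex.sub_im, ← Complex.ofReal_pow, Complex.ofReal_im, sq, Complex.mul_im]
    ring
  have h1 : (phaseDeriv l a lam).re
      = l - 2 * a * (2 * lam.re * lam.im) / Complex.normSq (lam ^ 2 - a ^ 2) := by
    rw [phaseDeriv, Complex.sub_re, Complex.ofReal_re, Complex.div_re, him]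
    simp
  rw [h1]
  have h2 : 2 * a * (2 * lam.re * lam.im) / Complex.normSq (lam ^ 2 - a ^ 2) < 0 := by
    apply div_neg_of_neg_of_pos _ hN
    have := mul_neg_of_pos_of_neg (mul_pos ha h.1) h.2
    nlinarith
  linarith

theorem hasDerivAt_phase {l a : ℝ} (ha : 0 < a) {lam : ℂ} (h : lam ∈ quadrant) :
    HasDerivAt (phase l a) (phaseDeriv l a lam) lam := by
  have h1 := sub_ne_zero_of_mem_quadrant h a
  have h2 := add_ne_zero_of_mem_quadrant h a
  have hm : HasDerivAt (mob a) ((1 * (lam - a) - (lam + a) * 1) / (lam - a) ^ 2) lam :=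
    ((hasDerivAt_id lam).add_const (a : ℂ)).div ((hasDerivAt_id lam).sub_const (a : ℂ)) h1
  have hs : mob a lam ∈ Complex.slitPlane := Or.inr (mob_im_pos ha h).ne'
  have := ((hasDerivAt_id lam).mul_const (l : ℂ)).add ((hm.clog hs).const_mul Complex.I)
  refine this.congr_deriv ?_
  rw [phaseDeriv, mob, sq_sub_sq]
  field_simp
  ring

/-- On a convex set, a holomorphic function whose derivative has positive real part is injective: if
the phase agreed at z and w, Rolle's theorem applied to Re(phase(z + t(w - z))/(w - z)) would give a
point of the segment where this real part vanishes. -/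
theorem injOn_phase {l a : ℝ} (hl : 0 < l) (ha : 0 < a) : InjOn (phase l a) quadrant := by
  intro z hz w hw hzw
  by_contra hne
  have hd : w - z ≠ 0 := sub_ne_zero.2 (Ne.symm hne)
  let g : ℝ → ℂ := fun t => phase l a (z + t * (w - z)) / (w - z)
  have hmem : ∀ t ∈ Icc (0 : ℝ) 1, z + t * (w - z) ∈ quadrant := fun t ht => by
    have := convex_quadrant.add_smul_sub_mem hz hw ht
    simpa using this
  have hg : ∀ t ∈ Icc (0 : ℝ) 1,
      HasDerivAt (fun t => (g t).re) (phaseDeriv l a (z + t * (w - z))).re t := fun t ht => by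
    have h1 : HasDerivAt (fun t : ℝ => z + (t : ℂ) * (w - z)) (1 * (w - z)) t :=
      ((Complex.ofRealCLM.hasDerivAt (x := t)).mul_const (w - z)).const_add z
    have h2 := ((hasDerivAt_phase (l := l) ha (hmem t ht)).comp t h1).div_const (w - z)
    have h3 := Complex.reCLM.hasFDerivAt.comp_hasDerivAt t h2
    refine h3.congr_deriv ?_
    rw [Complex.reCLM_apply]
    congr 1
    field_simp
  obtain ⟨c, hc, h0⟩ := exists_hasDerivAt_eq_zero (f := fun t => (g t).re) (zero_lt_one' ℝ)
    (fun t ht => (hg t ht).continuousAt.continuousWithinAt) (by simp [g, hzw])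
    (fun t ht => hg t (Ioo_subset_Icc_self ht))
  exact (phaseDeriv_re_pos hl ha (hmem c (Ioo_subset_Icc_self hc))).ne' h0

/-! ### Existence of the roots -/

theorem norm_mob_sq {a : ℝ} {lam : ℂ} (h : lam ∈ quadrant) :
    ‖mob a lam‖ ^ 2 = 1 + 4 * lam.re * a / ((lam.re - a) ^ 2 + lam.im ^ 2) := by
  have h2 := sub_ne_zero_of_mem_quadrant h a
  have h3 : Complex.normSq (lam - a) = (lam.re - a) ^ 2 + lam.im ^ 2 := by
    simp [Complex.normSq_apply]; ring
  have h4 : Complex.normSq (lam + a) = (lam.re + a) ^ 2 + lam.im ^ 2 := by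
    simp [Complex.normSq_apply]; ring
  have h5 := Complex.normSq_pos.mpr h2
  rw [mob, norm_div, div_pow, ← Complex.normSq_eq_norm_sq, ← Complex.normSq_eq_norm_sq, h3, h4]
  rw [h3] at h5
  field_simp
  ring

/-- For `s > 0` the modulus of the characteristic equation at `λ = s - i τ` holds if and only if
this function vanishes. -/
def modulusDefect (l a s τ : ℝ) : ℝ :=
  (Real.exp (2 * τ * l) - 1) * ((s - a) ^ 2 + τ ^ 2) - 4 * s * a

theorem modulusDefect_strictMono {l : ℝ} (hl : 0 < l) (a s : ℝ) {τ₁ τ₂ : ℝ} (h0 : 0 ≤ τ₁)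
    (h : τ₁ < τ₂) : modulusDefect l a s τ₁ < modulusDefect l a s τ₂ := by
  have hE1 : 1 ≤ Real.exp (2 * τ₁ * l) := Real.one_le_exp (by positivity)
  have hE : Real.exp (2 * τ₁ * l) < Real.exp (2 * τ₂ * l) := Real.exp_lt_exp.2 (by gcongr)
  have hN : (s - a) ^ 2 + τ₁ ^ 2 < (s - a) ^ 2 + τ₂ ^ 2 := by gcongr
  unfold modulusDefect
  have hN0 : 0 ≤ (s - a) ^ 2 + τ₁ ^ 2 := by positivity
  nlinarith

theorem continuous_modulusDefect (l a : ℝ) :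
    Continuous fun p : ℝ × ℝ => modulusDefect l a p.1 p.2 := by
  unfold modulusDefect
  fun_prop

theorem exists_modulusDefect_eq_zero {l a : ℝ} (hl : 0 < l) (ha : 0 < a) {s : ℝ} (hs : 0 < s) :
    ∃ τ, 0 < τ ∧ modulusDefect l a s τ = 0 := by
  -- With this choice exp(2Tl) - 1 ≥ 2Tl = 2l + 4sa, while the other factor is at least T² ≥ 1.
  set T := 1 + 2 * s * a / l with hT
  have hT1 : 1 ≤ T := by rw [hT]; have : 0 ≤ 2 * s * a / l := by positivity
                         linarith
  have h0 : modulusDefect l a s 0 < 0 := by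
    simp [modulusDefect]
    positivity
  have h1 : 0 < modulusDefect l a s T := by
    have hE := Real.add_one_le_exp (2 * T * l)
    have hN : 1 ≤ (s - a) ^ 2 + T ^ 2 := by nlinarith [sq_nonneg (s - a)]
    have h2 : 2 * T * l = 2 * l + 4 * s * a := by rw [hT]; field_simp; ring
    unfold modulusDefect
    have h3 : 0 ≤ 4 * s * a := by positivity
    nlinarith
  have hc : ContinuousOn (fun τ => modulusDefect l a s τ) (Icc 0 T) :=
    ((continuous_modulusDefect l a).comp (Continuous.prodMk_right s)).continuousOn
  obtain ⟨τ, hτ, h2⟩ := intermediate_value_Icc (by linarith) hc ⟨h0.le, h1.le⟩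
  refine ⟨τ, lt_of_le_of_ne hτ.1 fun h3 => ?_, h2⟩
  subst h3
  exact h0.ne h2

/-- For each s > 0 a unique τ(s) > 0 solves the modulus equation, and on the curve λ = s - iτ(s) the
phase is real, equal to sl - arg. It is at most nπ at s = nπ/l and at least nπ at s = (n + 1)π/l, so
it takes the value nπ in between. -/
theorem exists_phase_eq {l a : ℝ} (hl : 0 < l) (ha : 0 < a) (n : ℕ) :
    ∃ lam ∈ quadrant, phase l a lam = (n : ℤ) * Real.pi := by
  have hex : ∀ s : ℝ, ∃ τ, 0 < s → 0 < τ ∧ modulusDefect l a s τ = 0 := fun s => by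
    by_cases hs : 0 < s
    · obtain ⟨τ, h⟩ := exists_modulusDefect_eq_zero hl ha hs
      exact ⟨τ, fun _ => h⟩
    · exact ⟨0, fun h => absurd h hs⟩
  choose τ hτ using hex
  have hpos : ∀ s, 0 < s → 0 < τ s := fun s hs => (hτ s hs).1
  have hlt : ∀ s, 0 < s → ∀ x, 0 ≤ x → 0 < modulusDefect l a s x → τ s < x := by
    intro s hs x hx h
    by_contra hc
    push Not at hc
    rcases hc.eq_or_lt with h1 | h1
    · rw [h1, (hτ s hs).2] at h
      exact h.false
    · have := modulusDefect_strictMono hl a s hx h1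
      rw [(hτ s hs).2] at this
      linarith
  have hgt : ∀ s, 0 < s → ∀ x, modulusDefect l a s x < 0 → x < τ s := by
    intro s hs x h
    by_contra hc
    push Not at hc
    rcases hc.eq_or_lt with h1 | h1
    · rw [← h1, (hτ s hs).2] at h
      exact h.false
    · have := modulusDefect_strictMono hl a s (hpos s hs).le h1
      rw [(hτ s hs).2] at this
      linarith
  -- By strict monotonicity the sign of `modulusDefect` at (s, x) tells on which side of τ(s) the
  -- number x lies, and a strict sign persists for nearby s.
  have hcτ : ContinuousOn τ (Ioi 0) := by
    intro s hs
    refine ContinuousAt.continuousWithinAt ?_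
    have hcx : ∀ x, ContinuousAt (fun s => modulusDefect l a s x) s := fun x =>
      ((continuous_modulusDefect l a).comp (Continuous.prodMk_left x)).continuousAt
    have hev : ∀ᶠ s' in 𝓝 s, 0 < s' := lt_mem_nhds hs
    refine tendsto_order.2 ⟨fun x hx => ?_, fun x hx => ?_⟩
    · by_cases hx0 : 0 ≤ x
      · have h1 : modulusDefect l a s x < 0 := by
          have := modulusDefect_strictMono hl a s hx0 hx
          rwa [(hτ s hs).2] at this
        filter_upwards [hev, (hcx x).eventually_lt_const h1] with s' h2 h3
        exact hgt s' h2 x h3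
      · filter_upwards [hev] with s' h2
        exact (not_le.1 hx0).trans (hpos s' h2)
    · have h1 : 0 < modulusDefect l a s x := by
        have := modulusDefect_strictMono hl a s (hpos s hs).le hx
        rwa [(hτ s hs).2] at this
      filter_upwards [hev, (hcx x).eventually_const_lt h1] with s' h2 h3
      exact hlt s' h2 x ((hpos s hs).trans hx).le h3
  let L : ℝ → ℂ := fun s => ⟨s, -τ s⟩
  have hLq : ∀ s, 0 < s → L s ∈ quadrant := fun s hs => ⟨hs, by simpa [L] using hpos s hs⟩
  have hcL : ContinuousOn L (Ioi 0) := by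
    have : L = fun s : ℝ => (s : ℂ) + ((-τ s : ℝ) : ℂ) * Complex.I := by
      funext s
      exact (Complex.mk_eq_add_mul_I _ _)
    rw [this]
    exact Complex.continuous_ofReal.continuousOn.add
      ((Complex.continuous_ofReal.comp_continuousOn hcτ.neg).mul continuousOn_const)
  have hch : ContinuousOn (fun s => (phase l a (L s)).re) (Ioi 0) := by
    intro s hs
    have h1 := (hasDerivAt_phase (l := l) ha (hLq s hs)).continuousAt
    exact (Complex.continuous_re.continuousAt.comp h1).comp_continuousWithinAt (hcL s hs)
  have him : ∀ s, 0 < s → (phase l a (L s)).im = 0 := by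
    intro s hs
    have h1 : ‖mob a (L s)‖ ^ 2 = Real.exp (τ s * l) ^ 2 := by
      rw [norm_mob_sq (hLq s hs), ← Real.exp_nat_mul]
      have h2 := (hτ s hs).2
      unfold modulusDefect at h2
      have h3 := hpos s hs
      simp only [L, neg_sq]
      have h4 : ((2 : ℕ) : ℝ) * (τ s * l) = 2 * τ s * l := by push_cast; ring
      rw [h4]
      have h5 : 0 < (s - a) ^ 2 + τ s ^ 2 := by positivity
      have h6 : 4 * s * a / ((s - a) ^ 2 + τ s ^ 2) = Real.exp (2 * τ s * l) - 1 := by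
        rw [div_eq_iff h5.ne']
        linarith
      rw [h6]
      ring
    have h2 : ‖mob a (L s)‖ = Real.exp (τ s * l) :=
      (pow_left_inj₀ (norm_nonneg _) (Real.exp_pos _).le two_ne_zero).1 h1
    rw [phase_im, h2, Real.log_exp]
    simp [L]
  have hπ := Real.pi_pos
  -- For n = 0 the natural left end point s = 0 is not in the quadrant. It is replaced by a small s₀
  -- at which |λ| < a: there `mob` has negative real part, so arg > π/2 ≥ s₀l.
  have hstart : ∃ s₀, 0 < s₀ ∧ s₀ ≤ (n + 1) * (Real.pi / l) ∧
      (phase l a (L s₀)).re ≤ n * Real.pi := by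
    rcases Nat.eq_zero_or_pos n with hn | hn
    · subst hn
      -- The first bound, with τ(s₀) < a/2, gives |λ| < a; the second gives s₀l ≤ π/2; the third
      -- gives 4s₀a < a³l/4, which forces τ(s₀) < a/2.
      set s₀ := min (a / 2) (min (Real.pi / (2 * l)) (a ^ 2 * l / 32)) with hs₀
      have hs : 0 < s₀ := by rw [hs₀]; positivity
      have h1 : s₀ ≤ a / 2 := min_le_left _ _
      have h2 : s₀ ≤ Real.pi / (2 * l) := (min_le_right _ _).trans (min_le_left _ _)
      have h3 : s₀ ≤ a ^ 2 * l / 32 := (min_le_right _ _).trans (min_le_right _ _)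
      have h4 : τ s₀ < a / 2 := by
        refine hlt s₀ hs _ (by positivity) ?_
        unfold modulusDefect
        have hE := Real.add_one_le_exp (2 * (a / 2) * l)
        have hN : a ^ 2 / 4 ≤ (s₀ - a) ^ 2 + (a / 2) ^ 2 := by nlinarith [sq_nonneg (s₀ - a)]
        have h5 : a * l * (a ^ 2 / 4)
            ≤ (Real.exp (2 * (a / 2) * l) - 1) * ((s₀ - a) ^ 2 + (a / 2) ^ 2) := by
          apply mul_le_mul _ hN (by positivity)
          · have : 0 < a * l := by positivity
            linarith
          · linarith
        have h6 : 0 < a ^ 3 * l := by positivity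
        nlinarith
      have h5 : (mob a (L s₀)).re < 0 := by
        have h0 := Complex.normSq_pos.mpr (sub_ne_zero_of_mem_quadrant (hLq s₀ hs) a)
        rw [mob, Complex.div_re, ← add_div]
        apply div_neg_of_neg_of_pos _ h0
        simp [L]
        nlinarith [hpos s₀ hs]
      have h6 : Real.pi / 2 < (mob a (L s₀)).arg := by
        by_contra hc
        push Not at hc
        have := Complex.abs_arg_le_pi_div_two_iff.1
          (abs_le.2 ⟨by linarith [(arg_mob_mem ha (hLq s₀ hs)).1], hc⟩)
        linarith
      refine ⟨s₀, hs, h2.trans ?_, ?_⟩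
      · rw [div_le_iff₀ (by positivity)]
        field_simp
        norm_num
      · rw [phase_re]
        have h7 : s₀ * l ≤ Real.pi / 2 := by
          rw [le_div_iff₀ (by positivity)] at h2
          linarith
        simp only [L]
        simp only [L] at h6
        push_cast
        linarith
    · have hn' : (0 : ℝ) < n := by exact_mod_cast hn
      refine ⟨n * (Real.pi / l), by positivity, by gcongr; linarith, ?_⟩
      rw [phase_re]
      have := (arg_mob_mem ha (hLq (n * (Real.pi / l)) (by positivity))).1
      have e : (L (n * (Real.pi / l))).re * l = n * Real.pi := by
        simp only [L]
        field_simp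
      linarith
  obtain ⟨s₀, hs₀, hs₁, h0⟩ := hstart
  have h1 : n * Real.pi ≤ (phase l a (L ((n + 1) * (Real.pi / l)))).re := by
    rw [phase_re]
    have := (arg_mob_mem ha (hLq ((n + 1) * (Real.pi / l)) (by positivity))).2
    have e : (L ((n + 1) * (Real.pi / l))).re * l = (n + 1) * Real.pi := by
      simp only [L]
      field_simp
    linarith
  obtain ⟨s, hs, h2⟩ := intermediate_value_Icc hs₁
    (hch.mono fun x hx => hs₀.trans_le hx.1) ⟨h0, h1⟩
  have hs' : 0 < s := hs₀.trans_le hs.1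
  refine ⟨L s, hLq s hs', Complex.ext ?_ ?_⟩
  · refine h2.trans ?_
    simp
  · rw [him s hs']
    simp

/-! ### Asymptotics of the roots -/

theorem exists_bound_of_eventually_bound {f : ℕ → ℝ} {C : ℝ}
    (h : ∀ᶠ n : ℕ in atTop, f n ≤ C / (n + 1)) : ∃ C', 0 ≤ C' ∧ ∀ n : ℕ, f n ≤ C' / (n + 1) := by
  obtain ⟨N, hN⟩ := eventually_atTop.1 h
  refine ⟨|C| + ∑ k ∈ Finset.range N, |f k| * (k + 1), by positivity, fun n => ?_⟩
  have h1 : (0 : ℝ) < n + 1 := by positivity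
  rw [le_div_iff₀ h1]
  have h0 : ∀ k ∈ Finset.range N, 0 ≤ |f k| * (k + 1) := fun _ _ => by positivity
  rcases lt_or_ge n N with hn | hn
  · have := Finset.single_le_sum h0 (Finset.mem_range.2 hn)
    have h2 : f n * (n + 1) ≤ |f n| * (n + 1) := by gcongr; exact le_abs_self _
    have := abs_nonneg C
    linarith
  · have h2 := hN n hn
    rw [le_div_iff₀ h1] at h2
    have := Finset.sum_nonneg h0
    linarith [le_abs_self C]

section Asymptotics

variable {l a : ℝ} {lam : ℕ → ℂ}

theorem lt_re_of_phase (hl : 0 < l) (ha : 0 < a) (hq : ∀ n, lam n ∈ quadrant)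
    (hph : ∀ n : ℕ, phase l a (lam n) = (n : ℤ) * Real.pi) (n : ℕ) :
    n * (Real.pi / l) < (lam n).re := by
  have := (re_bounds_of_phase hl ha (hq n) (hph n)).1
  exact_mod_cast this

/-- `mob` - 1 = 2a/(λ_n - a) is O(1/n) because Re λ_n > nπ/l. The phase equation reads λ_n l - nπ =
-i log(mob), and |log(1 + w)| ≤ (3/2)|w| for |w| ≤ 1/2. -/
theorem exists_mob_bound (hl : 0 < l) (ha : 0 < a) (hq : ∀ n, lam n ∈ quadrant)
    (hph : ∀ n : ℕ, phase l a (lam n) = (n : ℤ) * Real.pi) :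
    (∃ C, 0 ≤ C ∧ ∀ n : ℕ, ‖mob a (lam n) - 1‖ ≤ C / (n + 1)) ∧
    ∃ C, 0 ≤ C ∧ ∀ n : ℕ, ‖lam n * l - n * Real.pi‖ ≤ C / (n + 1) := by
  set c := Real.pi / l with hc
  have hc0 : 0 < c := by positivity
  have hw : ∀ n, mob a (lam n) = 1 + 2 * a / (lam n - a) := fun n => by
    have := sub_ne_zero_of_mem_quadrant (hq n) a
    rw [mob]
    field_simp
    ring
  have hev : ∀ᶠ n : ℕ in atTop, ‖(2 * a / (lam n - a) : ℂ)‖ ≤ 4 * a / c / (n + 1) ∧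
      ‖(2 * a / (lam n - a) : ℂ)‖ ≤ 1 / 2 := by
    -- Large enough for both |λ_n - a| ≥ c(n + 1)/2 and 4a/(c(n + 1)) ≤ 1/2.
    have h1 : ∀ᶠ n : ℕ in atTop, (2 * a + c + 8 * a + 8 * a * c) / c ≤ n :=
      tendsto_natCast_atTop_atTop.eventually_ge_atTop _
    filter_upwards [h1] with n hn
    rw [div_le_iff₀ hc0] at hn
    have hac : 0 < a * c := by positivity
    have h2 : c * (n + 1) / 2 ≤ ‖lam n - a‖ := by
      refine le_trans ?_ (Complex.re_le_norm _)
      rw [Complex.sub_re, Complex.ofReal_re]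
      have := lt_re_of_phase hl ha hq hph n
      rw [← hc] at this
      linarith
    have h3 : ‖(2 * a / (lam n - a) : ℂ)‖ ≤ 4 * a / c / (n + 1) := by
      rw [norm_div]
      have h4 : ‖(2 * a : ℂ)‖ = 2 * a := by
        rw [norm_mul, Complex.norm_real, Real.norm_of_nonneg ha.le]
        simp
      rw [h4, div_le_iff₀ (lt_of_lt_of_le (by positivity) h2)]
      calc 2 * a = 4 * a / c / (n + 1) * (c * (n + 1) / 2) := by field_simp; norm_num
        _ ≤ _ := by gcongr
    refine ⟨h3, h3.trans ?_⟩
    rw [div_div, div_le_iff₀ (by positivity)]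
    nlinarith
  constructor
  · refine exists_bound_of_eventually_bound (C := 4 * a / c) ?_
    filter_upwards [hev] with n hn
    rw [hw, add_sub_cancel_left]
    exact hn.1
  · refine exists_bound_of_eventually_bound (C := 3 / 2 * (4 * a / c)) ?_
    filter_upwards [hev] with n hn
    have h1 : lam n * l - n * Real.pi = -(Complex.I * Complex.log (mob a (lam n))) := by
      have := hph n
      rw [phase] at this
      push_cast at this
      linear_combination this
    rw [h1, norm_neg, norm_mul, Complex.norm_I, one_mul, hw, mul_div_assoc (3 / 2 : ℝ)]
    exact (Complex.norm_log_one_add_half_le_self hn.2).trans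
      (mul_le_mul_of_nonneg_left hn.1 (by norm_num))

theorem exists_im_bound (hl : 0 < l) (ha : 0 < a) (hq : ∀ n, lam n ∈ quadrant)
    (hph : ∀ n : ℕ, phase l a (lam n) = (n : ℤ) * Real.pi) :
    ∃ C, 0 ≤ C ∧ ∀ n : ℕ, |(lam n).im| ≤ C := by
  obtain ⟨C, hC, h⟩ := (exists_mob_bound hl ha hq hph).2
  refine ⟨C / l, by positivity, fun n => ?_⟩
  rw [le_div_iff₀ hl]
  have h1 : (lam n * l - n * Real.pi).im = (lam n).im * l := by
    rw [← Complex.ofReal_natCast, ← Complex.ofReal_mul]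
    simp
  calc |(lam n).im| * l = |(lam n * l - n * Real.pi).im| := by
        rw [h1, abs_mul, abs_of_pos hl]
    _ ≤ _ := (Complex.abs_im_le_norm _).trans (h n)
    _ ≤ C := div_le_self hC (by linarith [n.cast_nonneg (α := ℝ)])

/-- With λ_n = s + it one has Im λ_n² = 2st, where s is unbounded and t tends to 0. The product
stays away from 0 because tl = -log|mob|, and 2 log|mob| ≥ 1 - |mob|⁻² = 4sa/((s + a)² + t²), which
is bounded below by a constant over s. -/
theorem exists_gap (hl : 0 < l) (ha : 0 < a) (hq : ∀ n, lam n ∈ quadrant)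
    (hph : ∀ n : ℕ, phase l a (lam n) = (n : ℤ) * Real.pi) :
    ∃ c, 0 < c ∧ ∀ n : ℕ, (lam n ^ 2).im ≤ -c := by
  obtain ⟨T, hT, hTb⟩ := exists_im_bound hl ha hq hph
  -- A common positive lower bound of all Re λ_n; the index 0 is treated apart since nπ/l vanishes
  -- there.
  set σ := min (lam 0).re (Real.pi / l) with hσ
  have hσ0 : 0 < σ := lt_min (hq 0).1 (by positivity)
  have hs : ∀ n, σ ≤ (lam n).re := fun n => by
    rcases Nat.eq_zero_or_pos n with hn | hn
    · subst hn
      exact min_le_left _ _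
    · refine (min_le_right _ _).trans (le_trans ?_ (lt_re_of_phase hl ha hq hph n).le)
      have : (1 : ℝ) ≤ n := by exact_mod_cast hn
      exact le_mul_of_one_le_left (by positivity) this
  set M := (1 + a / σ) ^ 2 + (T / σ) ^ 2 with hM
  have hM0 : 0 < M := by positivity
  refine ⟨4 * a / (l * M), by positivity, fun n => ?_⟩
  have hs0 := (hq n).1
  set s := (lam n).re with hsdef
  set t := (lam n).im with htdef
  have h1 : (s + a) ^ 2 + t ^ 2 ≤ M * s ^ 2 := by
    have e1 : s + a ≤ (1 + a / σ) * s := by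
      have : a ≤ a / σ * s := by
        rw [div_mul_eq_mul_div, le_div_iff₀ hσ0]
        exact mul_le_mul_of_nonneg_left (hs n) ha.le
      linarith
    have e2 : |t| ≤ T / σ * s := by
      refine (hTb n).trans ?_
      rw [div_mul_eq_mul_div, le_div_iff₀ hσ0]
      exact mul_le_mul_of_nonneg_left (hs n) hT
    have e3 : (s + a) ^ 2 ≤ ((1 + a / σ) * s) ^ 2 := by gcongr
    have e4 : t ^ 2 ≤ (T / σ * s) ^ 2 := by rw [← sq_abs]; gcongr
    rw [hM]
    nlinarith
  have h2 : t * l + Real.log ‖mob a (lam n)‖ = 0 := by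
    rw [← phase_im, hph n]
    simp
  have hN : 0 < (s - a) ^ 2 + t ^ 2 := by
    have := (hq n).2
    have : 0 < t ^ 2 := by rw [sq]; exact mul_pos_of_neg_of_neg this this
    positivity
  have h3 := norm_mob_sq (a := a) (hq n)
  rw [← hsdef, ← htdef] at h3
  have h4 : 4 * s * a / ((s + a) ^ 2 + t ^ 2) ≤ 2 * Real.log ‖mob a (lam n)‖ := by
    have h5 : 0 < ‖mob a (lam n)‖ ^ 2 := by rw [h3]; positivity
    have h6 := Real.one_sub_inv_le_log_of_pos h5
    rw [Real.log_pow] at h6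
    refine le_trans (le_of_eq ?_) (by exact_mod_cast h6)
    rw [h3]
    have : 0 < (s + a) ^ 2 + t ^ 2 := by positivity
    have : 1 + 4 * s * a / ((s - a) ^ 2 + t ^ 2)
        = ((s + a) ^ 2 + t ^ 2) / ((s - a) ^ 2 + t ^ 2) := by
      field_simp
      ring
    rw [this, inv_div]
    field_simp
    ring
  have h5 : 4 * s * a / (M * s ^ 2) ≤ 4 * s * a / ((s + a) ^ 2 + t ^ 2) := by gcongr
  have h6 : 4 * s * a / (M * s ^ 2) = 4 * a / M / s := by field_simp
  have h7 : 4 * a / M / s ≤ -(2 * t * l) := by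
    rw [← h6]
    linarith
  rw [div_le_iff₀ hs0] at h7
  have h8 : (lam n ^ 2).im = 2 * s * t := by
    rw [sq, Complex.mul_im]
    ring
  rw [h8, le_neg, mul_comm l M, ← div_div, div_le_iff₀ hl]
  linarith

end Asymptotics

end Roots

/-! ### Weak derivatives: dependence on the direction, complex test functions -/

section WeakCalculus

variable {E : Type*} [NormedAddCommGroup E] [NormedSpace ℝ E] [MeasureSpace E]

theorem HasWeakDeriv.dir_add {Ω : Set E} [BorelSpace E] [FiniteDimensional ℝ E]
    [IsLocallyFiniteMeasure (volume : Measure E)] {v v' : E} {u w w' : L2 Ω}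
    (h : HasWeakDeriv Ω v u w) (h' : HasWeakDeriv Ω v' u w') :
    HasWeakDeriv Ω (v + v') u (w + w') := by
  intro φ h1 h2 h3
  rw [integral_smul_Lp_add (integrable_smul_L2 h1.continuous h2 w)
    (integrable_smul_L2 h1.continuous h2 w'), neg_add, ← h φ h1 h2 h3, ← h' φ h1 h2 h3,
    ← integral_add (integrable_fderiv_smul_L2 h1 h2 v u) (integrable_fderiv_smul_L2 h1 h2 v' u)]
  simp only [map_add, add_smul]

theorem HasWeakDeriv.dir_smul {Ω : Set E} {v : E} {u w : L2 Ω} (c : ℝ)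
    (h : HasWeakDeriv Ω v u w) : HasWeakDeriv Ω (c • v) u ((c : ℂ) • w) := by
  intro φ h1 h2 h3
  rw [integral_smul_Lp_smul]
  simp only [map_smul, smul_eq_mul, mul_smul]
  rw [integral_smul, h φ h1 h2 h3, smul_neg, Complex.real_smul]

variable [BorelSpace E] [FiniteDimensional ℝ E] [IsLocallyFiniteMeasure (volume : Measure E)]

/-- Both 0 and u - w are weak derivatives of 0 in the zero direction, and weak derivatives are
unique. -/
theorem L2_eq_of_forall_integral_eq {Ω : Set E} (hΩ : IsOpen Ω) {u w : L2 Ω}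
    (h : ∀ φ : E → ℝ, ContDiff ℝ ∞ φ → HasCompactSupport φ → tsupport φ ⊆ Ω →
      ∫ x in Ω, φ x • u x = ∫ x in Ω, φ x • w x) : u = w := by
  have h1 : HasWeakDeriv Ω 0 0 (u + (-1 : ℂ) • w) := by
    intro φ h1 h2 h3
    rw [integral_smul_Lp_add (integrable_smul_L2 h1.continuous h2 _)
      (integrable_smul_L2 h1.continuous h2 _), integral_smul_Lp_smul, h φ h1 h2 h3]
    simp
  have h2 := h1.unique hΩ (hasWeakDeriv_zero Ω 0)
  rw [neg_one_smul, ← sub_eq_add_neg] at h2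
  exact sub_eq_zero.mp h2

theorem hasWeakDeriv_of_complex_re_im {F : Type*} [NormedAddCommGroup F] [NormedSpace ℝ F]
    {Φ : F → ℂ} (hΦ : ContDiff ℝ ∞ Φ) (x v : F) :
    fderiv ℝ (fun x => (Φ x).re) x v = (fderiv ℝ Φ x v).re ∧
      fderiv ℝ (fun x => (Φ x).im) x v = (fderiv ℝ Φ x v).im := by
  have h := (hΦ.differentiable (by simp)).differentiableAt (x := x) |>.hasFDerivAt
  constructor
  · have := (Complex.reCLM.hasFDerivAt.comp x h).fderiv
    exact congrArg (fun L => L v) this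
  · have := (Complex.imCLM.hasFDerivAt.comp x h).fderiv
    exact congrArg (fun L => L v) this

theorem integral_complex_mul_L2 {Ω : Set E} {Φ : E → ℂ} (hΦ : Continuous Φ)
    (hc : HasCompactSupport Φ) (u : L2 Ω) :
    ∫ x in Ω, Φ x * u x
      = (∫ x in Ω, (Φ x).re • u x) + Complex.I * ∫ x in Ω, (Φ x).im • u x := by
  rw [← integral_const_mul, ← integral_add]
  · refine integral_congr_ae (Eventually.of_forall fun x => ?_)
    simp only [Complex.real_smul]
    nth_rw 1 [← Complex.re_add_im (Φ x)]
    ring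
  · exact integrable_smul_L2 (Complex.continuous_re.comp hΦ) (hc.comp_left rfl) u
  · exact (integrable_smul_L2 (Complex.continuous_im.comp hΦ) (hc.comp_left rfl) u).const_mul _

theorem HasWeakDeriv.complex_test {Ω : Set E} {v : E} {u w : L2 Ω} (h : HasWeakDeriv Ω v u w)
    {Φ : E → ℂ} (hΦ : ContDiff ℝ ∞ Φ) (hc : HasCompactSupport Φ) (hs : tsupport Φ ⊆ Ω) :
    ∫ x in Ω, fderiv ℝ Φ x v * u x = -∫ x in Ω, Φ x * w x := by
  rw [integral_complex_mul_L2 ((hΦ.continuous_fderiv (by simp)).clm_apply continuous_const)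
    (hc.fderiv_apply (𝕜 := ℝ) v), integral_complex_mul_L2 hΦ.continuous hc]
  have h1 := h (fun x => (Φ x).re) (Complex.reCLM.contDiff.comp hΦ) (hc.comp_left rfl)
    ((tsupport_comp_subset rfl Φ).trans hs)
  have h2 := h (fun x => (Φ x).im) (Complex.imCLM.contDiff.comp hΦ) (hc.comp_left rfl)
    ((tsupport_comp_subset rfl Φ).trans hs)
  simp only [(hasWeakDeriv_of_complex_re_im hΦ _ _).1] at h1
  simp only [(hasWeakDeriv_of_complex_re_im hΦ _ _).2] at h2
  rw [h1, h2]
  ring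

end WeakCalculus

/-! ### First order weak equations on the interval -/

section Interval

theorem memLp_cont (l : ℝ) {f : ℝ → ℂ} (hf : Continuous f) :
    MemLp f 2 (volume.restrict (Ioo 0 l)) := by
  obtain ⟨C, hC⟩ := isCompact_Icc.exists_bound_of_continuousOn (s := Icc 0 l) hf.continuousOn
  refine MemLp.of_bound hf.aestronglyMeasurable C ?_
  filter_upwards [ae_restrict_mem measurableSet_Ioo] with y hy
  exact hC y (Ioo_subset_Icc_self hy)

/-- A continuous function on the line as an element of `L²(0, l)`. -/
def ofCont (l : ℝ) {f : ℝ → ℂ} (hf : Continuous f) : L2 (Ioo 0 l) := (memLp_cont l hf).toLp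

theorem coeFn_ofCont (l : ℝ) {f : ℝ → ℂ} (hf : Continuous f) :
    ofCont l hf =ᵐ[volume.restrict (Ioo 0 l)] f := (memLp_cont l hf).coeFn_toLp

theorem eq_ofCont {l : ℝ} {f : ℝ → ℂ} (hf : Continuous f) {u : L2 (Ioo 0 l)}
    (h : u =ᵐ[volume.restrict (Ioo 0 l)] f) : u = ofCont l hf :=
  Lp.ext (h.trans (coeFn_ofCont l hf).symm)

theorem smul_ofCont (l : ℝ) {f : ℝ → ℂ} (hf : Continuous f) (c : ℂ) :
    c • ofCont l hf = ofCont l (hf.const_smul c) := by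
  refine eq_ofCont _ ?_
  filter_upwards [Lp.coeFn_smul c (ofCont l hf), coeFn_ofCont l hf] with x h1 h2
  rw [h1, Pi.smul_apply, h2, Pi.smul_apply]

theorem inner_ofCont {l : ℝ} {f g : ℝ → ℂ} (hf : Continuous f) (hg : Continuous g) :
    ⟪ofCont l hf, ofCont l hg⟫_ℂ = ∫ y in Ioo 0 l, (starRingEnd ℂ) (f y) * g y := by
  rw [L2.inner_def]
  refine integral_congr_ae ?_
  filter_upwards [coeFn_ofCont l hf, coeFn_ofCont l hg] with x h1 h2
  rw [h1, h2, mul_comm]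
  rfl

theorem setIntegral_Ioo_eq {l : ℝ} (hl : 0 ≤ l) (f : ℝ → ℂ) :
    ∫ y in Ioo 0 l, f y = ∫ y in 0..l, f y := by
  rw [intervalIntegral.integral_of_le hl, integral_Ioc_eq_integral_Ioo]

theorem hasWeakDeriv_ofCont {l : ℝ} (hl : 0 < l) {f f' : ℝ → ℂ} (hf : Continuous f)
    (hf' : Continuous f') (h : ∀ x, HasDerivAt f (f' x) x) (v : ℝ) :
    HasWeakDeriv (Ioo 0 l) v (ofCont l hf) ((v : ℂ) • ofCont l hf') := by
  suffices h1 : HasWeakDeriv (Ioo 0 l) (1 : ℝ) (ofCont l hf) (ofCont l hf') by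
    have := h1.dir_smul v
    rwa [smul_eq_mul, mul_one] at this
  intro φ h1 h2 h3
  have e1 : ∫ x in Ioo 0 l, (fderiv ℝ φ x 1) • ofCont l hf x
      = ∫ x in 0..l, deriv φ x • f x := by
    rw [← setIntegral_Ioo_eq hl.le]
    refine integral_congr_ae ?_
    filter_upwards [coeFn_ofCont l hf] with x hx
    rw [hx, fderiv_apply_one_eq_deriv]
  have e2 : ∫ x in Ioo 0 l, φ x • ofCont l hf' x = ∫ x in 0..l, φ x • f' x := by
    rw [← setIntegral_Ioo_eq hl.le]
    refine integral_congr_ae ?_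
    filter_upwards [coeFn_ofCont l hf'] with x hx
    rw [hx]
  have h0 : φ 0 = 0 := image_eq_zero_of_notMem_tsupport fun h => (h3 h).1.false
  have hφl : φ l = 0 := image_eq_zero_of_notMem_tsupport fun h => (h3 h).2.false
  have hd : Continuous (deriv φ) := h1.continuous_deriv (by simp)
  rw [e1, e2, intervalIntegral.integral_smul_deriv_eq_deriv_smul
    (fun x _ => (h1.differentiable (by simp)).differentiableAt.hasDerivAt) (fun x _ => h x)
    (hd.intervalIntegrable _ _) (hf'.intervalIntegrable _ _), h0, hφl]
  simp

theorem hasEndValues_ofCont (l : ℝ) {f : ℝ → ℂ} (hf : Continuous f) :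
    HasEndValues l (ofCont l hf) (f 0) (f l) := ⟨f, hf, coeFn_ofCont l hf, rfl, rfl⟩

/-- Two continuous functions that agree almost everywhere on the interval agree at its end points,
so end values do not depend on the representative. -/
theorem HasEndValues.eq_of_ofCont {l : ℝ} (hl : 0 < l) {f : ℝ → ℂ} (hf : Continuous f)
    {a b : ℂ} (h : HasEndValues l (ofCont l hf) a b) : a = f 0 ∧ b = f l := by
  obtain ⟨g, hg, h1, h2, h3⟩ := h
  have h4 : g =ᵐ[volume.restrict (Icc 0 l)] f := by
    rw [← Measure.restrict_congr_set Ioo_ae_eq_Icc]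
    exact h1.symm.trans (coeFn_ofCont l hf)
  have h5 := Measure.eqOn_Icc_of_ae_eq volume hl.ne h4 hg.continuousOn hf.continuousOn
  exact ⟨h2 ▸ h5 (left_mem_Icc.2 hl.le), h3 ▸ h5 (right_mem_Icc.2 hl.le)⟩

theorem eqOn_of_ofCont_eq {l : ℝ} (hl : 0 < l) {f g : ℝ → ℂ} (hf : Continuous f)
    (hg : Continuous g) (h : ofCont l hf = ofCont l hg) : EqOn f g (Icc 0 l) := by
  refine Measure.eqOn_Icc_of_ae_eq volume hl.ne ?_ hf.continuousOn hg.continuousOn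
  rw [← Measure.restrict_congr_set Ioo_ae_eq_Icc]
  refine (coeFn_ofCont l hf).symm.trans ?_
  rw [h]
  exact coeFn_ofCont l hg

/-- A smooth function with compact support in `]0, l[` and integral zero has a primitive with
compact support in `]0, l[`. -/
theorem exists_primitive {l : ℝ} {g : ℝ → ℝ} (hg : ContDiff ℝ ∞ g) {a b : ℝ} (ha : 0 < a)
    (hab : a ≤ b) (hb : b < l) (hs : ∀ x, x ∉ Icc a b → g x = 0) (h0 : ∫ x in Ioo 0 l, g x = 0) :
    ∃ φ : ℝ → ℝ, ContDiff ℝ ∞ φ ∧ HasCompactSupport φ ∧ tsupport φ ⊆ Ioo 0 l ∧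
      ∀ x, fderiv ℝ φ x 1 = g x := by
  have hd : ∀ x, HasDerivAt (fun x => ∫ t in 0..x, g t) (g x) x := fun x =>
    hg.continuous.integral_hasStrictDerivAt 0 x |>.hasDerivAt
  have hzero : ∀ x, x ∉ Icc a b → ∫ t in 0..x, g t = 0 := by
    intro x hx
    rcases lt_or_ge x a with h1 | h1
    · refine intervalIntegral.integral_zero_ae (Eventually.of_forall fun t ht => hs t fun h2 => ?_)
      have : t ≤ max 0 x := ht.2
      exact absurd (h2.1.trans this) (not_le.2 (max_lt ha h1))
    · have h2 : b < x := by
        by_contra h3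
        exact hx ⟨h1, not_lt.1 h3⟩
      have h3 : ∫ t in 0..l, g t = 0 := by
        rw [intervalIntegral.integral_of_le (ha.trans_le hab |>.trans hb).le,
          integral_Ioc_eq_integral_Ioo, h0]
      rw [← intervalIntegral.integral_add_adjacent_intervals (b := l)
        (hg.continuous.intervalIntegrable _ _) (hg.continuous.intervalIntegrable _ _), h3, zero_add]
      refine intervalIntegral.integral_zero_ae (Eventually.of_forall fun t ht => hs t fun h4 => ?_)
      have : min l x < t := ht.1
      exact absurd (this.trans_le h4.2) (not_lt.2 (le_min hb.le h2.le))
  have hsup : tsupport (fun x => ∫ t in 0..x, g t) ⊆ Icc a b :=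
    closure_minimal (fun x hx => by
      by_contra h
      exact hx (hzero x h)) isClosed_Icc
  refine ⟨fun x => ∫ t in 0..x, g t, ?_, HasCompactSupport.intro isCompact_Icc hzero,
    hsup.trans fun x hx => ⟨ha.trans_le hx.1, hx.2.trans_lt hb⟩, fun x => ?_⟩
  · rw [contDiff_infty_iff_deriv]
    refine ⟨fun x => (hd x).differentiableAt, ?_⟩
    rw [funext fun x => (hd x).deriv]
    exact hg
  · rw [fderiv_apply_one_eq_deriv, (hd x).deriv]

/-- The lemma of du Bois-Reymond. -/
theorem HasWeakDeriv.eq_const {l : ℝ} (hl : 0 < l) {u : L2 (Ioo 0 l)}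
    (h : HasWeakDeriv (Ioo 0 l) (1 : ℝ) u 0) :
    ∃ c : ℂ, u = ofCont l (continuous_const (y := c)) := by
  let B : ContDiffBump (l / 2) := ⟨l / 8, l / 4, by positivity, by linarith⟩
  set η : ℝ → ℝ := B.normed volume with hη
  have hη1 : ContDiff ℝ ∞ η := B.contDiff_normed
  have hηs : ∀ x, x ∉ Icc (l / 4) (3 * l / 4) → η x = 0 := by
    intro x hx
    refine image_eq_zero_of_notMem_tsupport fun hx' => hx ?_
    rw [hη, B.tsupport_normed_eq, Real.closedBall_eq_Icc] at hx'
    change x ∈ Icc (l / 2 - l / 4) (l / 2 + l / 4) at hx'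
    exact ⟨by linarith [hx'.1], by linarith [hx'.2]⟩
  have hηc : HasCompactSupport η := B.hasCompactSupport_normed
  have hηI : ∫ x in Ioo 0 l, η x = 1 := by
    rw [setIntegral_eq_integral_of_forall_compl_eq_zero]
    · exact B.integral_normed
    · intro x hx
      refine hηs x fun hx' => hx ⟨by linarith [hx'.1], by linarith [hx'.2]⟩
  set c := ∫ x in Ioo 0 l, η x • u x with hc
  refine ⟨c, L2_eq_of_forall_integral_eq isOpen_Ioo fun ψ h1 h2 h3 => ?_⟩
  set J := ∫ x in Ioo 0 l, ψ x with hJ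
  obtain ⟨a, b, ha, hab, hb, hψs⟩ : ∃ a b, 0 < a ∧ a ≤ b ∧ b < l ∧
      ∀ x, x ∉ Icc a b → ψ x = 0 ∧ η x = 0 := by
    set K := tsupport ψ ∪ Icc (l / 4) (3 * l / 4) with hK
    have hKc : IsCompact K := h2.isCompact.union isCompact_Icc
    have hmem : l / 4 ∈ K := Or.inr ⟨le_rfl, by linarith⟩
    have hsub : K ⊆ Ioo 0 l := union_subset h3 fun x hx =>
      ⟨by linarith [hx.1], by linarith [hx.2]⟩
    obtain ⟨a, haK, ha⟩ := hKc.exists_isLeast ⟨_, hmem⟩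
    obtain ⟨b, hbK, hb⟩ := hKc.exists_isGreatest ⟨_, hmem⟩
    refine ⟨a, b, (hsub haK).1, ha hbK, (hsub hbK).2, fun x hx => ?_⟩
    have hx' : x ∉ K := fun h => hx ⟨ha h, hb h⟩
    exact ⟨image_eq_zero_of_notMem_tsupport fun h => hx' (Or.inl h),
      hηs x fun h => hx' (Or.inr h)⟩
  have hi : ∀ g : ℝ → ℝ, Continuous g → IntegrableOn g (Ioo 0 l) := fun g hg =>
    (hg.integrableOn_Icc (a := 0) (b := l)).mono_set Ioo_subset_Icc_self
  -- ψ - (∫ψ)η has integral zero, hence is the derivative of an admissible test function. Testing u'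
  -- = 0 against it gives ∫ψu = (∫ψ)∫ηu, that is, u is the constant c = ∫ηu.
  obtain ⟨φ, hφ1, hφ2, hφ3, hφ4⟩ := exists_primitive (g := fun x => ψ x - J * η x)
    (h1.sub (contDiff_const.mul hη1)) ha hab hb
    (fun x hx => by rw [(hψs x hx).1, (hψs x hx).2]; simp) (by
      rw [integral_sub (hi _ h1.continuous) ((hi _ hη1.continuous).const_mul J),
        integral_const_mul, hηI]
      simp [hJ])
  have h4 := h φ hφ1 hφ2 hφ3
  have e0 : ∫ x in Ioo 0 l, φ x • (0 : L2 (Ioo 0 l)) x = 0 := by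
    refine integral_eq_zero_of_ae ?_
    filter_upwards [Lp.coeFn_zero ℂ 2 (volume.restrict (Ioo 0 l))] with x hx
    rw [hx]
    simp
  simp only [hφ4] at h4
  rw [e0, neg_zero] at h4
  have e1 : ∫ x in Ioo 0 l, (ψ x - J * η x) • u x
      = (∫ x in Ioo 0 l, ψ x • u x) - J * c := by
    simp only [sub_smul, mul_smul]
    have e2 : Integrable (fun x => J • η x • u x) (volume.restrict (Ioo 0 l)) :=
      (integrable_smul_L2 hη1.continuous hηc u).smul J
    rw [integral_sub (integrable_smul_L2 h1.continuous h2 u) e2, integral_smul, ← hc,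
      Complex.real_smul]
  rw [e1, sub_eq_zero] at h4
  rw [h4]
  have e2 : ∫ x in Ioo 0 l, ψ x • ofCont l (continuous_const (y := c)) x
      = ∫ x in Ioo 0 l, (ψ x : ℂ) * c := by
    refine integral_congr_ae ?_
    filter_upwards [coeFn_ofCont l (continuous_const (y := c))] with x hx
    rw [hx, Complex.real_smul]
  rw [e2, integral_mul_const, integral_complex_ofReal]

/-- Integrating factor: e^{-κy}p has zero weak derivative, hence is constant. The factor is carried
over to the complex test function Φ = φe^{-κy}. -/
theorem HasWeakDeriv.eq_exp {l : ℝ} (hl : 0 < l) {p : L2 (Ioo 0 l)} {κ : ℂ}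
    (h : HasWeakDeriv (Ioo 0 l) (1 : ℝ) p (κ • p)) :
    ∃ c : ℂ, p = ofCont l (f := fun y => c * Complex.exp (κ * y)) (by fun_prop) := by
  have hE : ContDiff ℝ ∞ fun y : ℝ => Complex.exp (-(κ * y)) :=
    (contDiff_const.mul Complex.ofRealCLM.contDiff).neg.cexp
  have hEd : ∀ x : ℝ, HasDerivAt (fun y : ℝ => Complex.exp (-(κ * y)))
      (Complex.exp (-(κ * x)) * (-(κ * 1))) x := fun x =>
    ((Complex.ofRealCLM.hasDerivAt (x := x)).const_mul κ).neg.cexp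
  have hmem : MemLp (fun y : ℝ => Complex.exp (-(κ * y)) * p y) 2 (volume.restrict (Ioo 0 l)) := by
    obtain ⟨C, hC⟩ := isCompact_Icc.exists_bound_of_continuousOn (s := Icc 0 l)
      hE.continuous.continuousOn
    refine (Lp.memLp p).of_le_mul (c := C)
      (hE.continuous.aestronglyMeasurable.mul (Lp.memLp p).1) ?_
    filter_upwards [ae_restrict_mem measurableSet_Ioo] with y hy
    rw [norm_mul]
    exact mul_le_mul_of_nonneg_right (hC y (Ioo_subset_Icc_self hy)) (norm_nonneg _)
  have hq : HasWeakDeriv (Ioo 0 l) (1 : ℝ) hmem.toLp 0 := by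
    intro φ h1 h2 h3
    have e0 : ∫ x in Ioo 0 l, φ x • (0 : L2 (Ioo 0 l)) x = 0 := by
      refine integral_eq_zero_of_ae ?_
      filter_upwards [Lp.coeFn_zero ℂ 2 (volume.restrict (Ioo 0 l))] with x hx
      rw [hx]
      simp
    rw [e0, neg_zero]
    set Φ : ℝ → ℂ := fun y => φ y * Complex.exp (-(κ * y)) with hΦ
    have hφc : ContDiff ℝ ∞ fun y => (φ y : ℂ) := Complex.ofRealCLM.contDiff.comp h1
    have hΦ1 : ContDiff ℝ ∞ Φ := hφc.mul hE
    have hΦ2 : HasCompactSupport Φ := (h2.comp_left (g := fun x : ℝ => (x : ℂ)) (by simp)).mul_right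
    have hΦ3 : tsupport Φ ⊆ Ioo 0 l := by
      refine (tsupport_mul_subset_left).trans ((tsupport_comp_subset (g := fun x : ℝ => (x : ℂ))
        (by simp) φ).trans h3)
    have h5 := h.complex_test hΦ1 hΦ2 hΦ3
    have hder : ∀ x, fderiv ℝ Φ x 1
        = (fderiv ℝ φ x 1) * Complex.exp (-(κ * x)) - κ * Φ x := by
      intro x
      have hφd : HasDerivAt (fun y => (φ y : ℂ)) ((deriv φ x : ℝ) : ℂ) x :=
        ((h1.differentiable (by simp)).differentiableAt.hasDerivAt).ofReal_comp
      rw [fderiv_apply_one_eq_deriv, fderiv_apply_one_eq_deriv, show deriv Φ x = _ from (hφd.mul (hEd x)).deriv, hΦ]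
      ring
    have e1 : ∫ x in Ioo 0 l, Φ x * (κ • p) x = ∫ x in Ioo 0 l, κ * (Φ x * p x) := by
      refine integral_congr_ae ?_
      filter_upwards [Lp.coeFn_smul κ p] with x hx
      rw [hx, Pi.smul_apply, smul_eq_mul]
      ring
    have e2 : ∫ x in Ioo 0 l, (fderiv ℝ φ x 1) • (hmem.toLp : L2 (Ioo 0 l)) x
        = ∫ x in Ioo 0 l, (fderiv ℝ Φ x 1 * p x + κ * (Φ x * p x)) := by
      refine integral_congr_ae ?_
      filter_upwards [hmem.coeFn_toLp] with x hx
      rw [hx, hder, Complex.real_smul]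
      ring
    have hint : ∀ Ψ : ℝ → ℂ, Continuous Ψ → HasCompactSupport Ψ →
        Integrable (fun x => Ψ x * p x) (volume.restrict (Ioo 0 l)) := fun Ψ h6 h7 =>
      memLp_one_iff_integrable.mp ((Lp.memLp p).mul (r := 1)
        ((h6.memLp_of_hasCompactSupport (p := 2) h7).restrict (Ioo 0 l)))
    rw [e2, integral_add, h5, e1, integral_const_mul, neg_add_cancel]
    · exact hint _ ((hΦ1.continuous_fderiv (by simp)).clm_apply continuous_const)
        (hΦ2.fderiv_apply (𝕜 := ℝ) 1)
    · exact (hint Φ hΦ1.continuous hΦ2).const_mul κ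
  obtain ⟨c, hc⟩ := hq.eq_const hl
  refine ⟨c, eq_ofCont _ ?_⟩
  have h6 : hmem.toLp =ᵐ[volume.restrict (Ioo 0 l)] fun _ => c := by
    rw [hc]
    exact coeFn_ofCont l _
  filter_upwards [h6, hmem.coeFn_toLp] with x h7 h8
  rw [h8] at h7
  rw [← h7, mul_right_comm, ← Complex.exp_add]
  simp

end Interval

/-! ### Eigenvalues of the transverse operator -/

section TransverseEigenvalues

variable {l a : ℝ}

theorem continuous_modeFun (a : ℝ) (lam : ℂ) : Continuous (modeFun a lam) := by
  unfold modeFun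
  fun_prop

/-- The function `e^{i λ y} - (λ + a) / (λ - a) e^{-i λ y}`. -/
def modeDer (a : ℝ) (lam : ℂ) (y : ℝ) : ℂ :=
  Complex.exp (Complex.I * lam * y) - (lam + a) / (lam - a) * Complex.exp (-(Complex.I * lam * y))

theorem continuous_modeDer (a : ℝ) (lam : ℂ) : Continuous (modeDer a lam) := by
  unfold modeDer
  fun_prop

theorem hasDerivAt_exp_mul (κ : ℂ) (y : ℝ) :
    HasDerivAt (fun y : ℝ => Complex.exp (κ * y)) (κ * Complex.exp (κ * y)) y := by
  have := ((Complex.ofRealCLM.hasDerivAt (x := y)).const_mul κ).cexp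
  refine this.congr_deriv ?_
  simp [mul_comm]

theorem hasDerivAt_exp_neg_mul (κ : ℂ) (y : ℝ) :
    HasDerivAt (fun y : ℝ => Complex.exp (-(κ * y))) (-κ * Complex.exp (-(κ * y))) y := by
  simpa only [neg_mul] using hasDerivAt_exp_mul (-κ) y

theorem hasDerivAt_modeFun (a : ℝ) (lam : ℂ) (y : ℝ) :
    HasDerivAt (modeFun a lam) (Complex.I * lam * modeDer a lam y) y := by
  refine ((hasDerivAt_exp_mul (Complex.I * lam) y).add
    ((hasDerivAt_exp_neg_mul (Complex.I * lam) y).const_mul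
      ((lam + a) / (lam - a)))).congr_deriv ?_
  rw [modeDer]
  ring

theorem hasDerivAt_modeDer (a : ℝ) (lam : ℂ) (y : ℝ) :
    HasDerivAt (modeDer a lam) (Complex.I * lam * modeFun a lam y) y := by
  refine ((hasDerivAt_exp_mul (Complex.I * lam) y).sub
    ((hasDerivAt_exp_neg_mul (Complex.I * lam) y).const_mul
      ((lam + a) / (lam - a)))).congr_deriv ?_
  rw [modeFun]
  ring

theorem IsCharRoot.sub_ne_zero (ha : 0 < a) {lam : ℂ} (h : IsCharRoot l a lam) : lam - a ≠ 0 := by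
  intro h0
  have h1 := h.2
  rw [h0, zero_pow two_ne_zero, mul_zero, eq_comm, sq_eq_zero_iff] at h1
  have : (2 * a : ℂ) = 0 := by linear_combination h1 - h0
  simp [ha.ne'] at this

/-- The coefficient (λ + a)/(λ - a) in the mode is chosen for this: the left condition holds for
every λ ≠ a. -/
theorem modeFun_bc_zero {lam : ℂ} (h : lam - a ≠ 0) :
    Complex.I * lam * modeDer a lam 0 = -(Complex.I * a * modeFun a lam 0) := by
  simp only [modeDer, modeFun, Complex.ofReal_zero, mul_zero, neg_zero, Complex.exp_zero]
  field_simp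
  ring

/-- After clearing λ - a and the exponential, the right condition is the characteristic equation. -/
theorem IsCharRoot.bc_right {lam : ℂ} (h : IsCharRoot l a lam) (h1 : lam - a ≠ 0) :
    Complex.I * lam * modeDer a lam l = Complex.I * a * modeFun a lam l := by
  have h2 := h.2
  have hE := Complex.exp_ne_zero (Complex.I * lam * l)
  simp only [modeDer, modeFun, Complex.exp_neg]
  field_simp
  linear_combination h2

theorem modeFun_zero_ne_zero {lam : ℂ} (h0 : lam ≠ 0) (h : lam - a ≠ 0) : modeFun a lam 0 ≠ 0 := by
  have : modeFun a lam 0 = 2 * lam / (lam - a) := by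
    simp only [modeFun, Complex.ofReal_zero, mul_zero, neg_zero, Complex.exp_zero]
    field_simp
    ring
  rw [this]
  exact div_ne_zero (mul_ne_zero two_ne_zero h0) h

/-- The (non normalized) mode as an element of `L²(0, l)`. -/
def modeVec (l a : ℝ) (lam : ℂ) : L2 (Ioo 0 l) := ofCont l (continuous_modeFun a lam)

/-- The (non normalized) derivative of the mode, divided by `i λ`. -/
def modeDerVec (l a : ℝ) (lam : ℂ) : L2 (Ioo 0 l) := ofCont l (continuous_modeDer a lam)

theorem weakDeriv_modeVec (hl : 0 < l) (lam : ℂ) (v : ℝ) :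
    HasWeakDeriv (Ioo 0 l) v (modeVec l a lam) ((v : ℂ) • (Complex.I * lam) • modeDerVec l a lam) := by
  rw [modeDerVec, smul_ofCont]
  exact hasWeakDeriv_ofCont hl _ _ (hasDerivAt_modeFun a lam) v

theorem weakDeriv_modeDerVec (hl : 0 < l) (lam : ℂ) (v : ℝ) :
    HasWeakDeriv (Ioo 0 l) v (modeDerVec l a lam) ((v : ℂ) • (Complex.I * lam) • modeVec l a lam) := by
  rw [modeVec, smul_ofCont]
  exact hasWeakDeriv_ofCont hl _ _ (hasDerivAt_modeDer a lam) v

theorem modeVec_mem_H2 (hl : 0 < l) (lam : ℂ) : modeVec l a lam ∈ H2 (Ioo 0 l) := fun v =>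
  ⟨_, (H1 _).smul_mem _ ((H1 _).smul_mem _ fun v => ⟨_, weakDeriv_modeDerVec hl lam v⟩),
    weakDeriv_modeVec hl lam v⟩

theorem weakDeriv_one_modeVec (hl : 0 < l) (lam : ℂ) :
    weakDeriv (Ioo 0 l) 1 (modeVec l a lam) = (Complex.I * lam) • modeDerVec l a lam := by
  have := (weakDeriv_modeVec (a := a) hl lam 1).weakDeriv_eq isOpen_Ioo
  rwa [Complex.ofReal_one, one_smul] at this

theorem weakDeriv_one_modeDerVec (hl : 0 < l) (lam : ℂ) :
    weakDeriv (Ioo 0 l) 1 (modeDerVec l a lam) = (Complex.I * lam) • modeVec l a lam := by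
  have := (weakDeriv_modeDerVec (a := a) hl lam 1).weakDeriv_eq isOpen_Ioo
  rwa [Complex.ofReal_one, one_smul] at this

theorem IsCharRoot.modeVec_mem_domain (hl : 0 < l) (ha : 0 < a) {lam : ℂ}
    (h : IsCharRoot l a lam) : modeVec l a lam ∈ (transverseOp l a).domain := by
  have h1 := h.sub_ne_zero ha
  refine ⟨modeVec_mem_H2 hl lam, _, _, hasEndValues_ofCont l _, ?_⟩
  rw [weakDeriv_one_modeVec hl, ← modeFun_bc_zero h1, ← h.bc_right h1]
  exact (hasEndValues_ofCont l _).smul _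

theorem modeVec_ne_zero (hl : 0 < l) {lam : ℂ} (h0 : lam ≠ 0) (h1 : lam - a ≠ 0) :
    modeVec l a lam ≠ 0 := by
  intro h
  have h2 : (0 : L2 (Ioo 0 l)) = ofCont l (f := fun _ => (0 : ℂ)) continuous_const :=
    eq_ofCont _ (Lp.coeFn_zero ℂ 2 _)
  rw [h2] at h
  exact modeFun_zero_ne_zero h0 h1
    (eqOn_of_ofCont_eq hl (continuous_modeFun a lam) continuous_const h (left_mem_Icc.2 hl.le))

theorem IsCharRoot.isEigenvalue (hl : 0 < l) (ha : 0 < a) {lam : ℂ} (h : IsCharRoot l a lam) :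
    IsEigenvalue (transverseOp l a) (lam ^ 2) := by
  refine ⟨⟨modeVec l a lam, h.modeVec_mem_domain hl ha⟩, fun h0 => ?_, ?_⟩
  · exact modeVec_ne_zero hl h.1 (h.sub_ne_zero ha) (congrArg Subtype.val h0)
  · change -weakDeriv (Ioo 0 l) 1 (weakDeriv (Ioo 0 l) 1 (modeVec l a lam)) = _
    rw [weakDeriv_one_modeVec hl, weakDeriv_smul isOpen_Ioo
      (fun v => ⟨_, weakDeriv_modeDerVec hl lam v⟩), weakDeriv_one_modeDerVec hl, smul_smul,
      ← neg_smul]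
    congr 1
    linear_combination (-lam ^ 2) * Complex.I_mul_I

theorem add_ofCont {f g : ℝ → ℂ} (hf : Continuous f) (hg : Continuous g) :
    ofCont l hf + ofCont l hg = ofCont l (hf.add hg) := by
  refine eq_ofCont _ ?_
  filter_upwards [Lp.coeFn_add (ofCont l hf) (ofCont l hg), coeFn_ofCont l hf, coeFn_ofCont l hg]
    with x h1 h2 h3
  rw [h1, Pi.add_apply, h2, h3, Pi.add_apply]

/-- The second order equation factors weakly: with w = u' and κ = ±iλ, the function w + κu solves p'
= κp and is therefore an exponential. The boundary conditions become a homogeneous 2×2 system for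
the two amplitudes, whose determinant vanishes exactly when the characteristic equation holds. -/
theorem IsEigenvalue.isCharRoot (hl : 0 < l) (ha : 0 < a) {lam : ℂ}
    (h : IsEigenvalue (transverseOp l a) (lam ^ 2)) : IsCharRoot l a lam := by
  obtain ⟨⟨u, hu, u₀, u₁, hu1, hw1⟩, hne, heq⟩ := h
  have hne' : u ≠ 0 := fun h0 => hne (Subtype.ext h0)
  set w := weakDeriv (Ioo 0 l) 1 u with hw
  have heq' : weakDeriv (Ioo 0 l) 1 w = -(lam ^ 2 • u) := by
    have : -weakDeriv (Ioo 0 l) 1 w = lam ^ 2 • u := heq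
    rw [← this, neg_neg]
  have du : HasWeakDeriv (Ioo 0 l) (1 : ℝ) u w := hasWeakDeriv_weakDeriv (H2_le_H1 _ hu) 1
  have dw : HasWeakDeriv (Ioo 0 l) (1 : ℝ) w (-(lam ^ 2 • u)) := by
    rw [← heq']
    exact hasWeakDeriv_weakDeriv (weakDeriv_mem_H1 isOpen_Ioo hu 1) 1
  have key : ∀ κ : ℂ, κ ^ 2 = -lam ^ 2 →
      ∃ c : ℂ, w + κ • u = ofCont l (f := fun y => c * Complex.exp (κ * y)) (by fun_prop) := by
    intro κ hκ
    refine HasWeakDeriv.eq_exp hl ?_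
    have := dw.add (du.smul κ)
    convert this using 1
    rw [smul_add, smul_smul, ← sq, hκ, neg_smul, add_comm]
  obtain ⟨β, hβ⟩ := key (Complex.I * lam) (by rw [mul_pow, Complex.I_sq]; ring)
  obtain ⟨α, hα⟩ := key (-(Complex.I * lam)) (by rw [neg_sq, mul_pow, Complex.I_sq]; ring)
  have endp := hw1.add (hu1.smul (Complex.I * lam))
  have endm := hw1.add (hu1.smul (-(Complex.I * lam)))
  rw [hβ] at endp
  rw [hα] at endm
  obtain ⟨p0, p1⟩ := endp.eq_of_ofCont hl _
  obtain ⟨m0, m1⟩ := endm.eq_of_ofCont hl _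
  simp only [Complex.ofReal_zero, mul_zero, Complex.exp_zero, mul_one] at p0 m0
  have hI := Complex.I_mul_I
  have hI0 := Complex.I_ne_zero
  have haC : (a : ℂ) ≠ 0 := by exact_mod_cast ha.ne'
  -- For λ = 0 the two factors coincide and u is affine with slope β. The boundary conditions give
  -- β(2 - ial) = 0, and 2 - ial has real part 2, so u = 0.
  by_cases h0 : lam = 0
  · exfalso
    subst h0
    simp only [mul_zero, zero_smul, add_zero, zero_mul, Complex.exp_zero, mul_one] at hβ
    simp only [mul_zero, zero_mul, add_zero, Complex.exp_zero, mul_one] at p0 p1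
    have hlin : HasWeakDeriv (Ioo 0 l) (1 : ℝ)
        (u + (-1 : ℂ) • ofCont l (f := fun y : ℝ => β * y) (by fun_prop)) 0 := by
      have h1 : ∀ x : ℝ, HasDerivAt (fun y : ℝ => β * (y : ℂ)) β x := fun x => by
        simpa using (Complex.ofRealCLM.hasDerivAt (x := x)).const_mul β
      have h2 := hasWeakDeriv_ofCont hl (by fun_prop) continuous_const h1 1
      have := du.add (h2.smul (-1))
      rw [hβ] at this
      convert this using 1
      simp
    obtain ⟨c, hc⟩ := hlin.eq_const hl
    have hu' : u = ofCont l (f := fun y : ℝ => c + β * y) (by fun_prop) := by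
      rw [neg_one_smul, ← sub_eq_add_neg, sub_eq_iff_eq_add, add_ofCont] at hc
      exact hc
    rw [hu'] at hu1
    obtain ⟨q0, q1⟩ := hu1.eq_of_ofCont hl _
    simp only [Complex.ofReal_zero, mul_zero, add_zero] at q0
    have h3 : β * (2 - Complex.I * a * l) = 0 := by
      rw [q0] at p0
      rw [q1] at p1
      linear_combination -p0 - p1
    have h4 : (2 - Complex.I * a * l : ℂ) ≠ 0 := by
      intro h5
      have := congrArg Complex.re h5
      simp at this
    have hβ0 := (mul_eq_zero.1 h3).resolve_right h4
    have hc0 : c = 0 := by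
      rw [q0, hβ0, neg_eq_zero] at p0
      exact (mul_eq_zero.1 p0).resolve_left (mul_ne_zero hI0 haC)
    refine hne' ?_
    rw [hu']
    symm
    refine eq_ofCont _ ?_
    rw [hc0, hβ0]
    simp only [zero_mul, add_zero]
    exact Lp.coeFn_zero ℂ 2 (volume.restrict (Ioo 0 l))
  · refine ⟨h0, ?_⟩
    set P := Complex.exp (Complex.I * lam * l) with hP
    set Q := Complex.exp (-(Complex.I * lam) * l) with hQ
    have hPQ : P * Q = 1 := by
      rw [hP, hQ, ← Complex.exp_add]
      simp
    have e0 : lam * (α + β) = -(a * (β - α)) := by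
      linear_combination (-lam - a) * p0 + (-lam + a) * m0
    have e1 : lam * (α * Q + β * P) = a * (β * P - α * Q) := by
      linear_combination (-lam + a) * p1 + (-lam - a) * m1
    -- `e0` and `e1` are the conditions at 0 and l; eliminating α here, and β in `e3`, uses PQ = 1.
    have e2 : β * (P ^ 2 * (lam - a) ^ 2 - (lam + a) ^ 2) = 0 := by
      linear_combination (lam - a) * P * e1 - (lam + a) * e0 - (lam + a) * (lam - a) * α * hPQ
    have e3 : α * (P ^ 2 * (lam - a) ^ 2 - (lam + a) ^ 2) = 0 := by
      linear_combination (lam - a) * P ^ 2 * e0 - (lam + a) * P * e1 + (lam + a) ^ 2 * α * hPQ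
    by_contra hc
    have hc' := sub_ne_zero.2 hc
    have hβ0 := (mul_eq_zero.1 e2).resolve_right hc'
    have hα0 := (mul_eq_zero.1 e3).resolve_right hc'
    have h5 : w + (Complex.I * lam) • u = w + (-(Complex.I * lam)) • u := by
      rw [hα, hβ, hα0, hβ0]
      simp only [zero_mul]
    have h6 : (2 * (Complex.I * lam)) • u = 0 := by
      rw [neg_smul] at h5
      rw [two_mul, add_smul]
      exact eq_neg_iff_add_eq_zero.1 (add_left_cancel h5)
    exact hne' ((smul_eq_zero.1 h6).resolve_left (mul_ne_zero two_ne_zero (mul_ne_zero hI0 h0)))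

/-- A root with phase kπ lies in the k-th open strip, and the strips of two distinct integers are
disjoint. -/
theorem isTransverseRoot_iff (hl : 0 < l) (ha : 0 < a) (n : ℕ) (lam : ℂ) :
    IsTransverseRoot l a n lam ↔ lam ∈ quadrant ∧ phase l a lam = (n : ℤ) * Real.pi := by
  have hc : 0 < Real.pi / l := by positivity
  constructor
  · rintro ⟨h1, h2, h3⟩
    have h4 := h3.isCharRoot hl ha
    have h5 : lam ∈ quadrant := h4.mem_quadrant hl ha (le_trans (by positivity) h1.le)
    obtain ⟨k, hk⟩ := (isCharRoot_iff_phase ha h5).1 h4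
    obtain ⟨h6, h7⟩ := re_bounds_of_phase hl ha h5 hk
    have h8 : (n : ℝ) < k + 1 := lt_of_mul_lt_mul_right (h1.trans h7) hc.le
    have h9 : (k : ℝ) < n + 1 := lt_of_mul_lt_mul_right (h6.trans h2) hc.le
    have h10 : (n : ℤ) < k + 1 := by exact_mod_cast h8
    have h11 : k < (n : ℤ) + 1 := by exact_mod_cast h9
    have : k = n := by omega
    rw [← this]
    exact ⟨h5, hk⟩
  · rintro ⟨h1, h2⟩
    have h3 := re_bounds_of_phase hl ha h1 h2
    have h4 := ((isCharRoot_iff_phase ha h1).2 ⟨_, h2⟩).isEigenvalue hl ha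
    exact ⟨by exact_mod_cast h3.1, by exact_mod_cast h3.2, h4⟩

theorem existsUnique_transverseRoot (hl : 0 < l) (ha : 0 < a) (n : ℕ) :
    ∃! lam : ℂ, IsTransverseRoot l a n lam := by
  obtain ⟨lam, h1, h2⟩ := exists_phase_eq hl ha n
  refine ⟨lam, (isTransverseRoot_iff hl ha n lam).2 ⟨h1, h2⟩, fun z hz => ?_⟩
  obtain ⟨h3, h4⟩ := (isTransverseRoot_iff hl ha n z).1 hz
  exact injOn_phase hl ha h3 h1 (h4.trans h2.symm)

theorem transverseRoot_spec (hl : 0 < l) (ha : 0 < a) (n : ℕ) :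
    transverseRoot l a n ∈ quadrant ∧
      phase l a (transverseRoot l a n) = (n : ℤ) * Real.pi :=
  (isTransverseRoot_iff hl ha n _).1
    (Classical.epsilon_spec (existsUnique_transverseRoot hl ha n).exists)

theorem isCharRoot_transverseRoot (hl : 0 < l) (ha : 0 < a) (n : ℕ) :
    IsCharRoot l a (transverseRoot l a n) :=
  (isCharRoot_iff_phase ha (transverseRoot_spec hl ha n).1).2 ⟨_, (transverseRoot_spec hl ha n).2⟩

theorem transverse_eigenvalues (hl : 0 < l) (ha : 0 < a) :
    {μ : ℂ | IsEigenvalue (transverseOp l a) μ}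
      = Set.range (fun n : ℕ => transverseRoot l a n ^ 2) := by
  ext μ
  constructor
  · intro hμ
    obtain ⟨lam, hlam, hre⟩ : ∃ lam : ℂ, lam ^ 2 = μ ∧ 0 ≤ lam.re := by
      obtain ⟨z, hz⟩ := IsAlgClosed.exists_pow_nat_eq μ two_pos
      rcases le_total 0 z.re with h | h
      · exact ⟨z, hz, h⟩
      · exact ⟨-z, by rw [neg_sq, hz], by simpa using h⟩
    rw [mem_ofPred_eq, ← hlam] at hμ
    have h1 := hμ.isCharRoot hl ha
    have h2 := h1.mem_quadrant hl ha hre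
    obtain ⟨k, hk⟩ := (isCharRoot_iff_phase ha h2).1 h1
    have h3 := (re_bounds_of_phase hl ha h2 hk).2
    have h4 : (0 : ℝ) < k + 1 := by
      have hc : 0 < Real.pi / l := by positivity
      exact pos_of_mul_pos_left (h2.1.trans h3) hc.le
    have h5 : 0 ≤ k := by
      have : (0 : ℤ) < k + 1 := by exact_mod_cast h4
      omega
    obtain ⟨n, rfl⟩ := Int.eq_ofNat_of_zero_le h5
    obtain ⟨h6, h7⟩ := transverseRoot_spec hl ha n
    refine ⟨n, ?_⟩
    change transverseRoot l a n ^ 2 = μ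
    rw [injOn_phase hl ha h6 h2 (h7.trans hk.symm), hlam]
  · rintro ⟨n, rfl⟩
    exact (isCharRoot_transverseRoot hl ha n).isEigenvalue hl ha

end TransverseEigenvalues

/-! ### The cosine basis of L²(0, l) -/

section CosineBasis

variable {l : ℝ}

theorem besselBound_of_orthogonal {H : Type*} [NormedAddCommGroup H] [InnerProductSpace ℂ H]
    {ψ : ℕ → H} (ho : ∀ i j, i ≠ j → ⟪ψ i, ψ j⟫_ℂ = 0) {C : ℝ} (hC : ∀ i, ‖ψ i‖ ^ 2 ≤ C) :
    BesselBound C (smulSeq ψ) := by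
  intro s c
  have h : ∀ i ∈ s, ⟪c i • ψ i, ∑ j ∈ s, c j • ψ j⟫_ℂ = ((‖c i‖ ^ 2 * ‖ψ i‖ ^ 2 : ℝ) : ℂ) := by
    intro i hi
    rw [inner_sum, Finset.sum_eq_single_of_mem i hi]
    · rw [inner_self_eq_norm_sq_to_K, norm_smul, ← mul_pow]
      norm_cast
    · intro j _ hj
      rw [inner_smul_left, inner_smul_right, ho i j (Ne.symm hj), mul_zero, mul_zero]
  have h2 : ((‖∑ i ∈ s, c i • ψ i‖ ^ 2 : ℝ) : ℂ)
      = ((∑ i ∈ s, ‖c i‖ ^ 2 * ‖ψ i‖ ^ 2 : ℝ) : ℂ) := by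
    have h3 := inner_self_eq_norm_sq_to_K (𝕜 := ℂ) (∑ i ∈ s, c i • ψ i)
    rw [sum_inner, Finset.sum_congr rfl h] at h3
    push_cast
    push_cast at h3
    exact h3.symm
  simp only [smulSeq]
  rw [Complex.ofReal_injective h2, Finset.mul_sum]
  refine Finset.sum_le_sum fun i _ => ?_
  rw [mul_comm]
  exact mul_le_mul_of_nonneg_right (hC i) (by positivity)

theorem norm_ofCont_le (hl : 0 < l) {f : ℝ → ℂ} (hf : Continuous f) {M : ℝ} 
    (h : ∀ y ∈ Icc 0 l, ‖f y‖ ≤ M) : ‖ofCont l hf‖ ≤ √l * M := by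
  have hM : 0 ≤ M := (norm_nonneg _).trans (h 0 (left_mem_Icc.2 hl.le))
  have h1 := inner_self_eq_norm_sq_to_K (𝕜 := ℂ) (ofCont l hf)
  rw [inner_ofCont] at h1
  have h2 : ‖ofCont l hf‖ ^ 2 = ‖∫ y in Ioo 0 l, (starRingEnd ℂ) (f y) * f y‖ := by
    rw [h1, norm_pow, RCLike.norm_ofReal, abs_norm]
  refine le_of_sq_le_sq ?_ (by positivity)
  rw [h2, mul_pow, Real.sq_sqrt hl.le]
  have h3 := norm_setIntegral_le_of_norm_le_const (μ := volume) (s := Ioo 0 l) (C := M ^ 2)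
    (f := fun y => (starRingEnd ℂ) (f y) * f y) (by simp) (fun y hy => by
      rw [norm_mul, RCLike.norm_conj, ← sq]
      exact pow_le_pow_left₀ (norm_nonneg _) (h y (Ioo_subset_Icc_self hy)) 2)
  rw [mul_comm]
  simpa [hl.le] using h3

theorem sub_ofCont {f g : ℝ → ℂ} (hf : Continuous f) (hg : Continuous g) :
    ofCont l hf - ofCont l hg = ofCont l (hf.sub hg) := by
  refine eq_ofCont _ ?_
  filter_upwards [Lp.coeFn_sub (ofCont l hf) (ofCont l hg), coeFn_ofCont l hf, coeFn_ofCont l hg]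
    with x h1 h2 h3
  rw [h1, Pi.sub_apply, h2, h3, Pi.sub_apply]

theorem integral_cos_eq_zero (hl : 0 < l) {k : ℤ} (hk : k ≠ 0) :
    ∫ y in 0..l, Real.cos (k * (Real.pi * y / l)) = 0 := by
  have hc : (k : ℝ) * (Real.pi / l) ≠ 0 := by
    have : (k : ℝ) ≠ 0 := by exact_mod_cast hk
    positivity
  have h1 : ∀ y : ℝ, (k : ℝ) * (Real.pi * y / l) = (k * (Real.pi / l)) * y := fun y => by ring
  simp only [h1]
  rw [intervalIntegral.integral_comp_mul_left _ hc, integral_cos]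
  have h2 : (k : ℝ) * (Real.pi / l) * l = k * Real.pi := by field_simp
  rw [h2, Real.sin_int_mul_pi]
  simp

/-- The function `2 cos(n π y / l)`. -/
def cosFun (l : ℝ) (n : ℕ) (y : ℝ) : ℝ := 2 * Real.cos (n * (Real.pi * y / l))

/-- The function `2 sin(n π y / l)`. -/
def sinFun (l : ℝ) (n : ℕ) (y : ℝ) : ℝ := 2 * Real.sin (n * (Real.pi * y / l))

theorem continuous_cosFun (l : ℝ) (n : ℕ) : Continuous (cosFun l n) := by
  unfold cosFun
  fun_prop

theorem continuous_sinFun (l : ℝ) (n : ℕ) : Continuous (sinFun l n) := by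
  unfold sinFun
  fun_prop

/-- The function `2 cos(n π y / l)` in `L²(0, l)`. -/
def cosVec (l : ℝ) (n : ℕ) : L2 (Ioo 0 l) :=
  ofCont l (Complex.continuous_ofReal.comp (continuous_cosFun l n))

/-- The function `2 i sin(n π y / l)` in `L²(0, l)`. -/
def sinVec (l : ℝ) (n : ℕ) : L2 (Ioo 0 l) :=
  ofCont l (f := fun y => Complex.I * (sinFun l n y : ℂ))
    (continuous_const.mul (Complex.continuous_ofReal.comp (continuous_sinFun l n)))

theorem cosFun_mul_cosFun (l : ℝ) (m n : ℕ) (y : ℝ) : cosFun l m y * cosFun l n y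
    = 2 * Real.cos (((m : ℤ) - n : ℤ) * (Real.pi * y / l))
      + 2 * Real.cos (((m : ℤ) + n : ℤ) * (Real.pi * y / l)) := by
  unfold cosFun
  push_cast
  rw [sub_mul, add_mul, Real.cos_sub, Real.cos_add]
  ring

theorem sinFun_mul_sinFun (l : ℝ) (m n : ℕ) (y : ℝ) : sinFun l m y * sinFun l n y
    = 2 * Real.cos (((m : ℤ) - n : ℤ) * (Real.pi * y / l))
      - 2 * Real.cos (((m : ℤ) + n : ℤ) * (Real.pi * y / l)) := by
  unfold sinFun
  push_cast
  rw [sub_mul, add_mul, Real.cos_sub, Real.cos_add]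
  ring

theorem inner_cosVec (hl : 0 < l) (m n : ℕ) :
    ⟪cosVec l m, cosVec l n⟫_ℂ = ((∫ y in 0..l, cosFun l m y * cosFun l n y : ℝ) : ℂ) := by
  rw [cosVec, cosVec, inner_ofCont, setIntegral_Ioo_eq hl.le, ← intervalIntegral.integral_ofReal]
  simp

theorem inner_sinVec (hl : 0 < l) (m n : ℕ) :
    ⟪sinVec l m, sinVec l n⟫_ℂ = ((∫ y in 0..l, sinFun l m y * sinFun l n y : ℝ) : ℂ) := by
  rw [sinVec, sinVec, inner_ofCont, setIntegral_Ioo_eq hl.le, ← intervalIntegral.integral_ofReal]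
  congr 1
  ext y
  simp only [map_mul, Complex.conj_I, Complex.conj_ofReal, Complex.ofReal_mul]
  linear_combination (-(sinFun l m y : ℂ) * sinFun l n y) * Complex.I_mul_I

theorem inner_cosVec_of_ne (hl : 0 < l) {m n : ℕ} (h : m ≠ n) :
    ⟪cosVec l m, cosVec l n⟫_ℂ = 0 := by
  rw [inner_cosVec hl]
  simp only [cosFun_mul_cosFun]
  rw [intervalIntegral.integral_add (Continuous.intervalIntegrable (by fun_prop) _ _)
    (Continuous.intervalIntegrable (by fun_prop) _ _), intervalIntegral.integral_const_mul,
    intervalIntegral.integral_const_mul, integral_cos_eq_zero hl (by omega),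
    integral_cos_eq_zero hl (by omega)]
  simp

theorem inner_sinVec_of_ne (hl : 0 < l) {m n : ℕ} (h : m ≠ n) :
    ⟪sinVec l m, sinVec l n⟫_ℂ = 0 := by
  rw [inner_sinVec hl]
  simp only [sinFun_mul_sinFun]
  rw [intervalIntegral.integral_sub (Continuous.intervalIntegrable (by fun_prop) _ _)
    (Continuous.intervalIntegrable (by fun_prop) _ _), intervalIntegral.integral_const_mul,
    intervalIntegral.integral_const_mul, integral_cos_eq_zero hl (by omega),
    integral_cos_eq_zero hl (by omega)]
  simp

theorem norm_sinVec_sq_le (hl : 0 < l) (n : ℕ) : ‖sinVec l n‖ ^ 2 ≤ l * 2 ^ 2 := by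
  have h1 : ‖sinVec l n‖ ≤ √l * 2 := by
    unfold sinVec
    refine norm_ofCont_le hl _ fun y _ => ?_
    rw [norm_mul, Complex.norm_I, one_mul, Complex.norm_real, Real.norm_eq_abs, sinFun, abs_mul]
    have := Real.abs_sin_le_one (n * (Real.pi * y / l))
    rw [abs_two]
    linarith
  calc ‖sinVec l n‖ ^ 2 ≤ (√l * 2) ^ 2 := by gcongr
    _ = l * 2 ^ 2 := by rw [mul_pow, Real.sq_sqrt hl.le]

/-- The squared norm is 2l for n ≥ 1 and 4l for n = 0; the cruder bound l covers both. -/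
theorem le_norm_cosVec (hl : 0 < l) (n : ℕ) : √l ≤ ‖cosVec l n‖ := by
  rw [Real.sqrt_le_left (norm_nonneg _)]
  have h1 := inner_self_eq_norm_sq_to_K (𝕜 := ℂ) (cosVec l n)
  rw [inner_cosVec hl] at h1
  have h2 : ∫ y in 0..l, cosFun l n y * cosFun l n y = ‖cosVec l n‖ ^ 2 := by
    have h3 : ((∫ y in 0..l, cosFun l n y * cosFun l n y : ℝ) : ℂ)
      = ((‖cosVec l n‖ ^ 2 : ℝ) : ℂ) := by
      rw [h1]
      norm_cast
    exact Complex.ofReal_injective h3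
  rw [← h2]
  rcases Nat.eq_zero_or_pos n with hn | hn
  · subst hn
    simp [cosFun]
    linarith
  · simp only [cosFun_mul_cosFun]
    rw [intervalIntegral.integral_add (Continuous.intervalIntegrable (by fun_prop) _ _)
      (Continuous.intervalIntegrable (by fun_prop) _ _), intervalIntegral.integral_const_mul,
      intervalIntegral.integral_const_mul, integral_cos_eq_zero hl (k := (n : ℤ) + n) (by omega)]
    simp
    linarith

/-- In the variable x = cos(πy/l): the product formula for cosines turns orthogonality to all
cosines into orthogonality to all polynomials in x, and Weierstrass approximation on [-1, 1] of x ↦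
φ(l arccos(x)/π) reaches every test function φ. -/
theorem cosVec_total (hl : 0 < l) {u : L2 (Ioo 0 l)} (hu : ∀ n, ⟪cosVec l n, u⟫_ℂ = 0) :
    u = 0 := by
  have hint : ∀ g : ℝ → ℝ, Continuous g →
      Integrable (fun y => (g y : ℂ) * u y) (volume.restrict (Ioo 0 l)) := fun g hg =>
    memLp_one_iff_integrable.mp ((Lp.memLp u).mul (r := 1)
      (memLp_cont l (Complex.continuous_ofReal.comp hg)))
  have h0 : ∀ n : ℕ, ∫ y in Ioo 0 l, ((cosFun l n y : ℝ) : ℂ) * u y = 0 := fun n => by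
    rw [← hu n, L2.inner_def]
    refine integral_congr_ae ?_
    filter_upwards [coeFn_ofCont l (Complex.continuous_ofReal.comp (continuous_cosFun l n))]
      with y hy
    rw [cosVec, hy]
    simp [mul_comm]
  have hpow : ∀ k n : ℕ,
      ∫ y in Ioo 0 l, ((cosFun l 1 y ^ k * cosFun l n y : ℝ) : ℂ) * u y = 0 := by
    intro k
    induction k with
    | zero => simpa using h0
    | succ k ih =>
      intro n
      -- The recursion 2cos θ · 2cos nθ = 2cos(n - 1)θ + 2cos(n + 1)θ needs n ≥ 1, because n - 1 is
      -- a natural number subtraction.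
      rcases Nat.eq_zero_or_pos n with hn | hn
      · subst hn
        have h1 : ∀ y, cosFun l 1 y ^ (k + 1) * cosFun l 0 y
            = 2 * (cosFun l 1 y ^ k * cosFun l 1 y) := fun y => by
          simp [cosFun]
          ring
        have h2 : ∀ y, ((cosFun l 1 y ^ (k + 1) * cosFun l 0 y : ℝ) : ℂ) * u y
            = 2 * (((cosFun l 1 y ^ k * cosFun l 1 y : ℝ) : ℂ) * u y) := fun y => by
          rw [h1, Complex.ofReal_mul (2 : ℝ), mul_assoc]
          norm_cast
        simp only [h2]
        rw [integral_const_mul, ih 1, mul_zero]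
      · have h1 : ∀ y, cosFun l 1 y ^ (k + 1) * cosFun l n y
            = cosFun l 1 y ^ k * cosFun l (n - 1) y + cosFun l 1 y ^ k * cosFun l (n + 1) y := by
          intro y
          have h2 := cosFun_mul_cosFun l n 1 y
          have h3 : ((n : ℤ) - (1 : ℕ) : ℤ) = ((n - 1 : ℕ) : ℤ) := by omega
          have h4 : ((n : ℤ) + (1 : ℕ) : ℤ) = ((n + 1 : ℕ) : ℤ) := by omega
          rw [h3, h4, Int.cast_natCast, Int.cast_natCast] at h2
          rw [pow_succ, mul_assoc, mul_comm (cosFun l 1 y) (cosFun l n y), h2]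
          unfold cosFun
          ring
        simp only [h1, Complex.ofReal_add, add_mul]
        have h2 : ∀ j, Integrable (fun y => ((cosFun l 1 y ^ k * cosFun l j y : ℝ) : ℂ) * u y)
            (volume.restrict (Ioo 0 l)) := fun j =>
          hint (fun y => cosFun l 1 y ^ k * cosFun l j y)
            (((continuous_cosFun l 1).pow k).mul (continuous_cosFun l _))
        rw [integral_add (h2 _) (h2 _), ih, ih, add_zero]
  have hpow' : ∀ k : ℕ, ∫ y in Ioo 0 l, ((Real.cos (Real.pi * y / l) ^ k : ℝ) : ℂ) * u y = 0 := by
    intro k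
    have h1 : ∀ y, Real.cos (Real.pi * y / l) ^ k
        = (2 ^ (k + 1))⁻¹ * (cosFun l 1 y ^ k * cosFun l 0 y) := fun y => by
      simp [cosFun, mul_pow]
      field_simp
      ring
    simp only [h1, Complex.ofReal_mul ((2 ^ (k + 1))⁻¹ : ℝ), mul_assoc]
    rw [integral_const_mul, hpow, mul_zero]
  have hpoly : ∀ p : Polynomial ℝ,
      ∫ y in Ioo 0 l, ((p.eval (Real.cos (Real.pi * y / l)) : ℝ) : ℂ) * u y = 0 := by
    intro p
    induction p using Polynomial.induction_on' with
    | add p q hp hq =>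
      simp only [Polynomial.eval_add, Complex.ofReal_add, add_mul]
      rw [integral_add (hint _ (by fun_prop)) (hint _ (by fun_prop)), hp, hq, add_zero]
    | monomial k c =>
      simp only [Polynomial.eval_monomial, Complex.ofReal_mul c, mul_assoc]
      rw [integral_const_mul, hpow', mul_zero]
  refine L2_eq_of_forall_integral_eq isOpen_Ioo fun φ h1 h2 h3 => ?_
  have e0 : ∫ x in Ioo 0 l, φ x • (0 : L2 (Ioo 0 l)) x = 0 := by
    refine integral_eq_zero_of_ae ?_
    filter_upwards [Lp.coeFn_zero ℂ 2 (volume.restrict (Ioo 0 l))] with x hx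
    rw [hx]
    simp
  rw [e0, ← norm_le_zero_iff]
  have hui : Integrable u (volume.restrict (Ioo 0 l)) := (Lp.memLp u).integrable (by norm_num)
  set M := ∫ y in Ioo 0 l, ‖u y‖ with hM
  have hM0 : 0 ≤ M := integral_nonneg fun _ => norm_nonneg _
  refine le_of_forall_pos_le_add fun ε hε => ?_
  obtain ⟨p, hp⟩ := exists_polynomial_near_of_continuousOn (-1) 1
    (fun x => φ (l * Real.arccos x / Real.pi))
    (h1.continuous.comp (by have := Real.continuous_arccos; fun_prop)).continuousOn
    (ε / (M + 1)) (by positivity)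
  have h4 : ∀ y ∈ Ioo 0 l, |φ y - p.eval (Real.cos (Real.pi * y / l))| ≤ ε / (M + 1) := by
    intro y hy
    have h5 := hp (Real.cos (Real.pi * y / l)) ⟨Real.neg_one_le_cos _, Real.cos_le_one _⟩
    have h6 : Real.arccos (Real.cos (Real.pi * y / l)) = Real.pi * y / l := by
      refine Real.arccos_cos (by have := hy.1; positivity) ?_
      rw [div_le_iff₀ hl]
      exact mul_le_mul_of_nonneg_left hy.2.le Real.pi_pos.le
    have h7 : l * Real.arccos (Real.cos (Real.pi * y / l)) / Real.pi = y := by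
      rw [h6]
      field_simp
    simp only [h7] at h5
    rw [abs_sub_comm]
    exact h5.le
  have h5 : ∫ x in Ioo 0 l, φ x • u x
      = ∫ y in Ioo 0 l, ((φ y - p.eval (Real.cos (Real.pi * y / l)) : ℝ) : ℂ) * u y := by
    have : ∀ y, ((φ y - p.eval (Real.cos (Real.pi * y / l)) : ℝ) : ℂ) * u y
        = φ y • u y - ((p.eval (Real.cos (Real.pi * y / l)) : ℝ) : ℂ) * u y := fun y => by
      rw [Complex.ofReal_sub, sub_mul, Complex.real_smul]
    simp only [this]
    rw [integral_sub (integrable_smul_L2 h1.continuous h2 u) (hint _ (by fun_prop)), hpoly,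
      sub_zero]
  rw [h5, zero_add]
  calc _ ≤ ∫ y in Ioo 0 l, ε / (M + 1) * ‖u y‖ := by
        refine norm_integral_le_of_norm_le (hui.norm.const_mul _) ?_
        filter_upwards [ae_restrict_mem measurableSet_Ioo] with y hy
        rw [norm_mul, Complex.norm_real]
        exact mul_le_mul_of_nonneg_right (h4 y hy) (norm_nonneg _)
    _ = ε / (M + 1) * M := by rw [integral_const_mul]
    _ ≤ ε := by
        rw [div_mul_eq_mul_div, div_le_iff₀ (by positivity)]
        nlinarith

/-- The orthonormal basis of normalized cosines. -/
theorem exists_cosBasis (hl : 0 < l) :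
    ∃ e : HilbertBasis ℕ ℂ (L2 (Ioo 0 l)),
      ∀ n, e n = ((‖cosVec l n‖⁻¹ : ℝ) : ℂ) • cosVec l n := by
  have hpos : ∀ n, 0 < ‖cosVec l n‖ := fun n =>
    (Real.sqrt_pos.2 hl).trans_le (le_norm_cosVec hl n)
  have ho : Orthonormal ℂ fun n => ((‖cosVec l n‖⁻¹ : ℝ) : ℂ) • cosVec l n := by
    constructor
    · intro n
      rw [norm_smul, Complex.norm_real, norm_inv, norm_norm, inv_mul_cancel₀ (hpos n).ne']
    · intro m n hmn
      rw [inner_smul_left, inner_smul_right, inner_cosVec_of_ne hl hmn, mul_zero, mul_zero]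
  refine ⟨HilbertBasis.mkOfOrthogonalEqBot ho ?_, fun n => by
    rw [HilbertBasis.coe_mkOfOrthogonalEqBot]⟩
  rw [Submodule.eq_bot_iff]
  intro u hu
  refine cosVec_total hl fun n => ?_
  have h1 := (Submodule.mem_orthogonal _ _).1 hu _ (Submodule.subset_span ⟨n, rfl⟩)
  rw [inner_smul_left] at h1
  refine (mul_eq_zero.1 h1).resolve_left ?_
  rw [Complex.conj_ofReal]
  exact Complex.ofReal_ne_zero.2 (inv_pos.2 (hpos n)).ne'

end CosineBasis

/-! ### The modes form a Riesz basis; their dual basis and derivatives -/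

section ModesRieszBasis

variable {l a : ℝ}

/-! ### The modes are close to the cosines -/

/-- Write iλ_n y = ix + z with x = nπy/l and |z| ≤ |λ_n l - nπ| = O(1/n). Replacing the two
exponentials by e^{ix} and e^{-ix}, and the coefficient `mob` by 1, costs three errors O(1/n), whose
constants add up. -/
theorem eventually_modeFun_sub_le (hl : 0 < l) (ha : 0 < a) :
    ∃ C, 0 ≤ C ∧ ∀ᶠ n : ℕ in atTop, ∀ y ∈ Icc 0 l,
      ‖modeFun a (transverseRoot l a n) y - (cosFun l n y : ℂ)‖ ≤ C / (n + 1) ∧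
      ‖modeDer a (transverseRoot l a n) y - Complex.I * (sinFun l n y : ℂ)‖ ≤ C / (n + 1) := by
  obtain ⟨⟨C₁, hC₁, h1⟩, ⟨C₂, hC₂, h2⟩⟩ := exists_mob_bound hl ha
    (fun n => (transverseRoot_spec hl ha n).1) (fun n => (transverseRoot_spec hl ha n).2)
  refine ⟨2 * C₂ + (1 + C₁) * (2 * C₂) + C₁, by positivity, ?_⟩
  -- This makes |δ| ≤ 1, the range in which |e^ζ - 1| ≤ 2|ζ| is available for |ζ| ≤ |δ|.
  have hev : ∀ᶠ n : ℕ in atTop, C₂ ≤ n := tendsto_natCast_atTop_atTop.eventually_ge_atTop _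
  filter_upwards [hev] with n hn y hy
  have hn1 : (0 : ℝ) < n + 1 := by positivity
  set lam := transverseRoot l a n with hlam
  set δ := lam * l - n * Real.pi with hδ
  set B := mob a lam with hB
  have hδn : ‖δ‖ ≤ C₂ / (n + 1) := h2 n
  have hδ1 : ‖δ‖ ≤ 1 := hδn.trans ((div_le_one hn1).2 (by linarith))
  have hlC : (l : ℂ) ≠ 0 := by exact_mod_cast hl.ne'
  set x : ℝ := n * (Real.pi * y / l) with hx
  set z : ℂ := Complex.I * δ * (y / l : ℝ) with hz
  have hsplit : Complex.I * lam * y = x * Complex.I + z := by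
    rw [hx, hz, hδ]
    push_cast
    field_simp
    ring
  have hzn : ‖z‖ ≤ ‖δ‖ := by
    rw [hz, norm_mul, norm_mul, Complex.norm_I, one_mul, Complex.norm_real, Real.norm_of_nonneg
      (div_nonneg hy.1 hl.le)]
    exact mul_le_of_le_one_right (norm_nonneg _) ((div_le_one hl).2 hy.2)
  have hE : ∀ (ζ : ℂ) (t : ℝ), ‖ζ‖ ≤ ‖δ‖ →
      ‖Complex.exp (t * Complex.I + ζ) - Complex.exp (t * Complex.I)‖ ≤ 2 * C₂ / (n + 1) := by
    intro ζ t hζ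
    rw [Complex.exp_add, ← mul_sub_one, norm_mul, Complex.norm_exp_ofReal_mul_I, one_mul]
    refine (Complex.norm_exp_sub_one_le (hζ.trans hδ1)).trans ?_
    rw [mul_div_assoc]
    linarith
  have e1 := hE z x hzn
  have e2 := hE (-z) (-x) (by rwa [norm_neg])
  rw [← hsplit] at e1
  have hsplit' : ((-x : ℝ) : ℂ) * Complex.I + -z = -(Complex.I * lam * y) := by
    rw [hsplit]
    push_cast
    ring
  rw [hsplit'] at e2
  have e3 : ‖B‖ ≤ 1 + C₁ := by
    have h3 := h1 n
    have h4 : C₁ / (n + 1) ≤ C₁ := div_le_self hC₁ (by linarith [n.cast_nonneg (α := ℝ)])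
    have h5 : ‖B‖ ≤ ‖B - 1‖ + ‖(1 : ℂ)‖ := by
      simpa using norm_add_le (B - 1) 1
    rw [norm_one] at h5
    linarith
  have hcos : (cosFun l n y : ℂ) = Complex.exp (x * Complex.I) + Complex.exp ((-x : ℝ) * Complex.I) := by
    rw [cosFun, ← hx]
    push_cast
    rw [Complex.cos]
    ring_nf
  have hsin : Complex.I * (sinFun l n y : ℂ)
      = Complex.exp (x * Complex.I) - Complex.exp ((-x : ℝ) * Complex.I) := by
    rw [sinFun, ← hx]
    push_cast
    rw [Complex.sin]
    ring_nf
    rw [Complex.I_sq]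
    ring
  have hBe : ‖B * (Complex.exp (-(Complex.I * lam * y)) - Complex.exp ((-x : ℝ) * Complex.I))‖
      ≤ (1 + C₁) * (2 * C₂ / (n + 1)) := by
    rw [norm_mul]
    gcongr
  have hB1 : ‖(B - 1) * Complex.exp ((-x : ℝ) * Complex.I)‖ ≤ C₁ / (n + 1) := by
    rw [norm_mul, Complex.norm_exp_ofReal_mul_I, mul_one]
    exact h1 n
  have htot : (2 * C₂ + (1 + C₁) * (2 * C₂) + C₁) / (n + 1)
      = 2 * C₂ / (n + 1) + (1 + C₁) * (2 * C₂ / (n + 1)) + C₁ / (n + 1) := by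
    field_simp
  rw [htot]
  have hBdef : (lam + a) / (lam - a) = B := rfl
  constructor
  · have : modeFun a lam y - (cosFun l n y : ℂ)
        = (Complex.exp (Complex.I * lam * y) - Complex.exp (x * Complex.I))
        + B * (Complex.exp (-(Complex.I * lam * y)) - Complex.exp ((-x : ℝ) * Complex.I))
        + (B - 1) * Complex.exp ((-x : ℝ) * Complex.I) := by
      rw [modeFun, hcos, hBdef]
      ring
    rw [this]
    exact norm_add₃_le.trans (add_le_add (add_le_add e1 hBe) hB1)
  · have : modeDer a lam y - Complex.I * (sinFun l n y : ℂ)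
        = (Complex.exp (Complex.I * lam * y) - Complex.exp (x * Complex.I))
        + -(B * (Complex.exp (-(Complex.I * lam * y)) - Complex.exp ((-x : ℝ) * Complex.I)))
        + -((B - 1) * Complex.exp ((-x : ℝ) * Complex.I)) := by
      rw [modeDer, hsin, hBdef]
      ring
    rw [this]
    refine norm_add₃_le.trans (add_le_add (add_le_add e1 ?_) ?_)
    · rwa [norm_neg]
    · rwa [norm_neg]

theorem exists_modeVec_sub_le (hl : 0 < l) (ha : 0 < a) :
    (∃ C, 0 ≤ C ∧ ∀ n : ℕ, ‖modeVec l a (transverseRoot l a n) - cosVec l n‖ ≤ C / (n + 1)) ∧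
    ∃ C, 0 ≤ C ∧ ∀ n : ℕ, ‖modeDerVec l a (transverseRoot l a n) - sinVec l n‖ ≤ C / (n + 1) := by
  obtain ⟨C, hC, h⟩ := eventually_modeFun_sub_le hl ha
  constructor
  · refine exists_bound_of_eventually_bound (C := √l * C) ?_
    filter_upwards [h] with n hn
    rw [modeVec, cosVec, sub_ofCont, mul_div_assoc]
    exact norm_ofCont_le hl _ fun y hy => (hn y hy).1
  · refine exists_bound_of_eventually_bound (C := √l * C) ?_
    filter_upwards [h] with n hn
    rw [modeDerVec, sinVec, sub_ofCont, mul_div_assoc]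
    exact norm_ofCont_le hl _ fun y hy => (hn y hy).2

theorem summable_sq_of_le {f : ℕ → ℝ} {C : ℝ} (h0 : ∀ n, 0 ≤ f n) (h : ∀ n : ℕ, f n ≤ C / (n + 1)) :
    Summable fun n => f n ^ 2 := by
  have h1 : Summable fun n : ℕ => C ^ 2 * (1 / ((n : ℝ) + 1) ^ 2) := by
    have := (summable_nat_add_iff 1).2 (Real.summable_one_div_nat_pow.2 (one_lt_two : 1 < 2))
    simpa using this.mul_left (C ^ 2)
  refine Summable.of_nonneg_of_le (fun n => by positivity) (fun n => ?_) h1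
  calc f n ^ 2 ≤ (C / (n + 1)) ^ 2 := pow_le_pow_left₀ (h0 n) (h n) 2
    _ = _ := by rw [div_pow]; ring

theorem transverseRoot_ne_zero (hl : 0 < l) (ha : 0 < a) (n : ℕ) : transverseRoot l a n ≠ 0 :=
  (isCharRoot_transverseRoot hl ha n).1

theorem norm_modeVec_pos (hl : 0 < l) (ha : 0 < a) (n : ℕ) :
    0 < ‖modeVec l a (transverseRoot l a n)‖ :=
  norm_pos_iff.2 (modeVec_ne_zero hl (transverseRoot_ne_zero hl ha n)
    (sub_ne_zero_of_mem_quadrant (transverseRoot_spec hl ha n).1 a))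

theorem transverseMode_eq (l a : ℝ) (n : ℕ) : transverseMode l a n
    = ((‖modeVec l a (transverseRoot l a n)‖⁻¹ : ℝ) : ℂ) • modeVec l a (transverseRoot l a n) := rfl

theorem norm_normalize_sub_le {H : Type*} [NormedAddCommGroup H] [NormedSpace ℂ H] {x y : H}
    (hx : x ≠ 0) (hy : y ≠ 0) :
    ‖((‖x‖⁻¹ : ℝ) : ℂ) • x - ((‖y‖⁻¹ : ℝ) : ℂ) • y‖ ≤ 2 * ‖x - y‖ / ‖y‖ := by
  have hx' : 0 < ‖x‖ := norm_pos_iff.2 hx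
  have hy' : 0 < ‖y‖ := norm_pos_iff.2 hy
  have h1 : ((‖x‖⁻¹ : ℝ) : ℂ) • x - ((‖y‖⁻¹ : ℝ) : ℂ) • y
      = ((‖x‖⁻¹ - ‖y‖⁻¹ : ℝ) : ℂ) • x + ((‖y‖⁻¹ : ℝ) : ℂ) • (x - y) := by
    rw [Complex.ofReal_sub, sub_smul, smul_sub]
    abel
  have h2 : ‖((‖x‖⁻¹ - ‖y‖⁻¹ : ℝ) : ℂ) • x‖ ≤ ‖x - y‖ / ‖y‖ := by
    rw [norm_smul, Complex.norm_real, Real.norm_eq_abs]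
    have h3 : ‖x‖⁻¹ - ‖y‖⁻¹ = (‖y‖ - ‖x‖) / (‖x‖ * ‖y‖) := by
      field_simp
    rw [h3, abs_div, abs_of_pos (mul_pos hx' hy'), div_mul_eq_mul_div, div_le_div_iff₀
      (mul_pos hx' hy') hy']
    have := abs_norm_sub_norm_le y x
    rw [norm_sub_rev] at this
    nlinarith [mul_pos hx' hy']
  have h3 : ‖((‖y‖⁻¹ : ℝ) : ℂ) • (x - y)‖ = ‖x - y‖ / ‖y‖ := by
    rw [norm_smul, Complex.norm_real, norm_inv, norm_norm, div_eq_inv_mul]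
  rw [h1]
  refine (norm_add_le _ _).trans ?_
  rw [h3, two_mul, add_div]
  linarith

/-! ### Orthogonality of the modes for the bilinear pairing -/

theorem sq_sub_sq_ne_zero_of_mem_quadrant {z w : ℂ} (hz : z ∈ quadrant) (hw : w ∈ quadrant)
    (h : z ≠ w) : z ^ 2 - w ^ 2 ≠ 0 := by
  rw [sq_sub_sq]
  refine mul_ne_zero (fun h0 => ?_) (sub_ne_zero.2 h)
  have := congrArg Complex.re h0
  rw [Complex.add_re, Complex.zero_re] at this
  linarith [hz.1, hw.1]

/-- The Wronskian of the two modes is a primitive of (z² - w²) times their product, and it vanishes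
at both ends because both modes satisfy the same boundary conditions. No conjugation occurs: the
conditions are symmetric only for the bilinear pairing. -/
theorem integral_modeFun_mul_modeFun (ha : 0 < a) {z w : ℂ} (hz : IsCharRoot l a z)
    (hw : IsCharRoot l a w) (hne : z ^ 2 - w ^ 2 ≠ 0) :
    ∫ y in 0..l, modeFun a z y * modeFun a w y = 0 := by
  have hd : ∀ y ∈ uIcc 0 l, HasDerivAt
      (fun y => modeFun a z y * (Complex.I * w * modeDer a w y)
        - Complex.I * z * modeDer a z y * modeFun a w y)
      ((z ^ 2 - w ^ 2) * (modeFun a z y * modeFun a w y)) y := by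
    intro y _
    refine (((hasDerivAt_modeFun a z y).mul ((hasDerivAt_modeDer a w y).const_mul _)).sub
      (((hasDerivAt_modeDer a z y).const_mul _).mul (hasDerivAt_modeFun a w y))).congr_deriv ?_
    linear_combination ((w ^ 2 - z ^ 2) * (modeFun a z y * modeFun a w y)) * Complex.I_mul_I
  have h1 := intervalIntegral.integral_eq_sub_of_hasDerivAt hd
    (Continuous.intervalIntegrable (continuous_const.mul
      ((continuous_modeFun a z).mul (continuous_modeFun a w))) _ _)
  rw [intervalIntegral.integral_const_mul, hz.bc_right (hz.sub_ne_zero ha),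
    hw.bc_right (hw.sub_ne_zero ha), modeFun_bc_zero (hz.sub_ne_zero ha),
    modeFun_bc_zero (hw.sub_ne_zero ha)] at h1
  refine (mul_eq_zero.1 (h1.trans ?_)).resolve_left hne
  ring

/-- With M = `modeFun` and D = `modeDer`, M² - D² is the constant 4 `mob`, so MD/(2iz) + 2 `mob` y
is a primitive of M². The value is nonzero because the phase has nonvanishing derivative, that is,
because the root is simple. -/
theorem integral_modeFun_sq (ha : 0 < a) {z : ℂ} (hz : IsCharRoot l a z) (hq : z ∈ quadrant) :
    ∫ y in 0..l, modeFun a z y * modeFun a z y = 2 * mob a z * phaseDeriv l a z := by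
  have h0 := hz.1
  have h1 := hz.sub_ne_zero ha
  have h2 := add_ne_zero_of_mem_quadrant hq a
  have hI := Complex.I_ne_zero
  have hMD : ∀ y : ℝ, modeFun a z y ^ 2 - modeDer a z y ^ 2 = 4 * mob a z := by
    intro y
    have hE : Complex.exp (Complex.I * z * y) * Complex.exp (-(Complex.I * z * y)) = 1 := by
      rw [← Complex.exp_add]
      simp
    rw [modeFun, modeDer, mob]
    linear_combination 4 * ((z + a) / (z - a)) * hE
  have hd : ∀ y ∈ uIcc 0 l, HasDerivAt
      (fun y : ℝ => modeFun a z y * modeDer a z y / (2 * (Complex.I * z)) + 2 * mob a z * y)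
      (modeFun a z y * modeFun a z y) y := by
    intro y _
    have h3 := (((hasDerivAt_modeFun a z y).mul (hasDerivAt_modeDer a z y)).div_const
      (2 * (Complex.I * z))).add
      ((Complex.ofRealCLM.hasDerivAt (x := y)).const_mul (2 * mob a z))
    refine h3.congr_deriv ?_
    rw [Complex.ofRealCLM_apply, Complex.ofReal_one]
    field_simp
    linear_combination -hMD y
  have h3 := intervalIntegral.integral_eq_sub_of_hasDerivAt hd
    (Continuous.intervalIntegrable ((continuous_modeFun a z).mul (continuous_modeFun a z)) _ _)
  rw [h3]
  have e0 : modeFun a z 0 * modeDer a z 0 = 1 - mob a z ^ 2 := by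
    simp only [modeFun, modeDer, mob, Complex.ofReal_zero, mul_zero, neg_zero, Complex.exp_zero]
    ring
  have e1 : modeFun a z l * modeDer a z l = mob a z ^ 2 - 1 := by
    have hE := Complex.exp_ne_zero (Complex.I * z * l)
    have h4 : Complex.exp (Complex.I * z * l) ^ 2 = mob a z ^ 2 := by
      rw [mob, div_pow, eq_div_iff (pow_ne_zero 2 h1)]
      exact hz.2
    have h5 : Complex.exp (-(Complex.I * z * l)) ^ 2 * mob a z ^ 2 = 1 := by
      rw [← h4, ← mul_pow, ← Complex.exp_add]
      simp
    have h6 : (z + a) / (z - a) = mob a z := rfl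
    simp only [modeFun, modeDer, h6]
    linear_combination h4 - h5
  rw [e0, e1, phaseDeriv, mob, sq_sub_sq]
  push_cast
  field_simp
  ring_nf
  rw [Complex.I_sq]
  ring

/-- The complex conjugate of the mode. -/
def conjVec (l a : ℝ) (lam : ℂ) : L2 (Ioo 0 l) :=
  ofCont l (f := fun y => (starRingEnd ℂ) (modeFun a lam y))
    (Complex.continuous_conj.comp (continuous_modeFun a lam))

theorem inner_conjVec (hl : 0 < l) (z w : ℂ) :
    ⟪conjVec l a z, modeVec l a w⟫_ℂ = ∫ y in 0..l, modeFun a z y * modeFun a w y := by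
  rw [conjVec, modeVec, inner_ofCont, setIntegral_Ioo_eq hl.le]
  simp

theorem inner_conjVec_transverseMode_of_ne (hl : 0 < l) (ha : 0 < a) {m n : ℕ} (h : m ≠ n) :
    ⟪conjVec l a (transverseRoot l a n), transverseMode l a m⟫_ℂ = 0 := by
  rw [transverseMode_eq, inner_smul_right, inner_conjVec hl, integral_modeFun_mul_modeFun ha
    (isCharRoot_transverseRoot hl ha n) (isCharRoot_transverseRoot hl ha m), mul_zero]
  obtain ⟨h1, h2⟩ := transverseRoot_spec hl ha m
  obtain ⟨h3, h4⟩ := transverseRoot_spec hl ha n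
  refine sq_sub_sq_ne_zero_of_mem_quadrant h3 h1 fun h5 => h ?_
  rw [h5, h2] at h4
  have := mul_right_cancel₀ (Complex.ofReal_ne_zero.2 Real.pi_ne_zero) h4
  exact_mod_cast this

theorem inner_conjVec_transverseMode_self (hl : 0 < l) (ha : 0 < a) (n : ℕ) :
    ⟪conjVec l a (transverseRoot l a n), transverseMode l a n⟫_ℂ ≠ 0 := by
  have hq := (transverseRoot_spec hl ha n).1
  rw [transverseMode_eq, inner_smul_right, inner_conjVec hl, integral_modeFun_sq ha
    (isCharRoot_transverseRoot hl ha n) hq]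
  refine mul_ne_zero (Complex.ofReal_ne_zero.2 (inv_pos.2 (norm_modeVec_pos hl ha n)).ne')
    (mul_ne_zero (mul_ne_zero two_ne_zero (mob_ne_zero ha hq)) fun h => ?_)
  have := phaseDeriv_re_pos hl ha hq
  rw [h] at this
  exact this.false

/-- Bari's theorem relative to the normalized cosines. Pairing a vanishing series of modes with the
conjugate of the n-th mode isolates the n-th coefficient. -/
theorem isRieszBasis_transverseMode (hl : 0 < l) (ha : 0 < a) :
    IsRieszBasis (transverseMode l a) := by
  obtain ⟨e, he⟩ := exists_cosBasis hl
  obtain ⟨C, hC, h⟩ := (exists_modeVec_sub_le hl ha).1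
  refine isRieszBasis_of_close e ?_ fun c hc n => ?_
  · refine summable_sq_of_le (C := 2 * C / √l) (fun _ => norm_nonneg _) fun n => ?_
    have hsl : 0 < √l := Real.sqrt_pos.2 hl
    have h1 := le_norm_cosVec hl n
    rw [he, transverseMode_eq]
    refine (norm_normalize_sub_le (norm_pos_iff.1 (norm_modeVec_pos hl ha n))
      (norm_pos_iff.1 (hsl.trans_le h1))).trans ?_
    calc _ ≤ 2 * (C / (n + 1)) / √l := by
          gcongr
          exact h n
      _ = _ := by ring
  · have h1 := hc.mapL (innerSL ℂ (conjVec l a (transverseRoot l a n)))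
    rw [map_zero] at h1
    have h2 : (fun k => innerSL ℂ (conjVec l a (transverseRoot l a n)) (c k • transverseMode l a k))
        = fun k => if k = n then c n * ⟪conjVec l a (transverseRoot l a n), transverseMode l a n⟫_ℂ
          else 0 := by
      ext k
      rw [map_smul, smul_eq_mul, innerSL_apply_apply]
      split_ifs with hk
      · rw [hk]
      · rw [inner_conjVec_transverseMode_of_ne hl ha hk, mul_zero]
    rw [h2] at h1
    have h3 := h1.unique (hasSum_ite_eq n _)
    exact (mul_eq_zero.1 h3.symm).resolve_right (inner_conjVec_transverseMode_self hl ha n)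

/-- The dual basis consists of multiples of the complex conjugates of the modes. -/
theorem exists_dualBasis_eq (hl : 0 < l) (ha : 0 < a) (n : ℕ) :
    ∃ κ : ℂ, dualBasis (transverseMode l a) n = κ • conjVec l a (transverseRoot l a n) := by
  set d := ⟪transverseMode l a n, conjVec l a (transverseRoot l a n)⟫_ℂ with hd
  have hd0 : d ≠ 0 := by
    rw [hd, ← inner_conj_symm]
    exact (map_ne_zero _).2 (inner_conjVec_transverseMode_self hl ha n)
  refine ⟨d⁻¹, (isRieszBasis_transverseMode hl ha).dualBasis_eq fun k => ?_⟩
  rw [inner_smul_right]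
  split_ifs with hk
  · rw [hk, ← hd, inv_mul_cancel₀ hd0]
  · rw [← inner_conj_symm, inner_conjVec_transverseMode_of_ne hl ha hk, map_zero, mul_zero]

/-! ### The derivatives of the modes -/

theorem exists_inv_norm_modeVec_le (hl : 0 < l) (ha : 0 < a) :
    ∃ M, 0 ≤ M ∧ ∀ n, ‖modeVec l a (transverseRoot l a n)‖⁻¹ ≤ M := by
  obtain ⟨C, hC, h⟩ := (exists_modeVec_sub_le hl ha).1
  have hsl : 0 < √l := Real.sqrt_pos.2 hl
  have hev : ∀ᶠ n : ℕ in atTop, ‖modeVec l a (transverseRoot l a n)‖⁻¹ ≤ (√l / 2)⁻¹ := by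
    filter_upwards [tendsto_natCast_atTop_atTop.eventually_ge_atTop (2 * C / √l)] with n hn
    rw [div_le_iff₀ hsl] at hn
    refine inv_anti₀ (by positivity) ?_
    have h1 := le_norm_cosVec hl n
    have h2 := h n
    have h3 := norm_sub_norm_le (cosVec l n) (modeVec l a (transverseRoot l a n))
    rw [norm_sub_rev] at h3
    have h4 : C / (n + 1) ≤ √l / 2 := by
      rw [div_le_div_iff₀ (by positivity) two_pos]
      nlinarith
    linarith
  obtain ⟨M, hM⟩ := (isBoundedUnder_of_eventually_le hev).bddAbove_range
  exact ⟨M, (inv_nonneg.2 (norm_nonneg _)).trans (hM ⟨0, rfl⟩), fun n => hM ⟨n, rfl⟩⟩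

/-- The derivative of the normalized mode, divided by `i λ`. -/
def transverseDer (l a : ℝ) (n : ℕ) : L2 (Ioo 0 l) :=
  ((‖modeVec l a (transverseRoot l a n)‖⁻¹ : ℝ) : ℂ) • modeDerVec l a (transverseRoot l a n)

/-- The derivatives are close to 2i sin(nπy/l), an orthogonal family whose term of index 0 is zero.
A Bessel bound, rather than a Riesz basis, is all that convergence of the differentiated series
requires. -/
theorem exists_besselBound_transverseDer (hl : 0 < l) (ha : 0 < a) :
    ∃ C, BesselBound C (smulSeq (transverseDer l a)) := by
  obtain ⟨C, hC, h⟩ := (exists_modeVec_sub_le hl ha).2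
  obtain ⟨M, hM0, hM⟩ := exists_inv_norm_modeVec_le hl ha
  have h1 : BesselBound (l * 2 ^ 2) (smulSeq (sinVec l)) :=
    besselBound_of_orthogonal (fun i j hij => inner_sinVec_of_ne hl hij)
      (fun i => norm_sinVec_sq_le hl i)
  obtain ⟨C', hC'⟩ := h1.of_close (ψ := fun n => modeDerVec l a (transverseRoot l a n))
    (summable_sq_of_le (fun _ => norm_nonneg _) h)
  have hC'0 : 0 ≤ C' := by
    have := hC' {0} fun _ => 1
    simp only [Finset.sum_singleton, norm_one, one_pow, mul_one] at this
    exact (by positivity : (0 : ℝ) ≤ _).trans this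
  refine ⟨C' * M ^ 2, fun s c => ?_⟩
  have h2 := hC' s fun n => c n * ((‖modeVec l a (transverseRoot l a n)‖⁻¹ : ℝ) : ℂ)
  simp only [smulSeq, transverseDer, smul_smul]
  refine h2.trans ?_
  rw [mul_assoc, Finset.mul_sum _ _ (M ^ 2)]
  gcongr with i _
  rw [norm_mul, mul_pow, mul_comm, Complex.norm_real, Real.norm_of_nonneg
    (inv_nonneg.2 (norm_nonneg _))]
  gcongr
  exact hM i

end ModesRieszBasis

/-! ### Weak derivatives and the free Laplacian as Fourier multipliers -/

section FourierSide

open scoped FourierTransform SchwartzMap LineDeriv Laplacian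

variable {m : ℕ}

/-- `w ∈ L²(ℝᵐ)` is the weak derivative of `u ∈ L²(ℝᵐ)` in the direction `v`. -/
def EucDeriv (v : Euc m) (u w : L2Euc m) : Prop :=
  ∀ ψ : Euc m → ℝ, ContDiff ℝ ∞ ψ → HasCompactSupport ψ →
    ∫ x, (fderiv ℝ ψ x v) • u x = -∫ x, ψ x • w x

/-- `w = h u` almost everywhere on the Fourier side. -/
def FourierEq (h : Euc m → ℂ) (u w : L2Euc m) : Prop :=
  (𝓕 w : L2Euc m) =ᵐ[volume] fun ξ => h ξ * (𝓕 u : L2Euc m) ξ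

theorem integrable_smul_L2Euc {g : Euc m → ℝ} (hg : Continuous g) (hc : HasCompactSupport g)
    (u : L2Euc m) : Integrable (fun x => g x • u x) :=
  memLp_one_iff_integrable.mp ((Lp.memLp u).smul (hg.memLp_of_hasCompactSupport (p := 2) hc))

theorem integrable_schwartz_mul (g : 𝓢(Euc m, ℂ)) (u : L2Euc m) :
    Integrable (fun x => g x * u x) :=
  memLp_one_iff_integrable.mp ((Lp.memLp u).mul (r := 1) (g.memLp 2))

theorem EucDeriv.complex_test {v : Euc m} {u w : L2Euc m} (h : EucDeriv v u w)
    {Φ : Euc m → ℂ} (hΦ : ContDiff ℝ ∞ Φ) (hc : HasCompactSupport Φ) :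
    ∫ x, fderiv ℝ Φ x v * u x = -∫ x, Φ x * w x := by
  have key : ∀ {Φ : Euc m → ℂ}, Continuous Φ → HasCompactSupport Φ → ∀ u : L2Euc m,
      ∫ x, Φ x * u x = (∫ x, (Φ x).re • u x) + Complex.I * ∫ x, (Φ x).im • u x := by
    intro Φ hΦ hc u
    rw [← integral_const_mul, ← integral_add]
    · refine integral_congr_ae (Eventually.of_forall fun x => ?_)
      simp only [Complex.real_smul]
      nth_rw 1 [← Complex.re_add_im (Φ x)]
      ring
    · exact integrable_smul_L2Euc (Complex.continuous_re.comp hΦ) (hc.comp_left rfl) u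
    · exact (integrable_smul_L2Euc (Complex.continuous_im.comp hΦ)
        (hc.comp_left rfl) u).const_mul _
  rw [key ((hΦ.continuous_fderiv (by simp)).clm_apply continuous_const)
    (hc.fderiv_apply (𝕜 := ℝ) v), key hΦ.continuous hc]
  have h1 := h (fun x => (Φ x).re) (Complex.reCLM.contDiff.comp hΦ) (hc.comp_left rfl)
  have h2 := h (fun x => (Φ x).im) (Complex.imCLM.contDiff.comp hΦ) (hc.comp_left rfl)
  simp only [(hasWeakDeriv_of_complex_re_im hΦ _ _).1] at h1
  simp only [(hasWeakDeriv_of_complex_re_im hΦ _ _).2] at h2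
  rw [h1, h2]
  ring

/-- Smooth compactly supported cutoffs, converging to `1`, with derivatives converging to `0`. -/
theorem exists_cutoff (v : Euc m) : ∃ (χ : ℕ → Euc m → ℝ) (M : ℝ),
    (∀ k, ContDiff ℝ ∞ (χ k)) ∧ (∀ k, HasCompactSupport (χ k)) ∧ (∀ k x, |χ k x| ≤ 1) ∧
    (∀ k x, |fderiv ℝ (χ k) x v| ≤ M) ∧ (∀ x, ∀ᶠ k in atTop, χ k x = 1) ∧
    ∀ x, Tendsto (fun k => fderiv ℝ (χ k) x v) atTop (𝓝 0) := by
  let B : ContDiffBump (0 : Euc m) := ⟨1, 2, one_pos, one_lt_two⟩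
  have hB1 : ContDiff ℝ ∞ B := B.contDiff
  have hBd : Continuous (fderiv ℝ B) := hB1.continuous_fderiv (by simp)
  obtain ⟨M, hM⟩ : ∃ M, ∀ x, ‖fderiv ℝ B x v‖ ≤ M := by
    have hc : Continuous fun x => fderiv ℝ B x v := hBd.clm_apply continuous_const
    exact hc.bounded_above_of_compact_support (B.hasCompactSupport.fderiv_apply (𝕜 := ℝ) v)
  let r : ℕ → ℝ := fun k => ((k : ℝ) + 1)⁻¹
  have hr0 : ∀ k, 0 < r k := fun k => by positivity
  have hr1 : ∀ k, r k ≤ 1 := fun k => inv_le_one_of_one_le₀ (by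
    have := k.cast_nonneg (α := ℝ)
    linarith)
  have hr : Tendsto r atTop (𝓝 0) := by
    have := tendsto_one_div_add_atTop_nhds_zero_nat (𝕜 := ℝ)
    simpa [r] using this
  have hχf : ∀ k x, fderiv ℝ (fun x => B (r k • x)) x v = r k * fderiv ℝ B (r k • x) v := by
    intro k x
    have h1 : HasFDerivAt (fun x : Euc m => r k • x) (r k • ContinuousLinearMap.id ℝ (Euc m)) x :=
      (hasFDerivAt_id x).const_smul (r k)
    have h2 := ((hB1.differentiable (by simp)).differentiableAt (x := r k • x)).hasFDerivAt.comp x h1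
    change fderiv ℝ (B ∘ fun x : Euc m => r k • x) x v = _
    rw [h2.fderiv]
    simp
  refine ⟨fun k x => B (r k • x), M, fun k => hB1.comp (contDiff_const_smul (r k)), fun k =>
    B.hasCompactSupport.comp_homeomorph (Homeomorph.smulOfNeZero (r k) (hr0 k).ne'),
    fun k x => ?_, fun k x => ?_, fun x => ?_, fun x => ?_⟩
  · rw [abs_of_nonneg B.nonneg]
    exact B.le_one
  · rw [hχf, abs_mul, abs_of_nonneg (hr0 k).le]
    have h00 := abs_nonneg (fderiv ℝ B (r k • x) v)
    exact (mul_le_of_le_one_left h00 (hr1 k)).trans (hM _)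
  · have h1 : Tendsto (fun k => r k • x) atTop (𝓝 0) := by simpa using hr.smul_const x
    filter_upwards [h1.eventually (Metric.closedBall_mem_nhds (0 : Euc m) one_pos)] with k hk
    exact B.one_of_mem_closedBall hk
  · have h1 : Tendsto (fun k => r k * M) atTop (𝓝 0) := by simpa using hr.mul_const M
    refine squeeze_zero_norm (fun k => ?_) h1
    rw [hχf, norm_mul, Real.norm_of_nonneg (hr0 k).le]
    exact mul_le_mul_of_nonneg_left (hM _) (hr0 k).le

theorem fderiv_ofReal_mul {χ : Euc m → ℝ} {g : Euc m → ℂ} {x : Euc m}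
    (h1 : DifferentiableAt ℝ χ x) (h2 : DifferentiableAt ℝ g x) (v : Euc m) :
    fderiv ℝ (fun x => (χ x : ℂ) * g x) x v
      = (χ x : ℂ) * fderiv ℝ g x v + (fderiv ℝ χ x v : ℝ) * g x := by
  have h3 : HasFDerivAt (fun x => (χ x : ℂ)) (Complex.ofRealCLM.comp (fderiv ℝ χ x)) x :=
    Complex.ofRealCLM.hasFDerivAt.comp x h1.hasFDerivAt
  have h4 : HasFDerivAt (fun x => (χ x : ℂ) * g x) _ x := h3.mul h2.hasFDerivAt
  rw [h4.fderiv]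
  simp [mul_comm]

theorem tendsto_integral_mul_of_bound {f : ℕ → Euc m → ℂ} {f₀ : Euc m → ℂ} {u : L2Euc m}
    {F : Euc m → ℝ} (hf : ∀ k, Continuous (f k)) (hF : Integrable F)
    (hb : ∀ k x, ‖f k x * u x‖ ≤ F x) (hl : ∀ x, Tendsto (fun k => f k x) atTop (𝓝 (f₀ x))) :
    Tendsto (fun k => ∫ x, f k x * u x) atTop (𝓝 (∫ x, f₀ x * u x)) :=
  tendsto_integral_of_dominated_convergence F
    (fun k => (hf k).aestronglyMeasurable.mul (Lp.memLp u).1) hF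
    (fun k => Eventually.of_forall (hb k)) (Eventually.of_forall fun x => (hl x).mul_const _)

/-- The compact support of the test functions may be replaced by integrability. -/
theorem EucDeriv.integrable_test {v : Euc m} {u w : L2Euc m} (h : EucDeriv v u w)
    {g : Euc m → ℂ} (hg : ContDiff ℝ ∞ g) (i1 : Integrable fun x => fderiv ℝ g x v * u x)
    (i2 : Integrable fun x => g x * u x) (i3 : Integrable fun x => g x * w x) :
    ∫ x, fderiv ℝ g x v * u x = -∫ x, g x * w x := by
  obtain ⟨χ, M, hχd, hχc, hχb, hχM, hχ1, hχ0⟩ := exists_cutoff v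
  have hχC : ∀ k, ContDiff ℝ ∞ fun x => (χ k x : ℂ) := fun k =>
    Complex.ofRealCLM.contDiff.comp (hχd k)
  have hΦd : ∀ k, ContDiff ℝ ∞ fun x => (χ k x : ℂ) * g x := fun k => (hχC k).mul hg
  have hΦc : ∀ k, HasCompactSupport fun x => (χ k x : ℂ) * g x := fun k =>
    ((hχc k).comp_left (g := fun x : ℝ => (x : ℂ)) (by simp)).mul_right
  have hχ1' : ∀ x, Tendsto (fun k => (χ k x : ℂ)) atTop (𝓝 1) := by
    intro x
    refine tendsto_const_nhds.congr' ?_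
    filter_upwards [hχ1 x] with k hk
    rw [hk, Complex.ofReal_one]
  have hχb' : ∀ k x, ‖(χ k x : ℂ)‖ ≤ 1 := fun k x => by
    rw [Complex.norm_real]
    exact hχb k x
  have hfd : ∀ k x, fderiv ℝ (fun x => (χ k x : ℂ) * g x) x v
      = (χ k x : ℂ) * fderiv ℝ g x v + (fderiv ℝ (χ k) x v : ℝ) * g x := fun k x =>
    fderiv_ofReal_mul ((hχd k).differentiable (by simp)).differentiableAt
        (hg.differentiable (by simp)).differentiableAt v
  have hcf : ∀ k, Continuous fun x => fderiv ℝ (fun x => (χ k x : ℂ) * g x) x v := fun k =>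
    ((hΦd k).continuous_fderiv (by simp)).clm_apply continuous_const
  have hi : Integrable fun x => ‖fderiv ℝ g x v * u x‖ + M * ‖g x * u x‖ :=
    i1.norm.add (i2.norm.const_mul M)
  have lim1 : Tendsto (fun k => ∫ x, fderiv ℝ (fun x => (χ k x : ℂ) * g x) x v * u x) atTop
      (𝓝 (∫ x, fderiv ℝ g x v * u x)) := by
    refine tendsto_integral_mul_of_bound
      (f := fun k => fun x => fderiv ℝ (fun x => (χ k x : ℂ) * g x) x v)
      (f₀ := fun x => fderiv ℝ g x v) hcf hi (fun k x => ?_) fun x => ?_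
    · simp only [hfd, add_mul]
      refine (norm_add_le _ _).trans (add_le_add ?_ ?_)
      · rw [mul_assoc, norm_mul]
        exact mul_le_of_le_one_left (norm_nonneg _) (hχb' k x)
      · rw [mul_assoc, norm_mul, Complex.norm_real]
        exact mul_le_mul_of_nonneg_right (hχM k x) (norm_nonneg _)
    · have h1 := ((hχ1' x).mul_const (fderiv ℝ g x v)).add
        (((Complex.continuous_ofReal.tendsto 0).comp (hχ0 x)).mul_const (g x))
      rw [one_mul, Complex.ofReal_zero, zero_mul, add_zero] at h1
      simp only [hfd]
      exact h1
  have lim2 : Tendsto (fun k => ∫ x, ((χ k x : ℂ) * g x) * w x) atTop (𝓝 (∫ x, g x * w x)) := by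
    refine tendsto_integral_mul_of_bound (f := fun k => fun x => (χ k x : ℂ) * g x)
      (f₀ := g) (fun k => (hΦd k).continuous) i3.norm (fun k x => ?_) fun x => ?_
    · simp only [mul_assoc]
      rw [norm_mul]
      exact mul_le_of_le_one_left (norm_nonneg _) (hχb' k x)
    · simpa using (hχ1' x).mul_const (g x)
  refine tendsto_nhds_unique lim1 (lim2.neg.congr fun k => ?_)
  exact (h.complex_test (hΦd k) (hΦc k)).symm

theorem EucDeriv.schwartz_test {v : Euc m} {u w : L2Euc m} (h : EucDeriv v u w)
    (g : 𝓢(Euc m, ℂ)) : ∫ x, (∂_{v} g) x * u x = -∫ x, g x * w x := by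
  have i1 := integrable_schwartz_mul (∂_{v} g) u
  simp only [SchwartzMap.lineDerivOp_apply_eq_fderiv] at i1 ⊢
  exact h.integrable_test (g.smooth ⊤) i1 (integrable_schwartz_mul g u)
    (integrable_schwartz_mul g w)

/-- Bridge between identities of tempered distributions and pointwise ones: compactly supported
smooth functions are Schwartz functions and already separate locally integrable functions. -/
theorem smulLeftCLM_toTemperedDistribution_eq_iff {h : Euc m → ℂ} (hh : h.HasTemperateGrowth)
    (hc : Continuous h) (p q : L2Euc m) :
    TemperedDistribution.smulLeftCLM ℂ h (p : 𝓢'(Euc m, ℂ)) = (q : 𝓢'(Euc m, ℂ)) ↔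
      q =ᵐ[volume] fun ξ => h ξ * p ξ := by
  constructor
  · intro heq
    refine ae_eq_of_integral_contDiff_smul_eq ((Lp.memLp q).locallyIntegrable (by norm_num))
      ?_ fun ψ h1 h2 => ?_
    · exact LocallyIntegrable.continuous_mul hc ((Lp.memLp p).locallyIntegrable (by norm_num))
    · have h3 : HasCompactSupport (Complex.ofRealCLM ∘ ψ) := h2.comp_left rfl
      have h4 : ContDiff ℝ ∞ (Complex.ofRealCLM ∘ ψ) := by fun_prop
      have h5 := congrArg (fun T : 𝓢'(Euc m, ℂ) => T (h3.toSchwartzMap h4)) heq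
      simp only [TemperedDistribution.smulLeftCLM_apply_apply, Lp.toTemperedDistribution_apply,
        SchwartzMap.smulLeftCLM_apply_apply hh] at h5
      simp only [HasCompactSupport.toSchwartzMap_toFun, Function.comp_apply,
        Complex.ofRealCLM_apply, smul_eq_mul] at h5
      simp only [Complex.real_smul]
      rw [← h5]
      refine integral_congr_ae (Eventually.of_forall fun x => ?_)
      simp only []
      ring
  · intro heq
    ext g
    simp only [TemperedDistribution.smulLeftCLM_apply_apply, Lp.toTemperedDistribution_apply,
      SchwartzMap.smulLeftCLM_apply_apply hh]
    refine integral_congr_ae ?_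
    filter_upwards [heq] with x hx
    rw [hx]
    simp only [smul_eq_mul]
    ring

theorem eucDeriv_iff_lineDeriv {v : Euc m} {u w : L2Euc m} :
    EucDeriv v u w ↔ ∂_{v} (u : 𝓢'(Euc m, ℂ)) = (w : 𝓢'(Euc m, ℂ)) := by
  constructor
  · intro h
    ext g
    rw [TemperedDistribution.lineDerivOp_apply_apply, Lp.toTemperedDistribution_apply,
      Lp.toTemperedDistribution_apply]
    have := h.schwartz_test g
    simp only [neg_apply, smul_eq_mul, neg_mul]
    rw [integral_neg, this, neg_neg]
  · intro h ψ h1 h2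
    have h3 : HasCompactSupport (Complex.ofRealCLM ∘ ψ) := h2.comp_left rfl
    have h4 : ContDiff ℝ ∞ (Complex.ofRealCLM ∘ ψ) := by fun_prop
    have h5 := congrArg (fun T : 𝓢'(Euc m, ℂ) => T (h3.toSchwartzMap h4)) h
    simp only [TemperedDistribution.lineDerivOp_apply_apply, Lp.toTemperedDistribution_apply] at h5
    have h6 : ∀ x, (-∂_{v} (h3.toSchwartzMap h4)) x = -((fderiv ℝ ψ x v : ℝ) : ℂ) := by
      intro x
      rw [neg_apply, SchwartzMap.lineDerivOp_apply_eq_fderiv]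
      have h7 : HasFDerivAt (Complex.ofRealCLM ∘ ψ) (Complex.ofRealCLM.comp (fderiv ℝ ψ x)) x :=
        Complex.ofRealCLM.hasFDerivAt.comp x
          ((h1.differentiable (by simp)).differentiableAt.hasFDerivAt)
      congr 1
      exact congrArg (fun L => L v) h7.fderiv
    simp only [h6, HasCompactSupport.toSchwartzMap_toFun, Function.comp_apply,
      Complex.ofRealCLM_apply, smul_eq_mul, neg_mul, integral_neg] at h5
    simp only [Complex.real_smul]
    rw [← h5, neg_neg]

theorem toTemperedDistribution_injective' {u w : L2Euc m}
    (h : (u : 𝓢'(Euc m, ℂ)) = (w : 𝓢'(Euc m, ℂ))) : u = w :=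
  toTemperedDistribution_injective m h

theorem fourier_injective_tempered {S T : 𝓢'(Euc m, ℂ)} (h : 𝓕 S = 𝓕 T) : S = T := by
  have := congrArg (fun R : 𝓢'(Euc m, ℂ) => 𝓕⁻ R) h
  simpa using this

theorem smulLeftCLM_const_mul {h : Euc m → ℂ} (hh : h.HasTemperateGrowth) (c : ℂ)
    (T : 𝓢'(Euc m, ℂ)) :
    c • TemperedDistribution.smulLeftCLM ℂ h T
      = TemperedDistribution.smulLeftCLM ℂ (fun ξ => c * h ξ) T := by
  have := TemperedDistribution.smulLeftCLM_smul (F := ℂ) hh c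
  exact (congrArg (fun L => L T) this).symm

/-- The symbol `2 π i ⟨ξ, v⟩` of the derivative in the direction `v`. -/
def derSymbol (v ξ : Euc m) : ℂ := 2 * Real.pi * Complex.I * ((inner ℝ ξ v : ℝ) : ℂ)

/-- The symbol `(2 π)² |ξ|²` of the operator `-Δ`. -/
def lapSymbol (ξ : Euc m) : ℝ := (2 * Real.pi) ^ 2 * ‖ξ‖ ^ 2

/-- Both sides are compared as tempered distributions, on which the Fourier transform is injective
and turns the derivative into multiplication by its symbol. -/
theorem eucDeriv_iff {v : Euc m} {u w : L2Euc m} :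
    EucDeriv v u w ↔ FourierEq (derSymbol v) u w := by
  have hin : (fun ξ : Euc m => ((inner ℝ ξ v : ℝ) : ℂ)).HasTemperateGrowth := by fun_prop
  have hh : (derSymbol v).HasTemperateGrowth := by
    unfold derSymbol
    fun_prop
  have hc : Continuous (derSymbol v) := by
    unfold derSymbol
    fun_prop
  rw [eucDeriv_iff_lineDeriv, FourierEq, ← smulLeftCLM_toTemperedDistribution_eq_iff hh hc,
    ← Lp.fourier_toTemperedDistribution_eq, ← Lp.fourier_toTemperedDistribution_eq]
  have h1 := TemperedDistribution.fourier_lineDerivOp_eq (u : 𝓢'(Euc m, ℂ)) v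
  rw [smulLeftCLM_const_mul hin] at h1
  change _ = TemperedDistribution.smulLeftCLM ℂ (derSymbol v) _ at h1
  rw [← h1]
  exact ⟨fun h => by rw [h], fun h => fourier_injective_tempered h⟩

theorem laplacian_eq_iff {u g : L2Euc m} :
    Δ (u : 𝓢'(Euc m, ℂ)) = (g : 𝓢'(Euc m, ℂ)) ↔ FourierEq (fun ξ => -(lapSymbol ξ : ℂ)) u g := by
  have hin : (fun ξ : Euc m => Complex.ofReal (‖ξ‖ ^ 2)).HasTemperateGrowth := by fun_prop
  have hh : (fun ξ : Euc m => -(lapSymbol ξ : ℂ)).HasTemperateGrowth := by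
    unfold lapSymbol
    fun_prop
  have hc : Continuous fun ξ : Euc m => -(lapSymbol ξ : ℂ) := by
    unfold lapSymbol
    fun_prop
  rw [FourierEq, ← smulLeftCLM_toTemperedDistribution_eq_iff hh hc,
    ← Lp.fourier_toTemperedDistribution_eq, ← Lp.fourier_toTemperedDistribution_eq]
  have h1 : 𝓕 (Δ (u : 𝓢'(Euc m, ℂ)))
      = TemperedDistribution.smulLeftCLM ℂ (fun ξ => -(lapSymbol ξ : ℂ)) (𝓕 (u : 𝓢'(Euc m, ℂ))) := by
    rw [TemperedDistribution.laplacian_eq_fourierMultiplierCLM,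
      TemperedDistribution.fourierMultiplierCLM_apply, ← Complex.coe_smul, FourierTransform.fourier_smul,
      FourierTransform.fourier_fourierInv_eq, smulLeftCLM_const_mul hin]
    congr 2
    ext ξ
    simp [lapSymbol]
  rw [← h1]
  exact ⟨fun h => by rw [h], fun h => fourier_injective_tempered h⟩

theorem FourierEq.unique {h : Euc m → ℂ} {u w w' : L2Euc m} (h1 : FourierEq h u w)
    (h2 : FourierEq h u w') : w = w' :=
  (Lp.fourierTransformₗᵢ (Euc m) ℂ).injective (Lp.ext (h1.trans h2.symm))

/-- Membership in H² asks for (1 + |ξ|²)û in L²; here g = Δu, so this function is û - (2π)⁻²ĝ. -/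
theorem mem_H2Euc_of_fourierEq {u g : L2Euc m} (h : FourierEq (fun ξ => -(lapSymbol ξ : ℂ)) u g) :
    u ∈ H2Euc m := by
  refine TemperedDistribution.memSobolev_iff_exists_smulLeftCLM_fourier.2
    ⟨𝓕 u - (((2 * Real.pi) ^ 2)⁻¹ : ℂ) • 𝓕 g, ?_⟩
  have hh : (fun ξ : Euc m => (((1 + ‖ξ‖ ^ 2) ^ ((2 : ℝ) / 2) : ℝ) : ℂ)).HasTemperateGrowth := by
    fun_prop
  rw [Lp.fourier_toTemperedDistribution_eq]
  refine (smulLeftCLM_toTemperedDistribution_eq_iff hh ?_ _ _).2 ?_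
  · simp only [div_self (two_ne_zero' ℝ), Real.rpow_one]
    fun_prop
  · have hπ : (Real.pi : ℂ) ≠ 0 := Complex.ofReal_ne_zero.2 Real.pi_ne_zero
    filter_upwards [Lp.coeFn_sub (𝓕 u) ((((2 * Real.pi) ^ 2)⁻¹ : ℂ) • 𝓕 g),
      Lp.coeFn_smul (((2 * Real.pi) ^ 2)⁻¹ : ℂ) (𝓕 g), h] with ξ e1 e2 e3
    rw [e1, Pi.sub_apply, e2, Pi.smul_apply, e3, smul_eq_mul, div_self (two_ne_zero' ℝ),
      Real.rpow_one, lapSymbol]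
    push_cast
    field_simp
    ring

theorem laplacianEuc_eq_of_fourierEq {u : H2Euc m} {g : L2Euc m}
    (h : FourierEq (fun ξ => -(lapSymbol ξ : ℂ)) u g) : laplacianEuc u = g :=
  toTemperedDistribution_injective' ((coe_laplacianEuc u).trans (laplacian_eq_iff.2 h))

theorem fourierEq_laplacianEuc (u : H2Euc m) :
    FourierEq (fun ξ => -(lapSymbol ξ : ℂ)) (u : L2Euc m) (laplacianEuc u) :=
  laplacian_eq_iff.1 (coe_laplacianEuc u).symm

/-! ### Fourier multipliers -/

theorem memLp_bcf_mul (b : BoundedContinuousFunction (Euc m) ℂ) (u : L2Euc m) :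
    MemLp (fun ξ => b ξ * u ξ) 2 volume :=
  (Lp.memLp u).of_le_mul (c := ‖b‖) (b.continuous.aestronglyMeasurable.mul (Lp.memLp u).1)
    (Eventually.of_forall fun ξ => by
      rw [norm_mul]
      exact mul_le_mul_of_nonneg_right (b.norm_coe_le_norm ξ) (norm_nonneg _))

theorem norm_bcf_mul_le (b : BoundedContinuousFunction (Euc m) ℂ) (u : L2Euc m) :
    ‖(memLp_bcf_mul b u).toLp‖ ≤ ‖b‖ * ‖u‖ := by
  refine Lp.norm_le_mul_norm_of_ae_le_mul ?_
  filter_upwards [(memLp_bcf_mul b u).coeFn_toLp] with ξ h1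
  rw [h1, norm_mul]
  exact mul_le_mul_of_nonneg_right (b.norm_coe_le_norm ξ) (norm_nonneg _)

/-- Multiplication by a bounded continuous function. -/
def mulL2 (b : BoundedContinuousFunction (Euc m) ℂ) : L2Euc m →L[ℂ] L2Euc m :=
  LinearMap.mkContinuous
    { toFun := fun u => (memLp_bcf_mul b u).toLp
      map_add' := fun u w => by
        refine Lp.ext ?_
        filter_upwards [(memLp_bcf_mul b (u + w)).coeFn_toLp,
          Lp.coeFn_add (memLp_bcf_mul b u).toLp (memLp_bcf_mul b w).toLp,
          (memLp_bcf_mul b u).coeFn_toLp, (memLp_bcf_mul b w).coeFn_toLp,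
          Lp.coeFn_add u w] with ξ h1 h2 h3 h4 h5
        rw [h1, h2, Pi.add_apply, h3, h4, h5, Pi.add_apply, mul_add]
      map_smul' := fun c u => by
        refine Lp.ext ?_
        filter_upwards [(memLp_bcf_mul b (c • u)).coeFn_toLp,
          Lp.coeFn_smul c (memLp_bcf_mul b u).toLp,
          (memLp_bcf_mul b u).coeFn_toLp, Lp.coeFn_smul c u] with ξ h1 h2 h3 h5
        rw [h1, RingHom.id_apply, h2, Pi.smul_apply, h3, h5, Pi.smul_apply, smul_eq_mul,
          smul_eq_mul]
        ring } ‖b‖ fun u => norm_bcf_mul_le b u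

theorem norm_mulL2_le (b : BoundedContinuousFunction (Euc m) ℂ) (u : L2Euc m) :
    ‖mulL2 b u‖ ≤ ‖b‖ * ‖u‖ := norm_bcf_mul_le b u

theorem coeFn_mulL2 (b : BoundedContinuousFunction (Euc m) ℂ) (u : L2Euc m) :
    mulL2 b u =ᵐ[volume] fun ξ => b ξ * u ξ := (memLp_bcf_mul b u).coeFn_toLp

/-- The Fourier multiplier with a bounded continuous symbol. -/
def multOp (b : BoundedContinuousFunction (Euc m) ℂ) : L2Euc m →L[ℂ] L2Euc m :=
  ((Lp.fourierTransformₗᵢ (Euc m) ℂ).symm.toContinuousLinearEquiv : L2Euc m →L[ℂ] L2Euc m) ∘L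
    mulL2 b ∘L
    ((Lp.fourierTransformₗᵢ (Euc m) ℂ).toContinuousLinearEquiv : L2Euc m →L[ℂ] L2Euc m)

theorem fourierEq_multOp (b : BoundedContinuousFunction (Euc m) ℂ) (u : L2Euc m) :
    FourierEq b u (multOp b u) := by
  have h : (𝓕 (multOp b u) : L2Euc m) = mulL2 b (𝓕 u) :=
    (Lp.fourierTransformₗᵢ (Euc m) ℂ).apply_symm_apply _
  rw [FourierEq, h]
  exact coeFn_mulL2 b _

theorem norm_multOp_le (b : BoundedContinuousFunction (Euc m) ℂ) (u : L2Euc m) :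
    ‖multOp b u‖ ≤ ‖b‖ * ‖u‖ := by
  have h1 : ‖multOp b u‖ = ‖mulL2 b (𝓕 u)‖ :=
    (Lp.fourierTransformₗᵢ (Euc m) ℂ).symm.norm_map _
  rw [h1, ← Lp.norm_fourier_eq u]
  exact norm_mulL2_le b _

theorem FourierEq.mul {h k : Euc m → ℂ} {u w z : L2Euc m} (h1 : FourierEq h u w)
    (h2 : FourierEq k w z) : FourierEq (fun ξ => k ξ * h ξ) u z := by
  filter_upwards [h1, h2] with ξ e1 e2
  rw [e2, e1, mul_assoc]

/-- Relates two multiples of the same u without dividing by h, which is allowed to vanish. -/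
theorem FourierEq.of_factor {h k p : Euc m → ℂ} {u w z : L2Euc m} (h1 : FourierEq h u w)
    (h2 : FourierEq k u z) (hp : ∀ ξ, k ξ = p ξ * h ξ) : FourierEq p w z := by
  filter_upwards [h1, h2] with ξ e1 e2
  rw [e2, e1, hp, mul_assoc]

theorem fourierEq_one (u : L2Euc m) : FourierEq (fun _ => 1) u u :=
  Eventually.of_forall fun _ => (one_mul _).symm

theorem FourierEq.add {h k : Euc m → ℂ} {u w z : L2Euc m} (h1 : FourierEq h u w)
    (h2 : FourierEq k u z) : FourierEq (fun ξ => h ξ + k ξ) u (w + z) := by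
  have e : (𝓕 (w + z) : L2Euc m) = 𝓕 w + 𝓕 z := (Lp.fourierTransformₗᵢ (Euc m) ℂ).map_add w z
  rw [FourierEq, e]
  filter_upwards [h1, h2, Lp.coeFn_add (𝓕 w) (𝓕 z)] with ξ e1 e2 e3
  rw [e3, Pi.add_apply, e1, e2, add_mul]

theorem FourierEq.smul {h : Euc m → ℂ} {u w : L2Euc m} (c : ℂ) (h1 : FourierEq h u w) :
    FourierEq (fun ξ => c * h ξ) u (c • w) := by
  have e : (𝓕 (c • w) : L2Euc m) = c • 𝓕 w := (Lp.fourierTransformₗᵢ (Euc m) ℂ).map_smul c w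
  rw [FourierEq, e]
  filter_upwards [h1, Lp.coeFn_smul c (𝓕 w)] with ξ e1 e3
  rw [e3, Pi.smul_apply, e1, smul_eq_mul, mul_assoc]

theorem mem_domain_negLaplacian {u g : L2Euc m}
    (h : FourierEq (fun ξ => -(lapSymbol ξ : ℂ)) u g) : u ∈ (negLaplacian m).domain :=
  mem_H2Euc_of_fourierEq h

theorem negLaplacian_eq {u g : L2Euc m} (hu : u ∈ (negLaplacian m).domain)
    (h : FourierEq (fun ξ => -(lapSymbol ξ : ℂ)) u g) : negLaplacian m ⟨u, hu⟩ = -g :=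
  congrArg Neg.neg (laplacianEuc_eq_of_fourierEq (u := ⟨u, hu⟩) h)

theorem fourierEq_negLaplacian (u : (negLaplacian m).domain) :
    FourierEq (fun ξ => (lapSymbol ξ : ℂ)) (u : L2Euc m) (negLaplacian m u) := by
  have h := (fourierEq_laplacianEuc u).smul (-1)
  have e : (-1 : ℂ) • laplacianEuc u = negLaplacian m u := neg_one_smul _ _
  rw [e] at h
  simpa using h

theorem FourierEq.congr {h k : Euc m → ℂ} {u w : L2Euc m} (h1 : FourierEq h u w)
    (e : ∀ ξ, k ξ = h ξ) : FourierEq k u w := by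
  rwa [funext e]

/-- The resolvent of the free Laplacian is a Fourier multiplier. -/
theorem isResolventAt_negLaplacian {ζ : ℂ} (b : BoundedContinuousFunction (Euc m) ℂ)
    (hb : ∀ ξ, (lapSymbol ξ - ζ) * b ξ = 1) : IsResolventAt (negLaplacian m) ζ (multOp b) := by
  constructor
  · intro f
    have h0 := fourierEq_multOp b f
    generalize multOp b f = w at h0 ⊢
    -- From (4π²|ξ|² - ζ)b = 1 one gets -4π²|ξ|²b = -1 - ζb, that is, Δw = -f - ζw.
    have h1 : FourierEq (fun ξ => -(lapSymbol ξ : ℂ)) w ((-1 : ℂ) • f + (-ζ) • w) := by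
      refine h0.of_factor (((fourierEq_one f).smul (-1)).add (h0.smul (-ζ))) fun ξ => ?_
      linear_combination hb ξ
    refine ⟨mem_domain_negLaplacian h1, ?_⟩
    rw [negLaplacian_eq _ h1, neg_add, neg_smul, neg_smul, neg_neg, neg_neg, one_smul,
      add_sub_cancel_right]
  · intro u
    have h1 := ((fourierEq_negLaplacian u).add ((fourierEq_one (u : L2Euc m)).smul (-ζ)))
    rw [neg_smul, ← sub_eq_add_neg] at h1
    refine FourierEq.unique (h1.mul (fourierEq_multOp b _))
      ((fourierEq_one _).congr fun ξ => ?_)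
    linear_combination hb ξ

end FourierSide

/-! ### Tensor products and components in L²(Ω) -/

section Tensor

variable {m : ℕ} {l : ℝ}

theorem norm_sq_Lp {α : Type*} [MeasurableSpace α] {μ : Measure α} (u : Lp ℂ 2 μ) :
    ‖u‖ ^ 2 = ∫ x, ‖u x‖ ^ 2 ∂μ := by
  have h1 : ⟪u, u⟫_ℂ = ((∫ x, ‖u x‖ ^ 2 ∂μ : ℝ) : ℂ) := by
    rw [L2.inner_def, ← integral_complex_ofReal]
    refine integral_congr_ae (Eventually.of_forall fun y => ?_)
    simp only [inner_self_eq_norm_sq_to_K]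
    norm_cast
  rw [inner_self_eq_norm_sq_to_K] at h1
  exact Complex.ofReal_injective (by simpa using h1)

theorem integrable_norm_sq_Lp {α : Type*} [MeasurableSpace α] {μ : Measure α} (u : Lp ℂ 2 μ) :
    Integrable (fun x => ‖u x‖ ^ 2) μ :=
  (memLp_two_iff_integrable_sq_norm (Lp.memLp u).1).mp (Lp.memLp u)

theorem coeFn_sum_Lp {α : Type*} [MeasurableSpace α] {μ : Measure α} (s : Finset ℕ)
    (u : ℕ → Lp ℂ 2 μ) : ((∑ i ∈ s, u i : Lp ℂ 2 μ) : α → ℂ) =ᵐ[μ] fun x => ∑ i ∈ s, u i x := by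
  classical
  induction s using Finset.induction_on with
  | empty =>
    simp only [Finset.sum_empty]
    exact Lp.coeFn_zero ℂ 2 μ
  | insert i s hi ih =>
    rw [Finset.sum_insert hi]
    filter_upwards [Lp.coeFn_add (u i) (∑ i ∈ s, u i), ih] with x h1 h2
    rw [h1, Pi.add_apply, h2, Finset.sum_insert hi]

theorem coeFn_tensor (f : L2Euc m) (g : L2 (Ioo 0 l)) :
    tensor f g =ᵐ[volume.restrict (guide m l)] fun p => f p.1 * g p.2 :=
  (memLp_tensor f g).coeFn_toLp

theorem coeFn_component (u : L2 (guide m l)) (ψ : L2 (Ioo 0 l)) :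
    component u ψ =ᵐ[volume] componentFun u ψ := (memLp_componentFun u ψ).coeFn_toLp

theorem ae_ae_of_ae_guide {p : Euc m × ℝ → Prop} (h : ∀ᵐ z ∂(volume.restrict (guide m l)), p z) :
    ∀ᵐ x : Euc m, ∀ᵐ y ∂(volume.restrict (Ioo 0 l)), p (x, y) := by
  rw [restrict_guide] at h
  exact Measure.ae_ae_of_ae_prod h

theorem integral_guide {G : Type*} [NormedAddCommGroup G] [NormedSpace ℝ G] {F : Euc m × ℝ → G}
    (hF : Integrable F (volume.restrict (guide m l))) :
    ∫ p in guide m l, F p = ∫ x : Euc m, ∫ y in Ioo 0 l, F (x, y) := by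
  rw [restrict_guide] at hF ⊢
  exact integral_prod F hF

theorem norm_sq_guide (u : L2 (guide m l)) :
    ‖u‖ ^ 2 = ∫ x : Euc m, ∫ y in Ioo 0 l, ‖u (x, y)‖ ^ 2 := by
  rw [norm_sq_Lp]
  exact integral_guide (integrable_norm_sq_Lp u)

/-- Almost all slices of a function of `L²(Ω)` belong to `L²(0, l)`. -/
theorem ae_slice (u : L2 (guide m l)) : ∀ᵐ x : Euc m, ∃ g : L2 (Ioo 0 l),
    g =ᵐ[volume.restrict (Ioo 0 l)] (fun y => u (x, y)) ∧ ∀ ψ, componentFun u ψ x = ⟪ψ, g⟫_ℂ := by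
  have hu : MemLp u 2 ((volume : Measure (Euc m)).prod (volume.restrict (Ioo 0 l))) := by
    rw [← restrict_guide]
    exact Lp.memLp u
  have hu2 := (memLp_two_iff_integrable_sq_norm hu.1).mp hu
  filter_upwards [hu.1.prodMk_left, hu2.prod_right_ae] with x hx1 hx2
  have hx : MemLp (fun y => u (x, y)) 2 (volume.restrict (Ioo 0 l)) :=
    (memLp_two_iff_integrable_sq_norm hx1).mpr hx2
  refine ⟨hx.toLp, hx.coeFn_toLp, fun ψ => ?_⟩
  rw [L2.inner_def]
  refine integral_congr_ae ?_
  filter_upwards [hx.coeFn_toLp] with y hy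
  rw [hy]
  rfl

theorem tensor_add_left (f f' : L2Euc m) (g : L2 (Ioo 0 l)) :
    tensor (f + f') g = tensor f g + tensor f' g := by
  refine Lp.ext ?_
  have h := (Measure.quasiMeasurePreserving_fst (μ := (volume : Measure (Euc m)))
    (ν := volume.restrict (Ioo 0 l))).ae (Lp.coeFn_add f f')
  rw [← restrict_guide] at h
  filter_upwards [coeFn_tensor (f + f') g, coeFn_tensor f g, coeFn_tensor f' g,
    Lp.coeFn_add (tensor f g) (tensor f' g), h] with p h1 h2 h3 h4 h5
  rw [h1, h4, Pi.add_apply, h2, h3, h5, Pi.add_apply, add_mul]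

theorem tensor_smul_left (c : ℂ) (f : L2Euc m) (g : L2 (Ioo 0 l)) :
    tensor (c • f) g = c • tensor f g := by
  refine Lp.ext ?_
  have h := (Measure.quasiMeasurePreserving_fst (μ := (volume : Measure (Euc m)))
    (ν := volume.restrict (Ioo 0 l))).ae (Lp.coeFn_smul c f)
  rw [← restrict_guide] at h
  filter_upwards [coeFn_tensor (c • f) g, coeFn_tensor f g,
    Lp.coeFn_smul c (tensor f g), h] with p h1 h2 h4 h5
  rw [h1, h4, Pi.smul_apply, h2, h5, Pi.smul_apply, smul_eq_mul, smul_eq_mul, mul_assoc]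

theorem tensor_add_right (f : L2Euc m) (g g' : L2 (Ioo 0 l)) :
    tensor f (g + g') = tensor f g + tensor f g' := by
  refine Lp.ext ?_
  have h := (Measure.quasiMeasurePreserving_snd (μ := (volume : Measure (Euc m)))
    (ν := volume.restrict (Ioo 0 l))).ae (Lp.coeFn_add g g')
  rw [← restrict_guide] at h
  filter_upwards [coeFn_tensor f (g + g'), coeFn_tensor f g, coeFn_tensor f g',
    Lp.coeFn_add (tensor f g) (tensor f g'), h] with p h1 h2 h3 h4 h5
  rw [h1, h4, Pi.add_apply, h2, h3, h5, Pi.add_apply, mul_add]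

theorem tensor_smul_right (c : ℂ) (f : L2Euc m) (g : L2 (Ioo 0 l)) :
    tensor f (c • g) = c • tensor f g := by
  refine Lp.ext ?_
  have h := (Measure.quasiMeasurePreserving_snd (μ := (volume : Measure (Euc m)))
    (ν := volume.restrict (Ioo 0 l))).ae (Lp.coeFn_smul c g)
  rw [← restrict_guide] at h
  filter_upwards [coeFn_tensor f (c • g), coeFn_tensor f g,
    Lp.coeFn_smul c (tensor f g), h] with p h1 h2 h4 h5
  rw [h1, h4, Pi.smul_apply, h2, h5, Pi.smul_apply, smul_eq_mul, smul_eq_mul, mul_left_comm]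

/-- Fubini. It exhibits `component` as the adjoint of tensoring by ψ, from which its linearity and
continuity are inherited. -/
theorem inner_tensor_left (f : L2Euc m) (ψ : L2 (Ioo 0 l)) (u : L2 (guide m l)) :
    ⟪tensor f ψ, u⟫_ℂ = ⟪f, component u ψ⟫_ℂ := by
  have hi := L2.integrable_inner (𝕜 := ℂ) (tensor f ψ) u
  rw [L2.inner_def, integral_guide hi, L2.inner_def]
  refine integral_congr_ae ?_
  filter_upwards [ae_ae_of_ae_guide (coeFn_tensor f ψ), coeFn_component u ψ] with x h1 h2
  rw [h2, componentFun]
  simp only [RCLike.inner_apply]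
  rw [← integral_mul_const]
  refine integral_congr_ae ?_
  filter_upwards [h1] with y hy
  rw [hy, map_mul]
  ring

theorem inner_tensor (f h : L2Euc m) (ψ χ : L2 (Ioo 0 l)) :
    ⟪tensor f ψ, tensor h χ⟫_ℂ = ⟪f, h⟫_ℂ * ⟪ψ, χ⟫_ℂ := by
  have e : ∫ p in guide m l, ⟪f p.1, h p.1⟫_ℂ * ⟪ψ p.2, χ p.2⟫_ℂ = ⟪f, h⟫_ℂ * ⟪ψ, χ⟫_ℂ := by
    rw [restrict_guide]
    exact integral_prod_mul (fun x => ⟪f x, h x⟫_ℂ) fun y => ⟪ψ y, χ y⟫_ℂ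
  rw [← e, L2.inner_def]
  refine integral_congr_ae ?_
  filter_upwards [coeFn_tensor f ψ, coeFn_tensor h χ] with p h1 h2
  rw [h1, h2]
  simp only [RCLike.inner_apply, map_mul]
  ring

theorem norm_tensor (f : L2Euc m) (ψ : L2 (Ioo 0 l)) : ‖tensor f ψ‖ = ‖f‖ * ‖ψ‖ := by
  have h := inner_tensor f f ψ ψ
  simp only [inner_self_eq_norm_sq_to_K] at h
  rw [← mul_pow] at h
  have h' : ‖tensor f ψ‖ ^ 2 = (‖f‖ * ‖ψ‖) ^ 2 := by exact_mod_cast h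
  exact (pow_left_inj₀ (norm_nonneg _) (by positivity) two_ne_zero).1 h'

/-- `f ↦ f ⊗ ψ` as a bounded operator. -/
def tensorLeft (m : ℕ) (ψ : L2 (Ioo 0 l)) : L2Euc m →L[ℂ] L2 (guide m l) :=
  LinearMap.mkContinuous
    { toFun := fun f => tensor f ψ
      map_add' := fun f f' => tensor_add_left f f' ψ
      map_smul' := fun c f => tensor_smul_left c f ψ } ‖ψ‖ fun f => by
    rw [mul_comm]
    exact (norm_tensor f ψ).le

@[simp] theorem tensorLeft_apply (ψ : L2 (Ioo 0 l)) (f : L2Euc m) :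
    tensorLeft m ψ f = tensor f ψ := rfl

/-- `ψ ↦ f ⊗ ψ` as a bounded operator. -/
def tensorRight (l : ℝ) (f : L2Euc m) : L2 (Ioo 0 l) →L[ℂ] L2 (guide m l) :=
  LinearMap.mkContinuous
    { toFun := fun ψ => tensor f ψ
      map_add' := tensor_add_right f
      map_smul' := fun c ψ => tensor_smul_right c f ψ } ‖f‖ fun ψ => (norm_tensor f ψ).le

@[simp] theorem tensorRight_apply (f : L2Euc m) (ψ : L2 (Ioo 0 l)) :
    tensorRight l f ψ = tensor f ψ := rfl

theorem adjoint_tensorLeft (ψ : L2 (Ioo 0 l)) (u : L2 (guide m l)) :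
    ContinuousLinearMap.adjoint (tensorLeft m ψ) u = component u ψ := by
  refine ext_inner_left ℂ fun f => ?_
  rw [ContinuousLinearMap.adjoint_inner_right, tensorLeft_apply, inner_tensor_left]

theorem component_add (u u' : L2 (guide m l)) (ψ : L2 (Ioo 0 l)) :
    component (u + u') ψ = component u ψ + component u' ψ := by
  simp only [← adjoint_tensorLeft, map_add]

theorem component_sub (u u' : L2 (guide m l)) (ψ : L2 (Ioo 0 l)) :
    component (u - u') ψ = component u ψ - component u' ψ := by
  simp only [← adjoint_tensorLeft, map_sub]

theorem component_neg (u : L2 (guide m l)) (ψ : L2 (Ioo 0 l)) :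
    component (-u) ψ = -component u ψ := by
  simp only [← adjoint_tensorLeft, map_neg]

theorem component_sum {ι : Type*} (s : Finset ι) (u : ι → L2 (guide m l)) (ψ : L2 (Ioo 0 l)) :
    component (∑ i ∈ s, u i) ψ = ∑ i ∈ s, component (u i) ψ := by
  simp only [← adjoint_tensorLeft, map_sum]

theorem component_smul (c : ℂ) (u : L2 (guide m l)) (ψ : L2 (Ioo 0 l)) :
    component (c • u) ψ = c • component u ψ := by
  simp only [← adjoint_tensorLeft, map_smul]

theorem component_smul_right (c : ℂ) (u : L2 (guide m l)) (ψ : L2 (Ioo 0 l)) :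
    component u (c • ψ) = (starRingEnd ℂ) c • component u ψ := by
  refine ext_inner_left ℂ fun f => ?_
  rw [← inner_tensor_left, tensor_smul_right, inner_smul_left, inner_smul_right, inner_tensor_left]

theorem component_tensor (f : L2Euc m) (χ ψ : L2 (Ioo 0 l)) :
    component (tensor f χ) ψ = ⟪ψ, χ⟫_ℂ • f := by
  refine ext_inner_left ℂ fun h => ?_
  rw [← inner_tensor_left, inner_tensor, inner_smul_right, mul_comm]

theorem HasSum.component {v : ℕ → L2 (guide m l)} {u : L2 (guide m l)} (h : HasSum v u)
    (ψ : L2 (Ioo 0 l)) : HasSum (fun n => component (v n) ψ) (component u ψ) := by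
  simp only [← adjoint_tensorLeft]
  exact (ContinuousLinearMap.adjoint (tensorLeft m ψ)).hasSum h

/-- On almost every slice the scalar inequality applies with coefficients f i x; integration in x
keeps the same constant. -/
theorem BesselBound.tensor {C : ℝ} {χ : ℕ → L2 (Ioo 0 l)} (h : BesselBound C (smulSeq χ)) (m : ℕ) :
    BesselBound C (fun n (f : L2Euc m) => tensor f (χ n)) := by
  intro s f
  have h1 : ∀ᵐ x : Euc m, (∫ y in Ioo 0 l, ‖(∑ i ∈ s, Waveguide.tensor (f i) (χ i)) (x, y)‖ ^ 2)
      ≤ C * ∑ i ∈ s, ‖f i x‖ ^ 2 := by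
    have h2 : ∀ᵐ p ∂(volume.restrict (guide m l)), ∀ i, Waveguide.tensor (f i) (χ i) p
        = f i p.1 * χ i p.2 := ae_all_iff.2 fun i => coeFn_tensor (f i) (χ i)
    filter_upwards [ae_ae_of_ae_guide h2, ae_ae_of_ae_guide (coeFn_sum_Lp s fun i =>
      Waveguide.tensor (f i) (χ i))] with x h3 h4
    refine le_trans (le_of_eq ?_) (h s fun i => f i x)
    rw [norm_sq_Lp]
    refine integral_congr_ae ?_
    have h5 : ∀ᵐ y ∂(volume.restrict (Ioo 0 l)), ∀ i, (f i x • χ i) y = f i x * χ i y :=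
      ae_all_iff.2 fun i => by
        filter_upwards [Lp.coeFn_smul (f i x) (χ i)] with y hy
        rw [hy, Pi.smul_apply, smul_eq_mul]
    filter_upwards [h3, h4, h5, coeFn_sum_Lp s fun i => f i x • χ i] with y e1 e2 e3 e4
    rw [e2, e4]
    simp only [e1, e3]
  have hi : Integrable fun x : Euc m => ∑ i ∈ s, ‖f i x‖ ^ 2 :=
    integrable_finsetSum s fun i _ => integrable_norm_sq_Lp (f i)
  rw [norm_sq_guide]
  refine (integral_mono_of_nonneg (Eventually.of_forall fun x => integral_nonneg fun y => by
    positivity) (hi.const_mul C) h1).trans (le_of_eq ?_)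
  rw [integral_const_mul, integral_finsetSum s fun i _ => integrable_norm_sq_Lp (f i)]
  simp only [norm_sq_Lp]

/-- The analysis operator of a Bessel sequence is bounded. -/
theorem BesselBound.sum_norm_component_sq_le {C : ℝ} (hC : 0 ≤ C) {ψ : ℕ → L2 (Ioo 0 l)}
    (h : BesselBound C (smulSeq ψ)) (u : L2 (guide m l)) (s : Finset ℕ) :
    ∑ i ∈ s, ‖component u (ψ i)‖ ^ 2 ≤ C * ‖u‖ ^ 2 := by
  set S := ∑ i ∈ s, ‖component u (ψ i)‖ ^ 2 with hS
  have h0 : 0 ≤ S := Finset.sum_nonneg fun _ _ => by positivity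
  -- Duality: S is the inner product of u with a synthesized sum whose squared norm is at most CS,
  -- so S² ≤ CS‖u‖².
  have h1 : ((S : ℝ) : ℂ)
      = ⟪∑ i ∈ s, Waveguide.tensor (component u (ψ i)) (ψ i), u⟫_ℂ := by
    rw [sum_inner, hS]
    push_cast
    refine Finset.sum_congr rfl fun i _ => ?_
    rw [inner_tensor_left, inner_self_eq_norm_sq_to_K]
    rfl
  have h2 : S ≤ ‖∑ i ∈ s, Waveguide.tensor (component u (ψ i)) (ψ i)‖ * ‖u‖ := by
    have := norm_inner_le_norm (𝕜 := ℂ) (∑ i ∈ s, Waveguide.tensor (component u (ψ i)) (ψ i)) u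
    rw [← h1, Complex.norm_real, Real.norm_of_nonneg h0] at this
    exact this
  have h3 := h.tensor m s fun i => component u (ψ i)
  have h4 : S ^ 2 ≤ C * S * ‖u‖ ^ 2 := by
    calc S ^ 2 ≤ (‖∑ i ∈ s, Waveguide.tensor (component u (ψ i)) (ψ i)‖ * ‖u‖) ^ 2 := by gcongr
      _ ≤ C * S * ‖u‖ ^ 2 := by
        rw [mul_pow]
        gcongr
  rcases h0.eq_or_lt with h5 | h5
  · rw [← h5]
    positivity
  · nlinarith

theorem BesselBound.summable_norm_component_sq {C : ℝ} (hC : 0 ≤ C) {ψ : ℕ → L2 (Ioo 0 l)}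
    (h : BesselBound C (smulSeq ψ)) (u : L2 (guide m l)) :
    Summable fun n => ‖component u (ψ n)‖ ^ 2 :=
  summable_of_sum_le (fun _ => by positivity) (h.sum_norm_component_sq_le hC u)

/-- There are countably many components, so for almost every x they all vanish at once; totality in
L²(0, l) then kills the slice. -/
theorem eq_zero_of_component_eq_zero {ψ : ℕ → L2 (Ioo 0 l)}
    (hψ : ∀ v, (∀ n, ⟪ψ n, v⟫_ℂ = 0) → v = 0) {u : L2 (guide m l)}
    (hu : ∀ n, component u (ψ n) = 0) : u = 0 := by
  have h1 : ∀ᵐ x : Euc m, ∀ n, componentFun u (ψ n) x = 0 := by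
    refine ae_all_iff.2 fun n => ?_
    filter_upwards [coeFn_component u (ψ n), Lp.coeFn_zero ℂ 2 (volume : Measure (Euc m))]
      with x e1 e2
    rw [← e1, hu n, e2, Pi.zero_apply]
  have h2 : ‖u‖ ^ 2 = 0 := by
    rw [norm_sq_guide]
    refine integral_eq_zero_of_ae ?_
    filter_upwards [h1, ae_slice u] with x e1 ⟨g, e2, e3⟩
    have hg : g = 0 := hψ g fun n => by rw [← e3, e1 n]
    refine integral_eq_zero_of_ae ?_
    filter_upwards [e2, Lp.coeFn_zero ℂ 2 (volume.restrict (Ioo 0 l))] with y e4 e5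
    rw [← e4, hg, e5]
    simp
  exact norm_eq_zero.1 (pow_eq_zero_iff two_ne_zero |>.1 h2)

theorem eq_of_component_dualBasis_eq {φ : ℕ → L2 (Ioo 0 l)} (hφ : IsRieszBasis φ)
    {u v : L2 (guide m l)}
    (h : ∀ n, component u (dualBasis φ n) = component v (dualBasis φ n)) : u = v := by
  refine sub_eq_zero.1 (eq_zero_of_component_eq_zero (ψ := dualBasis φ)
    (fun v hv => hφ.eq_zero_of_inner_dualBasis_eq_zero hv) fun n => ?_)
  rw [component_sub, h n, sub_self]

theorem component_dualBasis_of_hasSum {φ : ℕ → L2 (Ioo 0 l)} (hφ : IsRieszBasis φ)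
    {f : ℕ → L2Euc m} {u : L2 (guide m l)} (h : HasSum (fun n => tensor (f n) (φ n)) u) (k : ℕ) :
    component u (dualBasis φ k) = f k := by
  have h1 := HasSum.component h (dualBasis φ k)
  simp only [component_tensor, inner_dualBasis hφ] at h1
  have h2 := hasSum_single (f := fun n => (if k = n then (1 : ℂ) else 0) • f n) k fun n hn => by
    simp [Ne.symm hn]
  rw [h1.unique h2, if_pos rfl, one_smul]

/-- The expansion of a function of `L²(Ω)` along a Riesz basis of `L²(0, l)`. -/
theorem hasSum_tensor_component {φ : ℕ → L2 (Ioo 0 l)} (hφ : IsRieszBasis φ)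
    (u : L2 (guide m l)) : HasSum (fun n => tensor (component u (dualBasis φ n)) (φ n)) u := by
  obtain ⟨C, hC, h1, h2⟩ := hφ.exists_besselBound
  -- The Bessel bounds give convergence to some v; biorthogonality gives v the same components as u,
  -- and these determine it.
  obtain ⟨v, hv⟩ := (h1.tensor m).summable (h2.summable_norm_component_sq hC u)
  have : u = v := eq_of_component_dualBasis_eq hφ fun n =>
    (component_dualBasis_of_hasSum hφ hv n).symm
  rwa [← this] at hv

end Tensor

/-! ### Green's formula and differentiation under components -/

section GuideCalculus

variable {m : ℕ} {l : ℝ}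

/-- A real valued function as an element of the complex `L²` space. -/
def realL2 {α : Type*} [MeasurableSpace α] {μ : Measure α} {g : α → ℝ} (hg : MemLp g 2 μ) :
    Lp ℂ 2 μ := (hg.ofReal (K := ℂ)).toLp

theorem coeFn_realL2 {α : Type*} [MeasurableSpace α] {μ : Measure α} {g : α → ℝ}
    (hg : MemLp g 2 μ) : realL2 hg =ᵐ[μ] fun x => (g x : ℂ) := (hg.ofReal (K := ℂ)).coeFn_toLp

theorem inner_realL2 {α : Type*} [MeasurableSpace α] {μ : Measure α} {g : α → ℝ}
    (hg : MemLp g 2 μ) (u : Lp ℂ 2 μ) : ⟪realL2 hg, u⟫_ℂ = ∫ x, g x • u x ∂μ := by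
  rw [L2.inner_def]
  refine integral_congr_ae ?_
  filter_upwards [coeFn_realL2 hg] with x hx
  rw [hx]
  simp [mul_comm]

theorem hasSum_integral_smul {α : Type*} [MeasurableSpace α] {μ : Measure α} {g : α → ℝ}
    (hg : MemLp g 2 μ) {v : ℕ → Lp ℂ 2 μ} {u : Lp ℂ 2 μ} (h : HasSum v u) :
    HasSum (fun n => ∫ x, g x • v n x ∂μ) (∫ x, g x • u x ∂μ) := by
  simp only [← inner_realL2 hg]
  exact (innerSL ℂ (realL2 hg)).hasSum h

theorem memLp_restrict_of_hasCompactSupport {E : Type*} [NormedAddCommGroup E] [MeasureSpace E]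
    [BorelSpace E] [IsFiniteMeasureOnCompacts (volume : Measure E)]
    [SecondCountableTopology E] {g : E → ℝ}
    (hg : Continuous g) (hc : HasCompactSupport g) (Ω : Set E) :
    MemLp g 2 (volume.restrict Ω) := (hg.memLp_of_hasCompactSupport hc).restrict Ω

theorem continuous_fderiv_apply {E : Type*} [NormedAddCommGroup E] [NormedSpace ℝ E] {φ : E → ℝ}
    (h : ContDiff ℝ ∞ φ) (v : E) : Continuous fun x => fderiv ℝ φ x v :=
  (h.continuous_fderiv (by simp)).clm_apply continuous_const

/-- For a fixed test function both sides are continuous in L², so a series may be differentiated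
termwise as soon as the series of derivatives converges. -/
theorem HasWeakDeriv.of_hasSum {E : Type*} [NormedAddCommGroup E] [NormedSpace ℝ E]
    [MeasureSpace E] [BorelSpace E] [FiniteDimensional ℝ E]
    [IsLocallyFiniteMeasure (volume : Measure E)] [SecondCountableTopology E] {Ω : Set E} {v : E}
    {f g : ℕ → L2 Ω} {u w : L2 Ω} (h : ∀ n, HasWeakDeriv Ω v (f n) (g n)) (hf : HasSum f u)
    (hg : HasSum g w) : HasWeakDeriv Ω v u w := by
  intro φ h1 h2 h3
  have e1 := hasSum_integral_smul (memLp_restrict_of_hasCompactSupport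
    (continuous_fderiv_apply h1 v) (h2.fderiv_apply (𝕜 := ℝ) v) Ω) hf
  have e2 := hasSum_integral_smul (memLp_restrict_of_hasCompactSupport h1.continuous h2 Ω) hg
  refine e1.unique ?_
  simp only [fun n => h n φ h1 h2 h3]
  exact e2.neg

/-- Green's formula `∫_Ω (∂_y φ) u + ∫_Ω φ w = ∫ φ(x, l) g₁(x) dx - ∫ φ(x, 0) g₀(x) dx`. -/
def GreenY (m : ℕ) (l : ℝ) (u w : L2 (guide m l)) (g₀ g₁ : L2Euc m) : Prop :=
  ∀ φ : Euc m × ℝ → ℝ, ContDiff ℝ ∞ φ → HasCompactSupport φ →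
    (∫ p in guide m l, (fderiv ℝ φ p (dirY m)) • u p) + ∫ p in guide m l, φ p • w p
      = (∫ x, φ (x, l) • g₁ x) - ∫ x, φ (x, 0) • g₀ x

theorem GreenY.hasWeakDeriv {u w : L2 (guide m l)} {g₀ g₁ : L2Euc m} (h : GreenY m l u w g₀ g₁) :
    HasWeakDeriv (guide m l) (dirY m) u w := by
  intro φ h1 h2 h3
  have h4 : ∀ p, p ∉ guide m l → φ p = 0 := fun p hp =>
    image_eq_zero_of_notMem_tsupport fun hp' => hp (h3 hp')
  have h5 : ∀ x : Euc m, φ (x, l) = 0 := fun x => h4 _ (by simp [guide])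
  have h6 : ∀ x : Euc m, φ (x, 0) = 0 := fun x => h4 _ (by simp [guide])
  have := h φ h1 h2
  simp only [h5, h6, zero_smul, integral_zero, sub_zero] at this
  exact eq_neg_of_add_eq_zero_left this

theorem GreenY.hasTraces {u w : L2 (guide m l)} {g₀ g₁ : L2Euc m} (h : GreenY m l u w g₀ g₁) :
    HasTraces m l u g₀ g₁ := by
  intro φ h1 h2
  rw [h.hasWeakDeriv.weakDeriv_eq (isOpen_guide m l)]
  exact h φ h1 h2

theorem HasTraces.greenY {u : L2 (guide m l)} {g₀ g₁ : L2Euc m} (h : HasTraces m l u g₀ g₁) :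
    GreenY m l u (weakDeriv (guide m l) (dirY m) u) g₀ g₁ := h

theorem hasCompactSupport_slice {φ : Euc m × ℝ → ℝ} (hc : HasCompactSupport φ) (y : ℝ) :
    HasCompactSupport fun x : Euc m => φ (x, y) := by
  refine HasCompactSupport.intro (hc.isCompact.image continuous_fst) fun x hx => ?_
  by_contra h
  exact hx ⟨(x, y), subset_tsupport _ h, rfl⟩

theorem contDiff_slice {φ : Euc m × ℝ → ℝ} (h : ContDiff ℝ ∞ φ) (y : ℝ) :
    ContDiff ℝ ∞ fun x : Euc m => φ (x, y) :=
  h.comp (contDiff_id.prodMk contDiff_const)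

theorem memLp_slice {φ : Euc m × ℝ → ℝ} (h : ContDiff ℝ ∞ φ) (hc : HasCompactSupport φ) (y : ℝ) :
    MemLp (fun x : Euc m => φ (x, y)) 2 (volume : Measure (Euc m)) :=
  (contDiff_slice h y).continuous.memLp_of_hasCompactSupport (hasCompactSupport_slice hc y)

theorem GreenY.of_hasSum {f g : ℕ → L2 (guide m l)} {u w : L2 (guide m l)} {b₀ b₁ : ℕ → L2Euc m}
    {g₀ g₁ : L2Euc m} (h : ∀ n, GreenY m l (f n) (g n) (b₀ n) (b₁ n)) (hf : HasSum f u)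
    (hg : HasSum g w) (h0 : HasSum b₀ g₀) (h1 : HasSum b₁ g₁) : GreenY m l u w g₀ g₁ := by
  intro φ hφ hc
  have e1 := hasSum_integral_smul (memLp_restrict_of_hasCompactSupport
    (continuous_fderiv_apply hφ (dirY m)) (hc.fderiv_apply (𝕜 := ℝ) (dirY m)) (guide m l)) hf
  have e2 := hasSum_integral_smul
    (memLp_restrict_of_hasCompactSupport hφ.continuous hc (guide m l)) hg
  have e3 := hasSum_integral_smul (memLp_slice hφ hc l) h1
  have e4 := hasSum_integral_smul (memLp_slice hφ hc 0) h0
  have e5 := e1.add e2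
  simp only [fun n => h n φ hφ hc] at e5
  exact e5.unique (e3.sub e4)

theorem fderiv_slice_left {φ : Euc m × ℝ → ℝ} (h : ContDiff ℝ ∞ φ) (x v : Euc m) (y : ℝ) :
    fderiv ℝ (fun x : Euc m => φ (x, y)) x v = fderiv ℝ φ (x, y) (v, 0) := by
  have h1 := ((h.differentiable (by simp)).differentiableAt (x := (x, y))).hasFDerivAt.comp
    (f := fun x : Euc m => (x, y)) x (hasFDerivAt_prodMk_left x y)
  have h2 : fderiv ℝ (fun x : Euc m => φ (x, y)) x = _ := h1.fderiv
  rw [h2]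
  simp

theorem hasDerivAt_slice_right {φ : Euc m × ℝ → ℝ} (h : ContDiff ℝ ∞ φ) (x : Euc m) (y : ℝ) :
    HasDerivAt (fun y : ℝ => φ (x, y)) (fderiv ℝ φ (x, y) (dirY m)) y := by
  have h1 := ((h.differentiable (by simp)).differentiableAt (x := (x, y))).hasFDerivAt.comp y
    (hasFDerivAt_prodMk_right x y)
  refine h1.hasDerivAt.congr_deriv ?_
  simp [dirY]

theorem integral_smul_tensor_congr (g : Euc m × ℝ → ℝ) (f : L2Euc m) (χ : L2 (Ioo 0 l)) :
    (fun p => g p • tensor f χ p)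
      =ᵐ[volume.restrict (guide m l)] fun p => g p • (f p.1 * χ p.2) := by
  filter_upwards [coeFn_tensor f χ] with p hp
  rw [hp]

theorem integral_guide_symm {F : Euc m × ℝ → ℂ} (hF : Integrable F (volume.restrict (guide m l))) :
    ∫ p in guide m l, F p = ∫ y in Ioo 0 l, ∫ x : Euc m, F (x, y) := by
  rw [restrict_guide] at hF ⊢
  exact integral_prod_symm F hF

/-- Integrate in x first: each slice φ(·, y) is an admissible test function on the whole of ℝᵐ. -/
theorem EucDeriv.tensor {v : Euc m} {f g : L2Euc m} (h : EucDeriv v f g) (χ : L2 (Ioo 0 l)) :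
    HasWeakDeriv (guide m l) (v, 0) (tensor f χ) (tensor g χ) := by
  intro φ h1 h2 _
  have i1 := (integrable_fderiv_smul_L2 h1 h2 (v, 0) (Waveguide.tensor f χ)).congr
    (integral_smul_tensor_congr _ f χ)
  have i2 := (integrable_smul_L2 h1.continuous h2 (Waveguide.tensor g χ)).congr
    (integral_smul_tensor_congr _ g χ)
  rw [integral_congr_ae (integral_smul_tensor_congr _ f χ),
    integral_congr_ae (integral_smul_tensor_congr _ g χ), integral_guide_symm i1,
    integral_guide_symm i2, ← integral_neg]
  refine integral_congr_ae (Eventually.of_forall fun y => ?_)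
  have h3 := h _ (contDiff_slice h1 y) (hasCompactSupport_slice h2 y)
  simp only [fderiv_slice_left h1] at h3
  simp only [Complex.real_smul, ← mul_assoc] at h3 ⊢
  rw [integral_mul_const, integral_mul_const, h3, neg_mul]

/-- Integrate in y first: the fundamental theorem of calculus for y ↦ φ(x, y)χ(y) produces the end
values of χ. -/
theorem greenY_tensor (hl : 0 < l) {χ χ' : ℝ → ℂ} (hχ : Continuous χ) (hχ' : Continuous χ')
    (hd : ∀ y, HasDerivAt χ (χ' y) y) (f : L2Euc m) :
    GreenY m l (tensor f (ofCont l hχ)) (tensor f (ofCont l hχ')) (χ 0 • f) (χ l • f) := by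
  intro φ h1 h2
  have c1 := integral_smul_tensor_congr (fun p => fderiv ℝ φ p (dirY m)) f (ofCont l hχ)
  have c2 := integral_smul_tensor_congr φ f (ofCont l hχ')
  have i1 := integrable_fderiv_smul_L2 h1 h2 (dirY m) (Waveguide.tensor f (ofCont l hχ))
  have i2 := integrable_smul_L2 h1.continuous h2 (Waveguide.tensor f (ofCont l hχ'))
  have i3 : Integrable fun x : Euc m => χ l • φ (x, l) • f x :=
    (integrable_slice_smul h1.continuous h2 l f).smul (χ l)
  have i4 : Integrable fun x : Euc m => χ 0 • φ (x, 0) • f x :=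
    (integrable_slice_smul h1.continuous h2 0 f).smul (χ 0)
  have c3 : (fun p => (fderiv ℝ φ p (dirY m)) • Waveguide.tensor f (ofCont l hχ) p
      + φ p • Waveguide.tensor f (ofCont l hχ') p) =ᵐ[volume.restrict (guide m l)]
      fun p => (fderiv ℝ φ p (dirY m)) • (f p.1 * ofCont l hχ p.2)
        + φ p • (f p.1 * ofCont l hχ' p.2) := c1.add c2
  rw [← integral_add i1 i2, integral_congr_ae c3, integral_guide ((i1.add i2).congr
    c3), integral_smul_Lp_smul, integral_smul_Lp_smul, ← integral_smul, ← integral_smul,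
    ← integral_sub i3 i4]
  refine integral_congr_ae (Eventually.of_forall fun x => ?_)
  have e1 : ∀ y : ℝ, HasDerivAt (fun y : ℝ => (φ (x, y) : ℂ) * χ y)
      ((fderiv ℝ φ (x, y) (dirY m) : ℝ) * χ y + (φ (x, y) : ℂ) * χ' y) y := fun y =>
    (hasDerivAt_slice_right h1 x y).ofReal_comp.mul (hd y)
  have cφ : Continuous fun y : ℝ => (φ (x, y) : ℂ) := by
    have := h1.continuous
    fun_prop
  have cφ' : Continuous fun y : ℝ => ((fderiv ℝ φ (x, y) (dirY m) : ℝ) : ℂ) := by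
    have := continuous_fderiv_apply h1 (dirY m)
    fun_prop
  have e2 := intervalIntegral.integral_eq_sub_of_hasDerivAt (a := 0) (b := l) (fun y _ => e1 y)
    (((cφ'.mul hχ).add (cφ.mul hχ')).intervalIntegrable 0 l)
  rw [← setIntegral_Ioo_eq hl.le] at e2
  have e3 : ∫ y in Ioo 0 l, ((fderiv ℝ φ (x, y) (dirY m)) • (f x * ofCont l hχ y)
      + φ (x, y) • (f x * ofCont l hχ' y))
      = f x * ((φ (x, l) : ℂ) * χ l - (φ (x, 0) : ℂ) * χ 0) := by
    rw [← e2, ← integral_const_mul]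
    refine integral_congr_ae ?_
    filter_upwards [coeFn_ofCont l hχ, coeFn_ofCont l hχ'] with y a1 a2
    rw [a1, a2, Complex.real_smul, Complex.real_smul]
    ring
  refine e3.trans ?_
  simp only [Complex.real_smul, smul_eq_mul]
  ring

/-! ### Components of weak derivatives -/

theorem inner_tensor_realL2 {g : Euc m → ℝ} (hg : MemLp g 2 (volume : Measure (Euc m)))
    {h : ℝ → ℝ} (hh : MemLp h 2 (volume.restrict (Ioo 0 l))) (u : L2 (guide m l)) :
    ⟪tensor (realL2 hg) (realL2 hh), u⟫_ℂ = ∫ p in guide m l, (g p.1 * h p.2) • u p := by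
  rw [L2.inner_def]
  refine integral_congr_ae ?_
  have h1 := (Measure.quasiMeasurePreserving_fst (μ := (volume : Measure (Euc m)))
    (ν := volume.restrict (Ioo 0 l))).ae (coeFn_realL2 hg)
  have h2 := (Measure.quasiMeasurePreserving_snd (μ := (volume : Measure (Euc m)))
    (ν := volume.restrict (Ioo 0 l))).ae (coeFn_realL2 hh)
  rw [← restrict_guide] at h1 h2
  filter_upwards [coeFn_tensor (realL2 hg) (realL2 hh), h1, h2] with p e1 e2 e3
  rw [e1, e2, e3]
  simp [mul_comm]

theorem memLp_euc {ψ : Euc m → ℝ} (h : Continuous ψ) (hc : HasCompactSupport ψ) :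
    MemLp ψ 2 (volume : Measure (Euc m)) := h.memLp_of_hasCompactSupport hc

theorem hasCompactSupport_mul_prod {ψ : Euc m → ℝ} {η : ℝ → ℝ} (h1 : HasCompactSupport ψ)
    (h2 : HasCompactSupport η) : HasCompactSupport fun p : Euc m × ℝ => ψ p.1 * η p.2 := by
  refine HasCompactSupport.intro (h1.isCompact.prod h2.isCompact) fun p hp => ?_
  by_contra h
  exact hp ⟨subset_tsupport _ (left_ne_zero_of_mul h), subset_tsupport _ (right_ne_zero_of_mul h)⟩

theorem fderiv_mul_prod {ψ : Euc m → ℝ} {η : ℝ → ℝ} {p : Euc m × ℝ}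
    (h1 : DifferentiableAt ℝ ψ p.1) (h2 : DifferentiableAt ℝ η p.2) (v : Euc m) (t : ℝ) :
    fderiv ℝ (fun p : Euc m × ℝ => ψ p.1 * η p.2) p (v, t)
      = fderiv ℝ ψ p.1 v * η p.2 + ψ p.1 * (t * deriv η p.2) := by
  have e1 : HasFDerivAt (fun p : Euc m × ℝ => ψ p.1 * η p.2) _ p :=
    (h1.hasFDerivAt.comp p hasFDerivAt_fst).mul (h2.hasFDerivAt.comp p hasFDerivAt_snd)
  rw [e1.fderiv]
  simp
  ring

/-- Taking components commutes with weak derivatives in the unbounded directions. -/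
theorem HasWeakDeriv.component {v : Euc m} {u w : L2 (guide m l)}
    (h : HasWeakDeriv (guide m l) (v, 0) u w) (χ : L2 (Ioo 0 l)) :
    EucDeriv v (component u χ) (component w χ) := by
  intro ψ h1 h2
  have m1 := memLp_euc (continuous_fderiv_apply h1 v) (h2.fderiv_apply (𝕜 := ℝ) v)
  have m2 := memLp_euc h1.continuous h2
  rw [← inner_realL2 m1, ← inner_realL2 m2, ← inner_tensor_left, ← inner_tensor_left]
  -- The hypothesis only allows tests with compact support in ]0, l[, whereas χ is an arbitrary L²
  -- vector. The defect of the identity, antilinear and continuous in χ, is represented by V; it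
  -- vanishes against such tests, hence V = 0.
  set V := ContinuousLinearMap.adjoint (tensorRight l (realL2 m1)) u
    + ContinuousLinearMap.adjoint (tensorRight l (realL2 m2)) w with hV
  have key : ∀ χ, ⟪χ, V⟫_ℂ = ⟪tensor (realL2 m1) χ, u⟫_ℂ + ⟪tensor (realL2 m2) χ, w⟫_ℂ := by
    intro χ
    rw [hV, inner_add_right, ContinuousLinearMap.adjoint_inner_right,
      ContinuousLinearMap.adjoint_inner_right, tensorRight_apply, tensorRight_apply]
  have hV0 : V = 0 := by
    refine L2_eq_of_forall_integral_eq isOpen_Ioo fun η e1 e2 e3 => ?_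
    have m3 := memLp_restrict_of_hasCompactSupport e1.continuous e2 (Ioo 0 l)
    rw [← inner_realL2 m3, ← inner_realL2 m3, inner_zero_right, key, inner_tensor_realL2,
      inner_tensor_realL2]
    have d1 : ContDiff ℝ ∞ fun p : Euc m × ℝ => ψ p.1 * η p.2 :=
      (h1.comp contDiff_fst).mul (e1.comp contDiff_snd)
    have := h _ d1 (hasCompactSupport_mul_prod h2 e2) ?_
    · have e4 : ∀ p : Euc m × ℝ, fderiv ℝ (fun p : Euc m × ℝ => ψ p.1 * η p.2) p (v, 0)
          = fderiv ℝ ψ p.1 v * η p.2 := fun p => by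
        rw [fderiv_mul_prod (h1.differentiable (by simp)).differentiableAt
          (e1.differentiable (by simp)).differentiableAt]
        ring
      simp only [e4] at this
      rw [this, neg_add_cancel]
    · intro p hp
      refine ⟨mem_univ _, e3 ?_⟩
      have h5 : tsupport (fun p : Euc m × ℝ => ψ p.1 * η p.2) ⊆ Prod.snd ⁻¹' tsupport η :=
        closure_minimal (fun p hp => subset_tsupport _ (right_ne_zero_of_mul hp))
          ((isClosed_tsupport η).preimage continuous_snd)
      exact h5 hp
  have := key χ
  rw [hV0, inner_zero_right] at this
  exact eq_neg_of_add_eq_zero_left this.symm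

theorem L2Euc_eq_of_forall_inner_eq {f g : L2Euc m} (h : ∀ (ψ : Euc m → ℝ) (h1 : ContDiff ℝ ∞ ψ)
    (h2 : HasCompactSupport ψ), ⟪realL2 (memLp_euc h1.continuous h2), f⟫_ℂ
      = ⟪realL2 (memLp_euc h1.continuous h2), g⟫_ℂ) : f = g := by
  refine Lp.ext (ae_eq_of_integral_contDiff_smul_eq ((Lp.memLp f).locallyIntegrable (by norm_num))
    ((Lp.memLp g).locallyIntegrable (by norm_num)) fun ψ h1 h2 => ?_)
  have := h ψ h1 h2
  rwa [inner_realL2, inner_realL2] at this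

theorem realL2_eq_ofCont {η : ℝ → ℝ} (h : MemLp η 2 (volume.restrict (Ioo 0 l)))
    (hc : Continuous fun y => (η y : ℂ)) : realL2 h = ofCont l hc :=
  eq_ofCont hc (coeFn_realL2 h)

/-- Green's formula is stated for compactly supported tests, while modes are not compactly supported
on the line. The cutoff equals 1 on a neighbourhood of [0, l], so first derivatives also agree up to
the end points. -/
theorem exists_compactSupport_eqOn (hl : 0 < l) {η : ℝ → ℝ} (hη : ContDiff ℝ ∞ η) :
    ∃ θ : ℝ → ℝ, ContDiff ℝ ∞ θ ∧ HasCompactSupport θ ∧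
      ∀ y ∈ Icc 0 l, θ y = η y ∧ deriv θ y = deriv η y := by
  let B : ContDiffBump (l / 2) := ⟨l, 2 * l, hl, by linarith⟩
  refine ⟨fun y => B y * η y, B.contDiff.mul hη, B.hasCompactSupport.mul_right, fun y hy => ?_⟩
  have hy' : y ∈ Metric.ball (l / 2) l := by
    rw [Metric.mem_ball, Real.dist_eq, abs_lt]
    constructor <;> linarith [hy.1, hy.2]
  have h : (fun y => B y * η y) =ᶠ[𝓝 y] η := by
    filter_upwards [Metric.isOpen_ball.mem_nhds hy'] with t ht
    rw [B.one_of_mem_closedBall (Metric.ball_subset_closedBall ht), one_mul]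
  exact ⟨h.self_of_nhds, h.deriv_eq⟩

theorem GreenY.test_mul (hl : 0 < l) {u w : L2 (guide m l)} {g₀ g₁ : L2Euc m}
    (h : GreenY m l u w g₀ g₁) {ψ : Euc m → ℝ} (h1 : ContDiff ℝ ∞ ψ) (h2 : HasCompactSupport ψ)
    {η : ℝ → ℝ} (hη : ContDiff ℝ ∞ η) :
    (∫ p in guide m l, (ψ p.1 * deriv η p.2) • u p) + ∫ p in guide m l, (ψ p.1 * η p.2) • w p
      = (∫ x, (ψ x * η l) • g₁ x) - ∫ x, (ψ x * η 0) • g₀ x := by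
  obtain ⟨θ, d0, d0c, hθ⟩ := exists_compactSupport_eqOn hl hη
  have d1 : ContDiff ℝ ∞ fun p : Euc m × ℝ => ψ p.1 * θ p.2 :=
    (h1.comp contDiff_fst).mul (d0.comp contDiff_snd)
  have h3 := h _ d1 (hasCompactSupport_mul_prod h2 d0c)
  have a1 : ∫ p in guide m l, (fderiv ℝ (fun p : Euc m × ℝ => ψ p.1 * θ p.2) p
      (dirY m)) • u p = ∫ p in guide m l, (ψ p.1 * deriv η p.2) • u p := by
    refine setIntegral_congr_fun (isOpen_guide m l).measurableSet fun p hp => ?_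
    have e2 := fderiv_mul_prod (p := p) (h1.differentiable (by simp)).differentiableAt
      (d0.differentiable (by simp)).differentiableAt 0 1
    simp only [dirY]
    rw [e2, (hθ p.2 (Ioo_subset_Icc_self hp.2)).2, map_zero, zero_mul, zero_add, one_mul]
  have a2 : ∫ p in guide m l, (ψ p.1 * θ p.2) • w p
      = ∫ p in guide m l, (ψ p.1 * η p.2) • w p := by
    refine setIntegral_congr_fun (isOpen_guide m l).measurableSet fun p hp => ?_
    simp only [(hθ p.2 (Ioo_subset_Icc_self hp.2)).1]
  rw [a1, a2] at h3
  rw [h3]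
  simp only [(hθ 0 (left_mem_Icc.2 hl.le)).1, (hθ l (right_mem_Icc.2 hl.le)).1]

theorem integral_mul_const_smul (ψ : Euc m → ℝ) (c : ℝ) (g : L2Euc m) :
    ∫ x, (ψ x * c) • g x = (c : ℂ) * ∫ x, ψ x • g x := by
  rw [← integral_const_mul]
  refine integral_congr_ae (Eventually.of_forall fun x => ?_)
  simp only [Complex.real_smul]
  push_cast
  ring

theorem GreenY.component_real (hl : 0 < l) {u w : L2 (guide m l)} {g₀ g₁ : L2Euc m}
    (h : GreenY m l u w g₀ g₁) {η : ℝ → ℝ} (hη : ContDiff ℝ ∞ η)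
    (c1 : Continuous fun y => ((deriv η y : ℝ) : ℂ)) (c2 : Continuous fun y => (η y : ℂ)) :
    component u (ofCont l c1) + component w (ofCont l c2)
      = (η l : ℂ) • g₁ - (η 0 : ℂ) • g₀ := by
  have k1 : MemLp (deriv η) 2 (volume.restrict (Ioo 0 l)) := (memLp_cont l c1).re
  have k2 : MemLp η 2 (volume.restrict (Ioo 0 l)) := (memLp_cont l c2).re
  rw [← realL2_eq_ofCont k1, ← realL2_eq_ofCont k2]
  refine L2Euc_eq_of_forall_inner_eq fun ψ h1 h2 => ?_
  rw [inner_add_right, ← inner_tensor_left, ← inner_tensor_left, inner_tensor_realL2,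
    inner_tensor_realL2, inner_sub_right, inner_smul_right, inner_smul_right, inner_realL2,
    inner_realL2, h.test_mul hl h1 h2 hη, integral_mul_const_smul, integral_mul_const_smul]

theorem component_add_right (u : L2 (guide m l)) (ψ ψ' : L2 (Ioo 0 l)) :
    component u (ψ + ψ') = component u ψ + component u ψ' := by
  refine ext_inner_left ℂ fun f => ?_
  rw [← inner_tensor_left, tensor_add_right, inner_add_left, inner_add_right, inner_tensor_left,
    inner_tensor_left]

/-- Integration by parts in the bounded direction, for the components. -/
theorem GreenY.component (hl : 0 < l) {u w : L2 (guide m l)} {g₀ g₁ : L2Euc m}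
    (h : GreenY m l u w g₀ g₁) {η η' : ℝ → ℂ} (hη : ContDiff ℝ ∞ η)
    (hd : ∀ y, HasDerivAt η (η' y) y) (c1 : Continuous fun y => (starRingEnd ℂ) (η' y))
    (c2 : Continuous fun y => (starRingEnd ℂ) (η y)) :
    component u (ofCont l c1) + component w (ofCont l c2) = η l • g₁ - η 0 • g₀ := by
  have hr : ContDiff ℝ ∞ fun y => (η y).re := Complex.reCLM.contDiff.comp hη
  have hi : ContDiff ℝ ∞ fun y => (η y).im := Complex.imCLM.contDiff.comp hη
  have dr : ∀ y, deriv (fun y => (η y).re) y = (η' y).re := fun y =>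
    (Complex.reCLM.hasFDerivAt.comp_hasDerivAt y (hd y)).deriv
  have di : ∀ y, deriv (fun y => (η y).im) y = (η' y).im := fun y =>
    (Complex.imCLM.hasFDerivAt.comp_hasDerivAt y (hd y)).deriv
  have cr : Continuous fun y => ((deriv (fun y => (η y).re) y : ℝ) : ℂ) :=
    Complex.continuous_ofReal.comp (hr.continuous_deriv (by simp))
  have ci : Continuous fun y => ((deriv (fun y => (η y).im) y : ℝ) : ℂ) :=
    Complex.continuous_ofReal.comp (hi.continuous_deriv (by simp))
  have cr2 : Continuous fun y => ((η y).re : ℂ) := Complex.continuous_ofReal.comp hr.continuous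
  have ci2 : Continuous fun y => ((η y).im : ℂ) := Complex.continuous_ofReal.comp hi.continuous
  -- Green's formula is available for real tests only, so conj η is split as Re η - i Im η.
  -- Components are conjugate-linear in the test vector, which restores η itself at the end points.
  have e1 : ofCont l c1 = ofCont l cr + (-Complex.I) • ofCont l ci := by
    rw [smul_ofCont, add_ofCont]
    refine eq_ofCont _ ((coeFn_ofCont l c1).trans (Eventually.of_forall fun y => ?_))
    apply Complex.ext <;> simp [dr, di]
  have e2 : ofCont l c2 = ofCont l cr2 + (-Complex.I) • ofCont l ci2 := by
    rw [smul_ofCont, add_ofCont]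
    refine eq_ofCont _ ((coeFn_ofCont l c2).trans (Eventually.of_forall fun y => ?_))
    apply Complex.ext <;> simp
  have k1 := h.component_real hl hr cr cr2
  have k2 := h.component_real hl hi ci ci2
  rw [e1, e2, component_add_right, component_add_right, component_smul_right,
    component_smul_right, ← Complex.re_add_im (η l), ← Complex.re_add_im (η 0)]
  rw [show ∀ A B C D : L2Euc m, A + (starRingEnd ℂ) (-Complex.I) • B
    + (C + (starRingEnd ℂ) (-Complex.I) • D) = A + C + Complex.I • (B + D) from fun A B C D => by
      simp only [map_neg, Complex.conj_I, neg_neg, smul_add]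
      abel, k1, k2, smul_sub, add_smul, add_smul, smul_smul, smul_smul, mul_comm Complex.I,
      mul_comm Complex.I]
  abel

end GuideCalculus

/-! ### The action of H_a on components -/

section DomainComponents

open scoped FourierTransform

variable {m : ℕ} {l a : ℝ}

theorem FourierEq.sum {ι : Type*} (s : Finset ι) {h : ι → Euc m → ℂ} {u : L2Euc m}
    {w : ι → L2Euc m} (hw : ∀ i ∈ s, FourierEq (h i) u (w i)) :
    FourierEq (fun ξ => ∑ i ∈ s, h i ξ) u (∑ i ∈ s, w i) := by
  classical
  induction s using Finset.induction_on with
  | empty =>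
    simp only [Finset.sum_empty]
    have := (fourierEq_one u).smul 0
    rw [zero_smul] at this
    exact this.congr fun ξ => by ring
  | insert i s hi ih =>
    rw [Finset.sum_insert hi]
    refine ((hw i (Finset.mem_insert_self i s)).add (ih fun j hj =>
      hw j (Finset.mem_insert_of_mem hj))).congr fun ξ => ?_
    rw [Finset.sum_insert hi]

theorem sum_derSymbol_sq (ξ : Euc m) :
    ∑ j : Fin m, derSymbol (EuclideanSpace.single j 1) ξ * derSymbol (EuclideanSpace.single j 1) ξ
      = -(lapSymbol ξ : ℂ) := by
  have h : ∀ j : Fin m, derSymbol (EuclideanSpace.single j 1) ξ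
      * derSymbol (EuclideanSpace.single j 1) ξ = -((2 * Real.pi) ^ 2 * ξ j ^ 2 : ℝ) := by
    intro j
    have e : (inner ℝ ξ (EuclideanSpace.single j (1 : ℝ)) : ℝ) = ξ j := by
      rw [EuclideanSpace.inner_single_right]
      simp
    rw [derSymbol, e]
    push_cast
    linear_combination (2 * (Real.pi : ℂ)) ^ 2 * (ξ j : ℂ) ^ 2 * Complex.I_sq
  simp only [h]
  rw [lapSymbol, EuclideanSpace.norm_sq_eq, Finset.mul_sum]
  push_cast
  rw [Finset.sum_neg_distrib]
  congr 1
  refine Finset.sum_congr rfl fun j _ => ?_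
  rw [Real.norm_eq_abs, ← Complex.ofReal_pow |ξ j|, sq_abs]
  push_cast
  rfl

/-- Taking components commutes with the x-derivatives, each of which multiplies the Fourier
transform by 2πiξ_j; the squares of these symbols add up to -4π²|ξ|². This also places the
components in the domain of the free Laplacian. -/
theorem fourierEq_component_weakDeriv {u : L2 (guide m l)} (hu : u ∈ H2 (guide m l))
    (χ : L2 (Ioo 0 l)) :
    FourierEq (fun ξ => -(lapSymbol ξ : ℂ)) (component u χ)
      (component (∑ j : Fin m, weakDeriv (guide m l) (dirX m j)
        (weakDeriv (guide m l) (dirX m j) u)) χ) := by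
  rw [component_sum]
  refine (FourierEq.sum Finset.univ fun j _ => ?_).congr fun ξ => (sum_derSymbol_sq ξ).symm
  have h1 : EucDeriv _ _ _ :=
    (hasWeakDeriv_weakDeriv (H2_le_H1 _ hu) (dirX m j)).component χ
  have h2 : EucDeriv _ _ _ :=
    (hasWeakDeriv_weakDeriv (weakDeriv_mem_H1 (isOpen_guide m l) hu (dirX m j))
      (dirX m j)).component χ
  exact (eucDeriv_iff.1 h1).mul (eucDeriv_iff.1 h2)

theorem contDiff_modeFun (a : ℝ) (lam : ℂ) : ContDiff ℝ ∞ (modeFun a lam) := by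
  have h : ContDiff ℝ ∞ fun y : ℝ => (y : ℂ) := Complex.ofRealCLM.contDiff
  unfold modeFun
  fun_prop

theorem contDiff_modeDer (a : ℝ) (lam : ℂ) : ContDiff ℝ ∞ (modeDer a lam) := by
  have h : ContDiff ℝ ∞ fun y : ℝ => (y : ℂ) := Complex.ofRealCLM.contDiff
  unfold modeDer
  fun_prop

/-- The boundary conditions cancel the boundary terms against the modes. -/
theorem component_conjVec_of_greenY (hl : 0 < l) {lam : ℂ} (hr : IsCharRoot l a lam)
    (h1 : lam - a ≠ 0) {u w w' : L2 (guide m l)} {g₀ g₁ : L2Euc m}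
    (hu : GreenY m l u w g₀ g₁)
    (hw : GreenY m l w w' (-((Complex.I * a) • g₀)) ((Complex.I * a) • g₁)) :
    component w' (conjVec l a lam) = -(lam ^ 2 • component u (conjVec l a lam)) := by
  have c1 : Continuous fun y => (starRingEnd ℂ) (Complex.I * lam * modeDer a lam y) :=
    Complex.continuous_conj.comp (continuous_const.mul (continuous_modeDer a lam))
  have c2 : Continuous fun y => (starRingEnd ℂ) (modeFun a lam y) :=
    Complex.continuous_conj.comp (continuous_modeFun a lam)
  have c3 : Continuous fun y => (starRingEnd ℂ) (-lam ^ 2 * modeFun a lam y) :=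
    Complex.continuous_conj.comp (continuous_const.mul (continuous_modeFun a lam))
  -- Two integrations by parts move ∂_y² onto the mode. In `k1` and `k2` the boundary terms
  -- coincide, since u and the mode satisfy the same conditions, so subtraction cancels them
  -- together with the common term in w.
  have k1 := hw.component hl (contDiff_modeFun a lam) (hasDerivAt_modeFun a lam) c1 c2
  have k2 := hu.component hl (contDiff_const.mul (contDiff_modeDer a lam))
    (η := fun y => Complex.I * lam * modeDer a lam y) (η' := fun y => -lam ^ 2 * modeFun a lam y)
    (fun y => ((hasDerivAt_modeDer a lam y).const_mul (Complex.I * lam)).congr_deriv (by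
      linear_combination lam ^ 2 * modeFun a lam y * Complex.I_sq)) c3 c1
  have e3 : ofCont l c3 = (starRingEnd ℂ) (-lam ^ 2) • conjVec l a lam := by
    rw [conjVec, smul_ofCont]
    refine eq_ofCont _ ((coeFn_ofCont l c3).trans (Eventually.of_forall fun y => ?_))
    simp
  change _ + component w' (conjVec l a lam) = _ at k1
  rw [e3, component_smul_right, Complex.conj_conj] at k2
  simp only [modeFun_bc_zero h1, hr.bc_right h1] at k2
  have k3 : component w' (conjVec l a lam) - (-lam ^ 2) • component u (conjVec l a lam) = 0 := by
    rw [← sub_eq_zero] at k1 k2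
    have := congrArg₂ (fun x y : L2Euc m => x - y) k1 k2
    simp only [sub_zero] at this
    rw [← this]
    module
  rw [sub_eq_zero.1 k3, neg_smul]

theorem mem_domain_modeComponent (u : (guideOp m l a).domain) (n : ℕ) :
    modeComponent m l a (u : L2 (guide m l)) n ∈ (negLaplacian m).domain :=
  mem_domain_negLaplacian (fourierEq_component_weakDeriv u.2.1 _)

/-- The components diagonalize `H_a`. -/
theorem modeComponent_guideOp (hl : 0 < l) (ha : 0 < a) (u : (guideOp m l a).domain) (n : ℕ) :
    modeComponent m l a (guideOp m l a u) n
      = negLaplacian m ⟨modeComponent m l a (u : L2 (guide m l)) n, mem_domain_modeComponent u n⟩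
        + transverseRoot l a n ^ 2 • modeComponent m l a (u : L2 (guide m l)) n := by
  have hx := negLaplacian_eq (mem_domain_modeComponent u n)
    (fourierEq_component_weakDeriv u.2.1 (dualBasis (transverseMode l a) n))
  have hu1 := u.2.1
  obtain ⟨g₀, g₁, t1, t2⟩ := u.2.2
  -- The dual vector is a multiple of the conjugated mode, the only kind of test vector for which
  -- the boundary terms were seen to cancel.
  obtain ⟨κ, hκ⟩ := exists_dualBasis_eq hl ha n
  have hr := isCharRoot_transverseRoot hl ha n
  have hy := component_conjVec_of_greenY hl hr (hr.sub_ne_zero ha) t1.greenY t2.greenY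
  have hop : guideOp m l a u = -((∑ j : Fin m, weakDeriv (guide m l) (dirX m j)
            (weakDeriv (guide m l) (dirX m j) (u : L2 (guide m l))))
          + weakDeriv (guide m l) (dirY m) (weakDeriv (guide m l) (dirY m) (u : L2 (guide m l)))) :=
    rfl
  rw [hx, hop]
  unfold modeComponent
  rw [component_neg, component_add, neg_add]
  congr 1
  rw [hκ, component_smul_right, component_smul_right, hy, smul_neg, neg_neg, smul_comm]

end DomainComponents

/-! ### Multiplier series along the modes and membership in the domain of H_a -/

section SeriesDomain

open scoped FourierTransform

variable {m : ℕ} {l a : ℝ}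

theorem exists_multiplier {p : Euc m → ℂ} (hc : Continuous p) {K : ℝ} (hK : ∀ ξ, ‖p ξ‖ ≤ K)
    (c : L2Euc m) : ∃ f, FourierEq p c f ∧ ‖f‖ ≤ K * ‖c‖ := by
  let b : BoundedContinuousFunction (Euc m) ℂ := BoundedContinuousFunction.ofNormedAddCommGroup p hc K hK
  refine ⟨multOp b c, fourierEq_multOp b c, (norm_multOp_le b c).trans ?_⟩
  refine mul_le_mul_of_nonneg_right ?_ (norm_nonneg _)
  exact BoundedContinuousFunction.norm_ofNormedAddCommGroup_le hc ((norm_nonneg _).trans (hK 0)) hK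

theorem FourierEq.norm_le {p : Euc m → ℂ} (hc : Continuous p) {K : ℝ} (hK : ∀ ξ, ‖p ξ‖ ≤ K)
    {c f : L2Euc m} (h : FourierEq p c f) : ‖f‖ ≤ K * ‖c‖ := by
  obtain ⟨g, h1, h2⟩ := exists_multiplier hc hK c
  rwa [h.unique h1]

/-- `U = ∑ₙ (pₙ(D) cₙ) ⊗ χₙ`. -/
def IsMultSeries (c : ℕ → L2Euc m) (χ : ℕ → L2 (Ioo 0 l)) (p : ℕ → Euc m → ℂ)
    (U : L2 (guide m l)) : Prop :=
  ∃ f : ℕ → L2Euc m, (∀ n, FourierEq (p n) (c n) (f n)) ∧ HasSum (fun n => tensor (f n) (χ n)) U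

theorem exists_isMultSeries {c : ℕ → L2Euc m} (hc : Summable fun n => ‖c n‖ ^ 2)
    {χ : ℕ → L2 (Ioo 0 l)} {C : ℝ} (hχ : BesselBound C (smulSeq χ)) {p : ℕ → Euc m → ℂ}
    (hp : ∀ n, Continuous (p n)) {K : ℝ} (hK : ∀ n ξ, ‖p n ξ‖ ≤ K) :
    ∃ U, IsMultSeries c χ p U := by
  choose f hf hn using fun n => exists_multiplier (hp n) (hK n) (c n)
  have hs : Summable fun n => ‖f n‖ ^ 2 := by
    refine Summable.of_nonneg_of_le (fun n => by positivity) (fun n => ?_) (hc.mul_left (K ^ 2))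
    rw [← mul_pow]
    exact pow_le_pow_left₀ (norm_nonneg _) (hn n) 2
  obtain ⟨U, hU⟩ := (hχ.tensor m).summable hs
  exact ⟨U, f, hf, hU⟩

theorem IsMultSeries.hasWeakDeriv_left {c : ℕ → L2Euc m} {χ : ℕ → L2 (Ioo 0 l)}
    {p q : ℕ → Euc m → ℂ} {v : Euc m} (hpq : ∀ n ξ, q n ξ = derSymbol v ξ * p n ξ)
    {U W : L2 (guide m l)} (hU : IsMultSeries c χ p U) (hW : IsMultSeries c χ q W) :
    HasWeakDeriv (guide m l) (v, 0) U W := by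
  obtain ⟨f, hf, hfU⟩ := hU
  obtain ⟨g, hg, hgW⟩ := hW
  refine HasWeakDeriv.of_hasSum (fun n => EucDeriv.tensor ?_ (χ n)) hfU hgW
  exact eucDeriv_iff.2 ((hf n).of_factor (hg n) (hpq n))

theorem IsMultSeries.hasWeakDeriv_right {c : ℕ → L2Euc m} {χ χ' : ℕ → L2 (Ioo 0 l)}
    {p q : ℕ → Euc m → ℂ} {κ : ℕ → ℂ} (hpq : ∀ n ξ, q n ξ = κ n * p n ξ)
    (hχ : ∀ n (f : L2Euc m), HasWeakDeriv (guide m l) (dirY m) (tensor f (χ n))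
      (tensor (κ n • f) (χ' n)))
    {U W : L2 (guide m l)} (hU : IsMultSeries c χ p U) (hW : IsMultSeries c χ' q W) :
    HasWeakDeriv (guide m l) (dirY m) U W := by
  obtain ⟨f, hf, hfU⟩ := hU
  obtain ⟨g, hg, hgW⟩ := hW
  refine HasWeakDeriv.of_hasSum (fun n => ?_) hfU hgW
  have : g n = κ n • f n := (hg n).unique (((hf n).smul (κ n)).congr (hpq n))
  rw [this]
  exact hχ n (f n)

theorem hasWeakDeriv_dir {u w w' : L2 (guide m l)} {v : Euc m}
    (h : HasWeakDeriv (guide m l) (v, 0) u w) (h' : HasWeakDeriv (guide m l) (dirY m) u w')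
    (t : ℝ) : HasWeakDeriv (guide m l) (v, t) u (w + (t : ℂ) • w') := by
  have := h.dir_add (h'.dir_smul t)
  simpa [dirY] using this

theorem mem_H1_guide {u : L2 (guide m l)} (h : ∀ v, ∃ w, HasWeakDeriv (guide m l) (v, 0) u w)
    (h' : ∃ w, HasWeakDeriv (guide m l) (dirY m) u w) : u ∈ H1 (guide m l) := by
  rintro ⟨v, t⟩
  obtain ⟨w, hw⟩ := h v
  obtain ⟨w', hw'⟩ := h'
  exact ⟨_, hasWeakDeriv_dir hw hw' t⟩

theorem mem_H2_guide {u : L2 (guide m l)}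
    (h : ∀ v, ∃ w ∈ H1 (guide m l), HasWeakDeriv (guide m l) (v, 0) u w)
    (h' : ∃ w ∈ H1 (guide m l), HasWeakDeriv (guide m l) (dirY m) u w) : u ∈ H2 (guide m l) := by
  rintro ⟨v, t⟩
  obtain ⟨w, hm, hw⟩ := h v
  obtain ⟨w', hm', hw'⟩ := h'
  exact ⟨_, (H1 _).add_mem hm ((H1 _).smul_mem _ hm'), hasWeakDeriv_dir hw hw' t⟩

/-- The value at `y` of the normalized mode. -/
def modeValue (l a : ℝ) (n : ℕ) (y : ℝ) : ℂ :=
  ((‖modeVec l a (transverseRoot l a n)‖⁻¹ : ℝ) : ℂ) * modeFun a (transverseRoot l a n) y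

theorem tensor_smul_comm (c : ℂ) (f : L2Euc m) (g : L2 (Ioo 0 l)) :
    tensor (c • f) g = tensor f (c • g) := by
  rw [tensor_smul_left, tensor_smul_right]

theorem greenY_modeVec (hl : 0 < l) (lam : ℂ) (f : L2Euc m) :
    GreenY m l (tensor f (modeVec l a lam)) (tensor ((Complex.I * lam) • f) (modeDerVec l a lam))
      (modeFun a lam 0 • f) (modeFun a lam l • f) := by
  rw [tensor_smul_comm, modeDerVec, smul_ofCont]
  exact greenY_tensor hl _ _ (hasDerivAt_modeFun a lam) f

theorem greenY_modeDerVec (hl : 0 < l) (lam : ℂ) (f : L2Euc m) :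
    GreenY m l (tensor f (modeDerVec l a lam)) (tensor ((Complex.I * lam) • f) (modeVec l a lam))
      (modeDer a lam 0 • f) (modeDer a lam l • f) := by
  rw [tensor_smul_comm, modeVec, smul_ofCont]
  exact greenY_tensor hl _ _ (hasDerivAt_modeDer a lam) f

theorem greenY_transverseMode (hl : 0 < l) (n : ℕ) (f : L2Euc m) :
    GreenY m l (tensor f (transverseMode l a n))
      (tensor ((Complex.I * transverseRoot l a n) • f) (transverseDer l a n))
      (modeValue l a n 0 • f) (modeValue l a n l • f) := by
  have h := greenY_modeVec (a := a) hl (transverseRoot l a n)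
    (((‖modeVec l a (transverseRoot l a n)‖⁻¹ : ℝ) : ℂ) • f)
  rw [smul_comm (Complex.I * _), tensor_smul_comm, tensor_smul_comm, smul_smul, smul_smul,
    mul_comm (modeFun a _ 0), mul_comm (modeFun a _ l)] at h
  exact h

theorem greenY_transverseDer (hl : 0 < l) (ha : 0 < a) (n : ℕ) (f : L2Euc m) :
    GreenY m l (tensor ((Complex.I * transverseRoot l a n) • f) (transverseDer l a n))
      (tensor ((Complex.I * transverseRoot l a n) • (Complex.I * transverseRoot l a n) • f)
        (transverseMode l a n))
      (-((Complex.I * a) • modeValue l a n 0 • f)) ((Complex.I * a) • modeValue l a n l • f) := by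
  have hr := isCharRoot_transverseRoot hl ha n
  have h1 := hr.sub_ne_zero ha
  have h := greenY_modeDerVec (a := a) hl (transverseRoot l a n)
    (((‖modeVec l a (transverseRoot l a n)‖⁻¹ : ℝ) : ℂ) • (Complex.I * transverseRoot l a n) • f)
  have b0 : -((Complex.I * a) • modeValue l a n 0 • f)
      = modeDer a (transverseRoot l a n) 0 • ((‖modeVec l a (transverseRoot l a n)‖⁻¹ : ℝ) : ℂ) •
        (Complex.I * transverseRoot l a n) • f := by
    rw [smul_smul, smul_smul, smul_smul, ← neg_smul, modeValue]
    congr 1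
    linear_combination (-((‖modeVec l a (transverseRoot l a n)‖⁻¹ : ℝ) : ℂ)) * modeFun_bc_zero h1
  have b1 : (Complex.I * a) • modeValue l a n l • f
      = modeDer a (transverseRoot l a n) l • ((‖modeVec l a (transverseRoot l a n)‖⁻¹ : ℝ) : ℂ) •
        (Complex.I * transverseRoot l a n) • f := by
    rw [smul_smul, smul_smul, smul_smul, modeValue]
    congr 1
    linear_combination (-((‖modeVec l a (transverseRoot l a n)‖⁻¹ : ℝ) : ℂ)) * hr.bc_right h1
  rw [← b0, ← b1, smul_comm (Complex.I * _) (((‖modeVec l a (transverseRoot l a n)‖⁻¹ : ℝ) : ℂ)),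
    tensor_smul_comm (((‖modeVec l a (transverseRoot l a n)‖⁻¹ : ℝ) : ℂ)),
    tensor_smul_comm (((‖modeVec l a (transverseRoot l a n)‖⁻¹ : ℝ) : ℂ))] at h
  exact h

/-- Im λ_n is bounded, hence so are both exponentials on [0, l]; the reflection coefficient and the
inverse normalization are bounded as well. -/
theorem exists_modeValue_le (hl : 0 < l) (ha : 0 < a) :
    ∃ V, 0 ≤ V ∧ ∀ n : ℕ, ∀ y ∈ Icc 0 l, ‖modeValue l a n y‖ ≤ V := by
  obtain ⟨M, hM, hMn⟩ := exists_inv_norm_modeVec_le hl ha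
  obtain ⟨C, hC, h⟩ := exists_mob_bound hl ha
    (fun n => (transverseRoot_spec hl ha n).1) (fun n => (transverseRoot_spec hl ha n).2) |>.1
  obtain ⟨T, hT, him⟩ := exists_im_bound hl ha
    (fun n => (transverseRoot_spec hl ha n).1) (fun n => (transverseRoot_spec hl ha n).2)
  refine ⟨M * (Real.exp (T * l) + (C + 1) * Real.exp (T * l)), by positivity, fun n y hy => ?_⟩
  rw [modeValue, norm_mul, Complex.norm_real, norm_inv, norm_norm]
  refine mul_le_mul (hMn n) ?_ (norm_nonneg _) hM
  have hmob : ‖mob a (transverseRoot l a n)‖ ≤ C + 1 := by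
    have h1 := norm_add_le (mob a (transverseRoot l a n) - 1) 1
    rw [sub_add_cancel, norm_one] at h1
    have h2 : C / ((n : ℝ) + 1) ≤ C := div_le_self hC (by
      have := n.cast_nonneg (α := ℝ)
      linarith)
    linarith [h n]
  have hb : |(transverseRoot l a n).im * y| ≤ T * l := by
    rw [abs_mul, abs_of_nonneg hy.1]
    exact mul_le_mul (him n) hy.2 hy.1 hT
  rw [modeFun]
  refine (norm_add_le _ _).trans (add_le_add ?_ ?_)
  · rw [Complex.norm_exp]
    refine Real.exp_le_exp.2 (le_trans (le_of_eq ?_) (neg_le_of_abs_le hb |> neg_le.1))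
    simp
  · rw [norm_mul, Complex.norm_exp]
    refine mul_le_mul hmob (Real.exp_le_exp.2 (le_trans (le_of_eq ?_) (le_of_abs_le hb)))
      (Real.exp_pos _).le (by linarith)
    simp

theorem summable_one_div_transverseRoot (hl : 0 < l) (ha : 0 < a) :
    Summable fun n => (1 + ‖transverseRoot l a n‖ ^ 2)⁻¹ := by
  set c := Real.pi / l with hc
  have hc0 : 0 < c := by positivity
  -- The factor comes from (n + 1)² ≤ 2(1 + n²) and n² ≤ max(1, c⁻²)(nc)², together with nc ≤ |λ_n|.
  have h1 : Summable fun n : ℕ => 2 * max 1 ((c ^ 2)⁻¹) * (1 / ((n : ℝ) + 1) ^ 2) := by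
    have := (summable_nat_add_iff 1).2 (Real.summable_one_div_nat_pow.2 (one_lt_two : 1 < 2))
    simpa using this.mul_left (2 * max 1 ((c ^ 2)⁻¹))
  refine Summable.of_nonneg_of_le (fun n => by positivity) (fun n => ?_) h1
  have h2 : n * c ≤ ‖transverseRoot l a n‖ :=
    (lt_re_of_phase hl ha (fun n => (transverseRoot_spec hl ha n).1)
      (fun n => (transverseRoot_spec hl ha n).2) n).le.trans (Complex.re_le_norm _)
  have h3 : (n * c) ^ 2 ≤ ‖transverseRoot l a n‖ ^ 2 := by gcongr
  set M := max 1 ((c ^ 2)⁻¹) with hM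
  have hM1 : 1 ≤ M := le_max_left _ _
  have hM2 : 1 ≤ M * c ^ 2 := by
    have := mul_le_mul_of_nonneg_right (le_max_right 1 ((c ^ 2)⁻¹)) (sq_nonneg c)
    rwa [inv_mul_cancel₀ (by positivity)] at this
  rw [mul_one_div, inv_eq_one_div, div_le_div_iff₀ (by positivity) (by positivity), one_mul]
  have h4 : (n : ℝ) ^ 2 ≤ M * (n * c) ^ 2 := by nlinarith [sq_nonneg (n : ℝ)]
  have h5 : M * (n * c) ^ 2 ≤ M * ‖transverseRoot l a n‖ ^ 2 := by gcongr
  nlinarith [sq_nonneg ((n : ℝ) - 1)]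

theorem norm_derSymbol_le (v ξ : Euc m) : ‖derSymbol v ξ‖ ≤ 2 * Real.pi * ‖ξ‖ * ‖v‖ := by
  rw [derSymbol, norm_mul, norm_mul, norm_mul, Complex.norm_I, Complex.norm_real, Complex.norm_real,
    Complex.norm_ofNat, Real.norm_of_nonneg Real.pi_pos.le, mul_one, mul_assoc (2 * Real.pi)]
  exact mul_le_mul_of_nonneg_left (norm_inner_le_norm ξ v) (by positivity)

theorem continuous_derSymbol (v : Euc m) : Continuous (derSymbol v) := by
  unfold derSymbol
  fun_prop

theorem lapSymbol_eq (ξ : Euc m) : lapSymbol ξ = (2 * Real.pi * ‖ξ‖) ^ 2 := by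
  rw [lapSymbol, mul_pow (2 * Real.pi)]

theorem norm_mul_le_of_regular {S B : ℂ} {N K R : ℝ} (hN : 0 ≤ N) (hS : ‖S‖ ≤ N * R)
    (hK : R * ‖B‖ ≤ K) : ‖S * B‖ ≤ N * K := by
  rw [norm_mul]
  calc ‖S‖ * ‖B‖ ≤ N * R * ‖B‖ := mul_le_mul_of_nonneg_right hS (norm_nonneg _)
    _ = N * (R * ‖B‖) := by ring
    _ ≤ N * K := mul_le_mul_of_nonneg_left hK hN

/-- The symbol families that occur in the derivatives of order at most two. -/
theorem norm_symbol_le (v v' ξ : Euc m) (z : ℂ) :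
    ‖derSymbol v ξ‖ ≤ ‖v‖ * (1 + lapSymbol ξ + ‖z‖ ^ 2) ∧
    ‖z‖ ≤ 1 * (1 + lapSymbol ξ + ‖z‖ ^ 2) ∧
    ‖derSymbol v' ξ * derSymbol v ξ‖ ≤ ‖v'‖ * ‖v‖ * (1 + lapSymbol ξ + ‖z‖ ^ 2) ∧
    ‖derSymbol v ξ * z‖ ≤ ‖v‖ * (1 + lapSymbol ξ + ‖z‖ ^ 2) ∧
    ‖z * z‖ ≤ 1 * (1 + lapSymbol ξ + ‖z‖ ^ 2) := by
  have h := norm_derSymbol_le v ξ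
  have h' := norm_derSymbol_le v' ξ
  rw [norm_mul, norm_mul, norm_mul, lapSymbol_eq]
  set s := 2 * Real.pi * ‖ξ‖ with hs
  have hs0 : 0 ≤ s := by positivity
  have hz0 := norm_nonneg z
  have hv0 := norm_nonneg v
  have hv0' := norm_nonneg v'
  have e1 : s ≤ 1 + s ^ 2 + ‖z‖ ^ 2 := by nlinarith [sq_nonneg (s - 1), sq_nonneg ‖z‖]
  have e2 : s * ‖z‖ ≤ 1 + s ^ 2 + ‖z‖ ^ 2 := by
    nlinarith [sq_nonneg (s - ‖z‖), sq_nonneg (s + ‖z‖)]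
  have e3 : s ^ 2 ≤ 1 + s ^ 2 + ‖z‖ ^ 2 := by nlinarith [sq_nonneg ‖z‖]
  refine ⟨?_, ?_, ?_, ?_, ?_⟩
  · rw [mul_comm] at h
    exact h.trans (mul_le_mul_of_nonneg_left e1 hv0)
  · nlinarith [sq_nonneg (‖z‖ - 1), sq_nonneg s]
  · calc ‖derSymbol v' ξ‖ * ‖derSymbol v ξ‖ ≤ (s * ‖v'‖) * (s * ‖v‖) :=
        mul_le_mul h' h (norm_nonneg _) (by positivity)
      _ = ‖v'‖ * ‖v‖ * s ^ 2 := by ring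
      _ ≤ _ := mul_le_mul_of_nonneg_left e3 (by positivity)
  · calc ‖derSymbol v ξ‖ * ‖z‖ ≤ (s * ‖v‖) * ‖z‖ := mul_le_mul_of_nonneg_right h hz0
      _ = ‖v‖ * (s * ‖z‖) := by ring
      _ ≤ _ := mul_le_mul_of_nonneg_left e2 hv0
  · nlinarith [sq_nonneg s]

section Regular

variable {c : ℕ → L2Euc m} {b : ℕ → Euc m → ℂ} {K : ℝ} {U : L2 (guide m l)}

/-- `greenY_transverseDer` carries a factor iλ_n, which is removed because λ_n ≠ 0. -/
theorem hasWeakDeriv_tensor_transverseDer (hl : 0 < l) (ha : 0 < a) (n : ℕ) (f : L2Euc m) :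
    HasWeakDeriv (guide m l) (dirY m) (tensor f (transverseDer l a n))
      (tensor ((Complex.I * transverseRoot l a n) • f) (transverseMode l a n)) := by
  have h0 : Complex.I * transverseRoot l a n ≠ 0 :=
    mul_ne_zero Complex.I_ne_zero (transverseRoot_ne_zero hl ha n)
  have := (greenY_transverseDer (m := m) hl ha n
    ((Complex.I * transverseRoot l a n)⁻¹ • f)).hasWeakDeriv
  rwa [smul_inv_smul₀ h0] at this

/-- A y-derivative costs a factor iλ_n and exchanges the modes with their normalized derivatives.
The hypothesis `hK` says that the symbols gain two orders jointly in ξ and λ_n, so the new symbols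
remain uniformly bounded. -/
theorem exists_weakDeriv_dirY (hl : 0 < l) (ha : 0 < a) (hc : Summable fun n => ‖c n‖ ^ 2)
    (hb : ∀ n, Continuous (b n))
    (hK : ∀ n ξ, (1 + lapSymbol ξ + ‖transverseRoot l a n‖ ^ 2) * ‖b n ξ‖ ≤ K)
    (hU : IsMultSeries c (transverseMode l a) b U) :
    ∃ Wy Wyy, IsMultSeries c (transverseDer l a)
        (fun n ξ => Complex.I * transverseRoot l a n * b n ξ) Wy ∧
      IsMultSeries c (transverseMode l a) (fun n ξ => Complex.I * transverseRoot l a n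
        * (Complex.I * transverseRoot l a n) * b n ξ) Wyy ∧
      HasWeakDeriv (guide m l) (dirY m) U Wy ∧ HasWeakDeriv (guide m l) (dirY m) Wy Wyy := by
  obtain ⟨C, hC, hB, -⟩ := (isRieszBasis_transverseMode hl ha).exists_besselBound
  obtain ⟨C', hB'⟩ := exists_besselBound_transverseDer hl ha
  have hκ : ∀ n, ‖Complex.I * transverseRoot l a n‖ = ‖transverseRoot l a n‖ := fun n => by
    rw [norm_mul, Complex.norm_I, one_mul]
  obtain ⟨Wy, hWy⟩ := exists_isMultSeries hc hB'
    (p := fun n ξ => Complex.I * transverseRoot l a n * b n ξ)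
    (fun n => continuous_const.mul (hb n)) (K := 1 * K) fun n ξ =>
      norm_mul_le_of_regular one_pos.le
        (by simpa only [hκ] using (norm_symbol_le 0 0 ξ (Complex.I * transverseRoot l a n)).2.1)
        (hK n ξ)
  obtain ⟨Wyy, hWyy⟩ := exists_isMultSeries hc hB
    (p := fun n ξ => Complex.I * transverseRoot l a n * (Complex.I * transverseRoot l a n) * b n ξ)
    (fun n => continuous_const.mul (hb n)) (K := 1 * K) fun n ξ =>
      norm_mul_le_of_regular one_pos.le
        (by simpa only [hκ] using
          (norm_symbol_le 0 0 ξ (Complex.I * transverseRoot l a n)).2.2.2.2) (hK n ξ)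
  refine ⟨Wy, Wyy, hWy, hWyy, ?_, ?_⟩
  · exact hU.hasWeakDeriv_right (κ := fun n => Complex.I * transverseRoot l a n) (fun n ξ => rfl)
      (fun n f => (greenY_transverseMode hl n f).hasWeakDeriv) hWy
  · exact hWy.hasWeakDeriv_right (κ := fun n => Complex.I * transverseRoot l a n)
      (fun n ξ => mul_assoc _ _ _) (hasWeakDeriv_tensor_transverseDer hl ha) hWyy

theorem exists_weakDeriv_mixed (hl : 0 < l) (ha : 0 < a) (hc : Summable fun n => ‖c n‖ ^ 2)
    (hb : ∀ n, Continuous (b n))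
    (hK : ∀ n ξ, (1 + lapSymbol ξ + ‖transverseRoot l a n‖ ^ 2) * ‖b n ξ‖ ≤ K) (v : Euc m) :
    ∃ W, IsMultSeries c (transverseDer l a)
      (fun n ξ => derSymbol v ξ * (Complex.I * transverseRoot l a n) * b n ξ) W := by
  obtain ⟨C', hB'⟩ := exists_besselBound_transverseDer hl ha
  have hκ : ∀ n, ‖Complex.I * transverseRoot l a n‖ = ‖transverseRoot l a n‖ := fun n => by
    rw [norm_mul, Complex.norm_I, one_mul]
  exact exists_isMultSeries hc hB'
    (fun n => ((continuous_derSymbol v).mul continuous_const).mul (hb n)) (K := ‖v‖ * K)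
    fun n ξ => norm_mul_le_of_regular (norm_nonneg v)
      (by simpa only [hκ] using
        (norm_symbol_le v 0 ξ (Complex.I * transverseRoot l a n)).2.2.2.1) (hK n ξ)

/-- Every derivative of order at most two is again a multiplier series with uniformly bounded
symbols: x-derivatives keep the transverse family, y-derivatives exchange the two. Both families are
Bessel, so these series converge and termwise differentiation is legitimate. -/
theorem IsMultSeries.mem_H2 (hl : 0 < l) (ha : 0 < a) (hc : Summable fun n => ‖c n‖ ^ 2)
    (hb : ∀ n, Continuous (b n))
    (hK : ∀ n ξ, (1 + lapSymbol ξ + ‖transverseRoot l a n‖ ^ 2) * ‖b n ξ‖ ≤ K)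
    (hU : IsMultSeries c (transverseMode l a) b U) : U ∈ H2 (guide m l) := by
  obtain ⟨C, hC, hB, -⟩ := (isRieszBasis_transverseMode hl ha).exists_besselBound
  obtain ⟨Wy, Wyy, hWy, hWyy, dy, dyy⟩ := exists_weakDeriv_dirY hl ha hc hb hK hU
  refine mem_H2_guide (fun v => ?_) ⟨Wy, mem_H1_guide (fun v => ?_) ⟨Wyy, dyy⟩, dy⟩
  · obtain ⟨W, hW⟩ := exists_isMultSeries hc hB (p := fun n ξ => derSymbol v ξ * b n ξ)
      (fun n => (continuous_derSymbol v).mul (hb n)) (K := ‖v‖ * K) fun n ξ =>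
        norm_mul_le_of_regular (norm_nonneg v) (norm_symbol_le v 0 ξ _).1 (hK n ξ)
    refine ⟨W, mem_H1_guide (fun v' => ?_) ?_, hU.hasWeakDeriv_left (fun n ξ => rfl) hW⟩
    · obtain ⟨W', hW'⟩ := exists_isMultSeries hc hB
        (p := fun n ξ => derSymbol v' ξ * derSymbol v ξ * b n ξ)
        (fun n => ((continuous_derSymbol v').mul (continuous_derSymbol v)).mul (hb n))
        (K := ‖v'‖ * ‖v‖ * K) fun n ξ => norm_mul_le_of_regular (by positivity)
          (norm_symbol_le v v' ξ _).2.2.1 (hK n ξ)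
      exact ⟨W', hW.hasWeakDeriv_left (fun n ξ => mul_assoc _ _ _) hW'⟩
    · obtain ⟨W', hW'⟩ := exists_weakDeriv_mixed hl ha hc hb hK v
      exact ⟨W', hW.hasWeakDeriv_right (κ := fun n => Complex.I * transverseRoot l a n)
        (fun n ξ => by ring) (fun n f => (greenY_transverseMode hl n f).hasWeakDeriv) hW'⟩
  · obtain ⟨W, hW⟩ := exists_weakDeriv_mixed hl ha hc hb hK v
    exact ⟨W, hWy.hasWeakDeriv_left (fun n ξ => mul_assoc _ _ _) hW⟩

/-- The Bessel bounds say nothing about traces on the boundary, so this series is made absolutely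
convergent: the end values are bounded and ‖f n‖ = O((1 + |λ_n|²)⁻¹), which is summable because λ_n
grows at least linearly. -/
theorem summable_modeValue_smul (hl : 0 < l) (ha : 0 < a) (hc : Summable fun n => ‖c n‖ ^ 2)
    (hb : ∀ n, Continuous (b n))
    (hK : ∀ n ξ, (1 + lapSymbol ξ + ‖transverseRoot l a n‖ ^ 2) * ‖b n ξ‖ ≤ K)
    {f : ℕ → L2Euc m} (hf : ∀ n, FourierEq (b n) (c n) (f n)) {y : ℝ} (hy : y ∈ Icc 0 l) :
    Summable fun n => modeValue l a n y • f n := by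
  obtain ⟨V, hV, hVn⟩ := exists_modeValue_le hl ha
  obtain ⟨N, hN⟩ : ∃ N, ∀ n, ‖c n‖ ≤ N := by
    obtain ⟨N, hN⟩ := hc.tendsto_atTop_zero.bddAbove_range
    exact ⟨√N, fun n => Real.le_sqrt_of_sq_le (hN ⟨n, rfl⟩)⟩
  have hlap : ∀ ξ : Euc m, 0 ≤ lapSymbol ξ := fun ξ => by
    rw [lapSymbol_eq]
    positivity
  have hK0 : 0 ≤ K := le_trans (mul_nonneg (by have := hlap 0; positivity) (norm_nonneg _)) (hK 0 0)
  have hfn : ∀ n, ‖f n‖ ≤ K * N * (1 + ‖transverseRoot l a n‖ ^ 2)⁻¹ := fun n => by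
    have h0 : (0 : ℝ) < 1 + ‖transverseRoot l a n‖ ^ 2 := by positivity
    have h1 : ∀ ξ, ‖b n ξ‖ ≤ K * (1 + ‖transverseRoot l a n‖ ^ 2)⁻¹ := fun ξ => by
      rw [← div_eq_mul_inv, le_div_iff₀ h0, mul_comm]
      refine le_trans (mul_le_mul_of_nonneg_right ?_ (norm_nonneg _)) (hK n ξ)
      linarith [hlap ξ]
    refine ((hf n).norm_le (hb n) h1).trans ?_
    rw [mul_right_comm K N]
    exact mul_le_mul_of_nonneg_left (hN n) (by positivity)
  refine Summable.of_norm_bounded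
    ((summable_one_div_transverseRoot hl ha).mul_left (V * (K * N))) fun n => ?_
  rw [norm_smul, mul_assoc]
  exact mul_le_mul (hVn n y hy) (hfn n) (norm_nonneg _) hV

/-- Sufficiently regular series along the modes belong to the domain of `H_a`. -/
theorem IsMultSeries.mem_domain (hl : 0 < l) (ha : 0 < a) (hc : Summable fun n => ‖c n‖ ^ 2)
    (hb : ∀ n, Continuous (b n))
    (hK : ∀ n ξ, (1 + lapSymbol ξ + ‖transverseRoot l a n‖ ^ 2) * ‖b n ξ‖ ≤ K)
    (hU : IsMultSeries c (transverseMode l a) b U) : U ∈ (guideOp m l a).domain := by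
  have hH2 := hU.mem_H2 hl ha hc hb hK
  obtain ⟨Wy, Wyy, ⟨g, hg, hgW⟩, ⟨k, hk, hkW⟩, dy, dyy⟩ := exists_weakDeriv_dirY hl ha hc hb hK hU
  obtain ⟨f, hf, hfU⟩ := hU
  have hgf : ∀ n, g n = (Complex.I * transverseRoot l a n) • f n := fun n =>
    (hg n).unique ((hf n).smul _)
  have hkf : ∀ n, k n = (Complex.I * transverseRoot l a n) • (Complex.I * transverseRoot l a n)
      • f n := fun n =>
    (hk n).unique ((((hf n).smul _).smul _).congr fun ξ => mul_assoc _ _ _)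
  obtain ⟨G₀, hG₀⟩ := summable_modeValue_smul hl ha hc hb hK hf (left_mem_Icc.2 hl.le)
  obtain ⟨G₁, hG₁⟩ := summable_modeValue_smul hl ha hc hb hK hf (right_mem_Icc.2 hl.le)
  have t1 : GreenY m l U Wy G₀ G₁ := GreenY.of_hasSum (fun n => by
    rw [hgf]
    exact greenY_transverseMode hl n (f n)) hfU hgW hG₀ hG₁
  have t2 : GreenY m l Wy Wyy (-((Complex.I * a) • G₀)) ((Complex.I * a) • G₁) :=
    GreenY.of_hasSum (fun n => by
      rw [hgf, hkf]
      exact greenY_transverseDer hl ha n (f n)) hgW hkW (hG₀.const_smul _).neg (hG₁.const_smul _)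
  refine ⟨hH2, G₀, G₁, t1.hasTraces, ?_⟩
  rw [dy.weakDeriv_eq (isOpen_guide m l)]
  exact t2.hasTraces

end Regular

end SeriesDomain

/-! ### The resolvent of H_a and the spectral gap -/

section Resolvent

variable {m : ℕ} {l a : ℝ}

theorem lapSymbol_nonneg (ξ : Euc m) : 0 ≤ lapSymbol ξ := by
  rw [lapSymbol_eq]
  positivity

theorem continuous_lapSymbol : Continuous (lapSymbol (m := m)) := by
  unfold lapSymbol
  fun_prop

theorem tendsto_re_transverseRoot_sq (hl : 0 < l) (ha : 0 < a) :
    Tendsto (fun n => (transverseRoot l a n ^ 2).re) atTop atTop := by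
  obtain ⟨T, hT, him⟩ := exists_im_bound hl ha
    (fun n => (transverseRoot_spec hl ha n).1) (fun n => (transverseRoot_spec hl ha n).2)
  have hc : 0 < Real.pi / l := by positivity
  have h1 : Tendsto (fun n : ℕ => ((n : ℝ) * (Real.pi / l)) ^ 2 + -T ^ 2) atTop atTop :=
    tendsto_atTop_add_const_right _ _ ((tendsto_pow_atTop two_ne_zero).comp
      (tendsto_natCast_atTop_atTop.atTop_mul_const hc))
  refine tendsto_atTop_mono (fun n => ?_) h1
  have h2 := lt_re_of_phase hl ha
    (fun n => (transverseRoot_spec hl ha n).1) (fun n => (transverseRoot_spec hl ha n).2) n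
  have h3 : ((n : ℝ) * (Real.pi / l)) ^ 2 ≤ (transverseRoot l a n).re ^ 2 := by gcongr
  have h4 : (transverseRoot l a n).im ^ 2 ≤ T ^ 2 := sq_le_sq' (neg_le_of_abs_le (him n))
    (le_of_abs_le (him n))
  have h5 : (transverseRoot l a n ^ 2).re
      = (transverseRoot l a n).re ^ 2 - (transverseRoot l a n).im ^ 2 := by
    rw [sq, Complex.mul_re]
    ring
  rw [h5]
  linarith

theorem spectralSet_nonempty (l a : ℝ) : (spectralSet l a).Nonempty :=
  ⟨_, 0, 0, le_rfl, rfl⟩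

/-- For w_n = λ_n² - z, the number max(|Im w_n|, Re w_n) bounds |w_n + r| from below for every r ≥
0, and is positive because 0 is not on that half-line. It is at least 1 for large n since Re λ_n² →
∞, so only finitely many half-lines matter. -/
theorem exists_dist_bound (hl : 0 < l) (ha : 0 < a) {z : ℂ} (hz : z ∉ spectralSet l a) :
    ∃ δ > 0, ∀ (n : ℕ) (r : ℝ), 0 ≤ r → δ ≤ ‖transverseRoot l a n ^ 2 + r - z‖ := by
  set w : ℕ → ℂ := fun n => transverseRoot l a n ^ 2 - z with hw
  set d : ℕ → ℝ := fun n => max |(w n).im| (w n).re with hd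
  have hd0 : ∀ n, 0 < d n := by
    intro n
    by_contra h0
    have h1 : (w n).im = 0 := abs_nonpos_iff.1 ((le_max_left _ _).trans (not_lt.1 h0))
    have h2 : (w n).re ≤ 0 := (le_max_right _ _).trans (not_lt.1 h0)
    refine hz ⟨n, -(w n).re, by linarith, ?_⟩
    have h3 : w n = ((w n).re : ℂ) := Complex.ext (by simp) (by simp [h1])
    push_cast
    rw [← h3, hw]
    ring
  have hd1 : ∀ᶠ n in atTop, (d n)⁻¹ ≤ 1 := by
    filter_upwards [(tendsto_re_transverseRoot_sq hl ha).eventually_ge_atTop (z.re + 1)] with n hn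
    refine inv_le_one_of_one_le₀ (le_trans ?_ (le_max_right _ _))
    rw [hw, Complex.sub_re]
    linarith
  obtain ⟨M, hM⟩ := (isBoundedUnder_of_eventually_le hd1).bddAbove_range
  have hM' : ∀ n, (d n)⁻¹ ≤ M := fun n => hM ⟨n, rfl⟩
  have hM0 : 0 < M := (inv_pos.2 (hd0 0)).trans_le (hM' 0)
  refine ⟨M⁻¹, inv_pos.2 hM0, fun n r hr => ?_⟩
  refine ((inv_le_comm₀ hM0 (hd0 n)).2 (hM' n)).trans ?_
  have e : transverseRoot l a n ^ 2 + r - z = w n + r := by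
    rw [hw]
    ring
  rw [e]
  refine max_le ?_ ?_
  · have := Complex.abs_im_le_norm (w n + r)
    rwa [Complex.add_im, Complex.ofReal_im, add_zero] at this
  · have := Complex.re_le_norm (w n + r)
    rw [Complex.add_re, Complex.ofReal_re] at this
    linarith

theorem infDist_spectralSet_pos (hl : 0 < l) (ha : 0 < a) {z : ℂ} (hz : z ∉ spectralSet l a) :
    0 < Metric.infDist z (spectralSet l a) := by
  obtain ⟨δ, hδ, h⟩ := exists_dist_bound hl ha hz
  refine hδ.trans_le ((Metric.le_infDist (spectralSet_nonempty l a)).2 ?_)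
  rintro _ ⟨n, r, hr, rfl⟩
  rw [dist_comm, dist_eq_norm]
  exact h n r hr

theorem infDist_le_norm_symbol {z : ℂ} (n : ℕ) (ξ : Euc m) :
    Metric.infDist z (spectralSet l a) ≤ ‖(lapSymbol ξ : ℂ) - (z - transverseRoot l a n ^ 2)‖ := by
  have h := Metric.infDist_le_dist_of_mem (x := z)
    (show transverseRoot l a n ^ 2 + (lapSymbol ξ : ℂ) ∈ spectralSet l a from
      ⟨n, lapSymbol ξ, lapSymbol_nonneg ξ, rfl⟩)
  rw [dist_comm, dist_eq_norm] at h
  rwa [show (lapSymbol ξ : ℂ) - (z - transverseRoot l a n ^ 2)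
    = transverseRoot l a n ^ 2 + (lapSymbol ξ : ℂ) - z by ring]

/-- Ellipticity of the symbols, uniform in the transverse mode. -/
theorem exists_symbol_bound (hl : 0 < l) (ha : 0 < a) {z : ℂ} (hz : z ∉ spectralSet l a) :
    ∃ K, ∀ (n : ℕ) (ξ : Euc m), 1 + lapSymbol ξ + ‖transverseRoot l a n‖ ^ 2
      ≤ K * ‖(lapSymbol ξ : ℂ) - (z - transverseRoot l a n ^ 2)‖ := by
  obtain ⟨T, hT, him⟩ := exists_im_bound hl ha
    (fun n => (transverseRoot_spec hl ha n).1) (fun n => (transverseRoot_spec hl ha n).2)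
  have hδ := infDist_spectralSet_pos hl ha hz
  -- The left side equals Re X + Re z + 1 + 2(Im λ_n)², where X is the symbol on the right. Here Re
  -- X ≤ |X|, and the bounded remainder is absorbed by |X| ≥ dist(z, 𝔖_a).
  refine ⟨1 + (1 + ‖z‖ + 2 * T ^ 2) / Metric.infDist z (spectralSet l a), fun n ξ => ?_⟩
  have h1 := infDist_le_norm_symbol (l := l) (a := a) (z := z) n ξ
  set δ := Metric.infDist z (spectralSet l a)
  set X := (lapSymbol ξ : ℂ) - (z - transverseRoot l a n ^ 2) with hX
  have h2 : (1 + ‖z‖ + 2 * T ^ 2) ≤ (1 + ‖z‖ + 2 * T ^ 2) / δ * ‖X‖ := by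
    rw [div_mul_eq_mul_div, le_div_iff₀ hδ]
    exact mul_le_mul_of_nonneg_left h1 (by positivity)
  have h3 : X.re = lapSymbol ξ - z.re + ((transverseRoot l a n).re ^ 2
      - (transverseRoot l a n).im ^ 2) := by
    rw [hX, sq (transverseRoot l a n)]
    simp
    ring
  have h4 : ‖transverseRoot l a n‖ ^ 2
      = (transverseRoot l a n).re ^ 2 + (transverseRoot l a n).im ^ 2 := by
    rw [Complex.sq_norm, Complex.normSq_apply]
    ring
  have h5 : (transverseRoot l a n).im ^ 2 ≤ T ^ 2 := sq_le_sq' (neg_le_of_abs_le (him n))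
    (le_of_abs_le (him n))
  have h6 := Complex.re_le_norm X
  have h7 := Complex.re_le_norm z
  rw [add_mul, one_mul, h4]
  linarith

/-- The symbol `1 / (4 π² |ξ|² + λ_n² - z)`. -/
def resSymbol (m : ℕ) (l a : ℝ) (z : ℂ) (n : ℕ) (ξ : Euc m) : ℂ :=
  ((lapSymbol ξ : ℂ) - (z - transverseRoot l a n ^ 2))⁻¹

theorem symbol_ne_zero (hl : 0 < l) (ha : 0 < a) {z : ℂ} (hz : z ∉ spectralSet l a) (n : ℕ)
    (ξ : Euc m) : (lapSymbol ξ : ℂ) - (z - transverseRoot l a n ^ 2) ≠ 0 :=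
  norm_pos_iff.1 ((infDist_spectralSet_pos hl ha hz).trans_le (infDist_le_norm_symbol n ξ))

theorem continuous_resSymbol (hl : 0 < l) (ha : 0 < a) {z : ℂ} (hz : z ∉ spectralSet l a) (n : ℕ) :
    Continuous (resSymbol m l a z n) :=
  ((Complex.continuous_ofReal.comp continuous_lapSymbol).sub continuous_const).inv₀
    (symbol_ne_zero hl ha hz n)

theorem norm_resSymbol_le (hl : 0 < l) (ha : 0 < a) {z : ℂ} (hz : z ∉ spectralSet l a) (n : ℕ)
    (ξ : Euc m) : ‖resSymbol m l a z n ξ‖ ≤ (Metric.infDist z (spectralSet l a))⁻¹ := by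
  rw [resSymbol, norm_inv]
  exact inv_anti₀ (infDist_spectralSet_pos hl ha hz) (infDist_le_norm_symbol n ξ)

/-- The resolvent symbol as a bounded function. -/
def resBCF (m : ℕ) (hl : 0 < l) (ha : 0 < a) {z : ℂ} (hz : z ∉ spectralSet l a) (n : ℕ) :
    BoundedContinuousFunction (Euc m) ℂ :=
  BoundedContinuousFunction.ofNormedAddCommGroup (resSymbol m l a z n)
    (continuous_resSymbol hl ha hz n) _ (norm_resSymbol_le hl ha hz n)

theorem norm_multOp_resBCF_le (hl : 0 < l) (ha : 0 < a) {z : ℂ} (hz : z ∉ spectralSet l a) (n : ℕ)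
    (f : L2Euc m) : ‖multOp (resBCF m hl ha hz n) f‖
      ≤ (Metric.infDist z (spectralSet l a))⁻¹ * ‖f‖ :=
  (norm_multOp_le _ f).trans (mul_le_mul_of_nonneg_right
    (BoundedContinuousFunction.norm_ofNormedAddCommGroup_le _
      (inv_nonneg.2 Metric.infDist_nonneg) _) (norm_nonneg _))

theorem isResolventAt_negLaplacian_sub (hl : 0 < l) (ha : 0 < a) {z : ℂ}
    (hz : z ∉ spectralSet l a) (n : ℕ) :
    IsResolventAt (negLaplacian m) (z - transverseRoot l a n ^ 2) (multOp (resBCF m hl ha hz n)) :=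
  isResolventAt_negLaplacian _ fun ξ => mul_inv_cancel₀ (symbol_ne_zero hl ha hz n ξ)

/-- Uniformly bounded operators on the components define a bounded operator on `L²(Ω)`. -/
theorem exists_componentwise {φ : ℕ → L2 (Ioo 0 l)} {C : ℝ} (hC : 0 ≤ C)
    (h1 : BesselBound C (smulSeq φ)) (h2 : BesselBound C (smulSeq (dualBasis φ)))
    {T : ℕ → L2Euc m →L[ℂ] L2Euc m} {K : ℝ} (hK : 0 ≤ K) (hT : ∀ n f, ‖T n f‖ ≤ K * ‖f‖) :
    ∃ R : L2 (guide m l) →L[ℂ] L2 (guide m l),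
      (∀ u, HasSum (fun n => tensor (T n (component u (dualBasis φ n))) (φ n)) (R u)) ∧
      ∀ u, ‖R u‖ ≤ C * K * ‖u‖ := by
  have hle : ∀ u n, ‖T n (component u (dualBasis φ n))‖ ^ 2
      ≤ K ^ 2 * ‖component u (dualBasis φ n)‖ ^ 2 := fun u n => by
    rw [← mul_pow]
    exact pow_le_pow_left₀ (norm_nonneg _) (hT n _) 2
  have hs : ∀ u, Summable fun n => tensor (T n (component u (dualBasis φ n))) (φ n) := fun u =>
    (h1.tensor m).summable (Summable.of_nonneg_of_le (fun n => by positivity) (hle u)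
      ((h2.summable_norm_component_sq hC u).mul_left (K ^ 2)))
  let R₀ : L2 (guide m l) →ₗ[ℂ] L2 (guide m l) :=
    { toFun := fun u => ∑' n, tensor (T n (component u (dualBasis φ n))) (φ n)
      map_add' := fun u v => by
        rw [← (hs u).tsum_add (hs v)]
        refine tsum_congr fun n => ?_
        rw [component_add, map_add, tensor_add_left]
      map_smul' := fun c u => by
        rw [RingHom.id_apply, ← (hs u).tsum_const_smul c]
        refine tsum_congr fun n => ?_
        rw [component_smul, map_smul, tensor_smul_left] }
  have hb : ∀ u, ‖R₀ u‖ ≤ C * K * ‖u‖ := fun u => by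
    have h3 := (h1.tensor m).norm_sq_le_of_hasSum hC (S := K ^ 2 * (C * ‖u‖ ^ 2))
      (c := fun n => T n (component u (dualBasis φ n))) (fun s => by
        refine (Finset.sum_le_sum fun n _ => hle u n).trans ?_
        rw [← Finset.mul_sum]
        exact mul_le_mul_of_nonneg_left (h2.sum_norm_component_sq_le hC u s) (sq_nonneg K))
      (hs u).hasSum
    refine (pow_le_pow_iff_left₀ (norm_nonneg _) (by positivity) two_ne_zero).1 ?_
    refine h3.trans (le_of_eq ?_)
    ring
  exact ⟨R₀.mkContinuous (C * K) hb, fun u => (hs u).hasSum, hb⟩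

/-- Functions are determined by their dual components, on which H_a - z and R act by reciprocal
symbols; both inverse identities follow. The analytic content is that R maps into the domain, where
ellipticity supplies the gain of two orders. -/
theorem resolvent_componentwise (hl : 0 < l) (ha : 0 < a) {z : ℂ} (hz : z ∉ spectralSet l a)
    {R : L2 (guide m l) →L[ℂ] L2 (guide m l)}
    (hR : ∀ u, HasSum (fun n => tensor (multOp (resBCF m hl ha hz n) (modeComponent m l a u n))
      (transverseMode l a n)) (R u)) : IsResolventAt (guideOp m l a) z R := by
  have hφ := isRieszBasis_transverseMode hl ha
  obtain ⟨C, hC, -, h2⟩ := hφ.exists_besselBound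
  have hcomp : ∀ u n, FourierEq (resSymbol m l a z n) (modeComponent m l a u n)
      (modeComponent m l a (R u) n) := fun u n => by
    have := component_dualBasis_of_hasSum hφ (hR u) n
    rw [modeComponent, modeComponent, this]
    exact fourierEq_multOp (resBCF m hl ha hz n) _
  have hop : ∀ (u : (guideOp m l a).domain) (n : ℕ),
      FourierEq (fun ξ => (lapSymbol ξ : ℂ) - (z - transverseRoot l a n ^ 2))
        (modeComponent m l a (u : L2 (guide m l)) n)
        (modeComponent m l a (guideOp m l a u - z • (u : L2 (guide m l))) n) := fun u n => by
    have e : modeComponent m l a (guideOp m l a u - z • (u : L2 (guide m l))) n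
        = modeComponent m l a (guideOp m l a u) n
          - z • modeComponent m l a (u : L2 (guide m l)) n := by
      simp only [modeComponent, component_sub, component_smul]
    rw [e, modeComponent_guideOp hl ha, add_sub_assoc, ← sub_smul]
    refine ((fourierEq_negLaplacian _).add ((fourierEq_one _).smul _)).congr fun ξ => ?_
    ring
  have hinv : ∀ n (ξ : Euc m), resSymbol m l a z n ξ
      * ((lapSymbol ξ : ℂ) - (z - transverseRoot l a n ^ 2)) = 1 := fun n ξ =>
    inv_mul_cancel₀ (symbol_ne_zero hl ha hz n ξ)
  obtain ⟨K, hK⟩ := exists_symbol_bound (m := m) hl ha hz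
  constructor
  · intro f
    have hmem : R f ∈ (guideOp m l a).domain := by
      refine IsMultSeries.mem_domain hl ha (h2.summable_norm_component_sq hC f)
        (b := resSymbol m l a z) (K := K) (continuous_resSymbol hl ha hz) (fun n ξ => ?_)
        ⟨_, fun n => fourierEq_multOp (resBCF m hl ha hz n) _, hR f⟩
      refine (mul_le_mul_of_nonneg_right (hK n ξ) (norm_nonneg _)).trans (le_of_eq ?_)
      rw [mul_assoc, ← norm_mul, mul_comm (_ - _), hinv, norm_one, mul_one]
    refine ⟨hmem, eq_of_component_dualBasis_eq hφ fun n => ?_⟩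
    refine FourierEq.unique ((hcomp f n).mul (hop ⟨R f, hmem⟩ n))
      ((fourierEq_one _).congr fun ξ => ?_)
    rw [mul_comm, hinv]
  · intro u
    refine eq_of_component_dualBasis_eq hφ fun n => ?_
    exact FourierEq.unique ((hop u n).mul (hcomp _ n)) ((fourierEq_one _).congr (hinv n))

/-- The resolvent of `H_a`, with a bound uniform in `z`. -/
theorem exists_resolvent (m : ℕ) (hl : 0 < l) (ha : 0 < a) :
    ∃ C, 0 ≤ C ∧ ∀ (z : ℂ) (hz : z ∉ spectralSet l a),
      ∃ R : L2 (guide m l) →L[ℂ] L2 (guide m l), IsResolventAt (guideOp m l a) z R ∧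
        (∀ u, HasSum (fun n => tensor (multOp (resBCF m hl ha hz n) (modeComponent m l a u n))
          (transverseMode l a n)) (R u)) ∧
        ∀ u, ‖R u‖ ≤ C / Metric.infDist z (spectralSet l a) * ‖u‖ := by
  obtain ⟨C, hC, h1, h2⟩ := (isRieszBasis_transverseMode hl ha).exists_besselBound
  refine ⟨C, hC, fun z hz => ?_⟩
  obtain ⟨R, hR, hb⟩ := exists_componentwise (m := m) hC h1 h2
    (inv_nonneg.2 Metric.infDist_nonneg) (norm_multOp_resBCF_le hl ha hz)
  exact ⟨R, resolvent_componentwise hl ha hz hR, hR, hb⟩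

/-- The spectral set lies in Im ≤ -c; with γ = c/2 the closed half-plane Im z ≥ -γ keeps distance at
least γ from it. -/
theorem exists_infDist_ge (hl : 0 < l) (ha : 0 < a) :
    ∃ γ > 0, ∀ z : ℂ, -γ ≤ z.im → z ∉ spectralSet l a ∧
      γ ≤ Metric.infDist z (spectralSet l a) := by
  obtain ⟨c, hc, h⟩ := exists_gap hl ha
    (fun n => (transverseRoot_spec hl ha n).1) (fun n => (transverseRoot_spec hl ha n).2)
  have him : ∀ s ∈ spectralSet l a, s.im ≤ -c := by
    rintro _ ⟨n, r, -, rfl⟩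
    rw [Complex.add_im, Complex.ofReal_im, add_zero]
    exact h n
  refine ⟨c / 2, by positivity, fun z hz => ⟨fun hmem => ?_, ?_⟩⟩
  · have := him z hmem
    linarith
  · refine (Metric.le_infDist (spectralSet_nonempty l a)).2 fun s hs => ?_
    have h1 := Complex.abs_im_le_norm (z - s)
    rw [dist_eq_norm]
    have h2 := le_abs_self (z - s).im
    rw [Complex.sub_im] at h1 h2
    linarith [him s hs]

end Resolvent

end Waveguide

end

theorem proposition4p3 (d : ℕ) (hd : 2 ≤ d) (l a : ℝ) (hl : 0 < l) (ha : 0 < a) :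
    -- the objects `λ_n(a)` and `φ_n(a)` are well defined
    (∀ n : ℕ, ∃! lam : ℂ, IsTransverseRoot l a n lam) ∧
    {μ : ℂ | IsEigenvalue (transverseOp l a) μ}
      = Set.range (fun n : ℕ => transverseRoot l a n ^ 2) ∧
    IsRieszBasis (transverseMode l a) ∧
    -- the diagonalization of `H_a`
    (∀ u : (guideOp (d - 1) l a).domain,
      ∃ h : ∀ n : ℕ, modeComponent (d - 1) l a (u : L2 (guide (d - 1) l)) n
          ∈ (negLaplacian (d - 1)).domain,
        HasSum
          (fun n : ℕ => tensor
            (negLaplacian (d - 1) ⟨modeComponent (d - 1) l a (u : L2 (guide (d - 1) l)) n, h n⟩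
              + transverseRoot l a n ^ 2 • modeComponent (d - 1) l a (u : L2 (guide (d - 1) l)) n)
            (transverseMode l a n))
          (guideOp (d - 1) l a u)) ∧
    -- the resolvent of `H_a`
    (∀ z : ℂ, z ∉ spectralSet l a →
      z ∈ opResolventSet (guideOp (d - 1) l a) ∧
      (∀ n : ℕ, z - transverseRoot l a n ^ 2 ∈ opResolventSet (negLaplacian (d - 1))) ∧
      ∀ u : L2 (guide (d - 1) l),
        HasSum
          (fun n : ℕ => tensor
            (opResolvent (negLaplacian (d - 1)) (z - transverseRoot l a n ^ 2)
              (modeComponent (d - 1) l a u n))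
            (transverseMode l a n))
          (opResolvent (guideOp (d - 1) l a) z u)) ∧
    (∃ C : ℝ, 0 ≤ C ∧ ∀ z : ℂ, z ∉ spectralSet l a → ∀ u : L2 (guide (d - 1) l),
      ‖opResolvent (guideOp (d - 1) l a) z u‖
        ≤ C / Metric.infDist z (spectralSet l a) * ‖u‖) ∧
    -- the spectral gap and the uniform resolvent bound
    (∃ γ : ℝ, 0 < γ ∧ ∃ C : ℝ, 0 ≤ C ∧ ∀ z : ℂ, -γ ≤ z.im →
      z ∈ opResolventSet (guideOp (d - 1) l a) ∧
      ‖opResolvent (guideOp (d - 1) l a) z‖ ≤ C) := by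

  obtain ⟨C, hC, hres⟩ := exists_resolvent (d - 1) hl ha
  refine ⟨existsUnique_transverseRoot hl ha, transverse_eigenvalues hl ha,
    isRieszBasis_transverseMode hl ha, fun u => ⟨mem_domain_modeComponent u, ?_⟩,
    fun z hz => ?_, ⟨C, hC, fun z hz u => ?_⟩, ?_⟩
  -- The summands are the terms of the expansion of H_a u along the modes, so no separate
  -- convergence argument is needed.
  · simp only [← modeComponent_guideOp hl ha u]
    exact hasSum_tensor_component (isRieszBasis_transverseMode hl ha) _
  · obtain ⟨R, hR, hsum, -⟩ := hres z hz
    refine ⟨⟨R, hR⟩, fun n => ⟨_, isResolventAt_negLaplacian_sub hl ha hz n⟩, fun u => ?_⟩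
    -- The resolvents are defined by choice; uniqueness of the inverse identifies them with the
    -- operators constructed here.
    simp only [hR.opResolvent_eq,
      fun n => (isResolventAt_negLaplacian_sub (m := d - 1) hl ha hz n).opResolvent_eq]
    exact hsum u
  · obtain ⟨R, hR, -, hb⟩ := hres z hz
    rw [hR.opResolvent_eq]
    exact hb u
  · obtain ⟨γ, hγ, hgap⟩ := exists_infDist_ge hl ha
    refine ⟨γ, hγ, C / γ, by positivity, fun z hz => ?_⟩
    obtain ⟨hz', hd'⟩ := hgap z hz
    obtain ⟨R, hR, -, hb⟩ := hres z hz'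
    refine ⟨⟨R, hR⟩, ?_⟩
    rw [hR.opResolvent_eq]
    refine R.opNorm_le_bound (by positivity) fun u => (hb u).trans ?_
    gcongr
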